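/- Let $X$ be a locally Noetherian scheme and let $\mathcal E$ be a locally free $\mathcal O_X$-module of finite rank $n>0$ (the sheaf of sections of a vector bundle of rank $n$ on $X$). Put $\mathcal E^\vee=\mathcal Hom_{\mathcal O_X}(\mathcal E,\mathcal O_X)$, $\mathcal A_i=\mathrm{Sym}^i_{\mathcal O_X}\mathcal E^\vee$, $\mathcal A=\bigoplus_{i\ge 0}\mathcal A_i$ and $\mathcal I=\bigoplus_{i>0}\mathcal A_i\subset\mathcal A$. Let $\mathcal P=\mathcal Proj_X\mathcal A$ with projection $\bar\pi:\mathcal P\to X$. Let $\mathcal G=\bigoplus_{p\in\mathbb Z}\mathcal G_p$ be a graded $\mathcal A$-module, and let $\mathcal G(p)$ denote the shift $\mathcal G(p)_i=\mathcal G_{p+i}$. The graded localization of $\mathcal G$ is the graded $\mathcal A$-module $\mathcal G(*\mathcal I)$ with $$\mathcal G(*\mathcal I)_p=\varinjlim_k\,\mathcal Hom_{\mathcal A}(\mathcal I^k,\mathcal G(p))\qquad(p\in\mathbb Z),$$ where $\mathcal Hom_{\mathcal A}$ is the sheaf of $\mathcal A$-linear morphisms preserving degrees, and the limit is an inductive limit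 of sheaves of $\mathcal O_X$-modules along the restrictions to $\mathcal I^{k'}\subset\mathcal I^k$ for $k'\ge k$. Let $\widetilde{\mathcal G}(p)$ be the sheaf on $\mathcal P$ associated with $\mathcal G(p)$: its sections are locally the fractions $m/g$ with $g\in\mathcal A_d$ and $m\in\mathcal G_{d+p}$ for some $d\ge 0$. A morphism $\varphi:\mathcal I^k\to\mathcal G(p)$ of graded $\mathcal A$-modules over an open subset $U\subset X$ induces a morphism $\mathcal O_{\mathcal P}=\widetilde{\mathcal I^k}\to\widetilde{\mathcal G}(p)$ over $\bar\pi^{-1}(U)$, and we send $\varphi$ to the image of the section $1$, that is, to the section of $\widetilde{\mathcal G}(p)$ given by $\varphi(g)/g$ wherever $g$ is a homogeneous local section of $\mathcal I^k$ which does not vanish. These maps define a canonical morphism $$\mathcal G(*\mathcal I)\longrightarrow\bigoplus_{p\in\mathbb Z}\bar\pi_*\widetilde{\mathcal G}(p).$$ If $\mathcal G$ is quasi-coherent, then this morphism is an isomorphism of graded $\mathcal A$-modules: it is compatible with the actions of the $\mathcal A_i$ on both sides, and it is an isomorphism of $\mathcal O_X$-modules $\mathcal G(*\mathcal I)_p\to\bar\pi_*\widetilde{\mathcal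 G}(p)$ in each degree $p$, hence on the direct sums over $p\in\mathbb Z$. -/

import Mathlib

open CategoryTheory AlgebraicGeometry TopologicalSpace Opposite

universe u

noncomputable section

namespace GradedLocalization

/-- Presheaves of modules over a presheaf of commutative rings on a topological space. -/
abbrev PMod {X : TopCat.{u}} (R : TopCat.Presheaf CommRingCat.{u} X) :=
  PresheafOfModules.{u} (R ⋙ forget₂ CommRingCat.{u} RingCat.{u})

/-- The ring of sections over `U`. -/
abbrev RSec {X : TopCat.{u}} (R : TopCat.Presheaf CommRingCat.{u} X) (U : Opens X) : Type u :=
  R.obj (op U)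

/-- The module of sections over `U`. -/
abbrev MSec {X : TopCat.{u}} {R : TopCat.Presheaf CommRingCat.{u} X} (M : PMod R) (U : Opens X) :
    Type u :=
  M.obj (op U)

/-- Restriction of ring sections. -/
def rres {X : TopCat.{u}} (R : TopCat.Presheaf CommRingCat.{u} X) {U V : Opens X} (h : V ≤ U) :
    RSec R U →+* RSec R V :=
  (R.map (homOfLE h).op).hom

/-- Restriction of module sections. -/
def mres {X : TopCat.{u}} {R : TopCat.Presheaf CommRingCat.{u} X} (M : PMod R) {U V : Opens X}
    (h : V ≤ U) : MSec M U →+ MSec M V :=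
  (M.presheaf.map (homOfLE h).op).hom

section Lemmas

variable {X : TopCat.{u}} {R : TopCat.Presheaf CommRingCat.{u} X} (M : PMod R) {U V W : Opens X}

theorem rres_rres (h : V ≤ U) (h' : W ≤ V) (r : RSec R U) :
    rres R h' (rres R h r) = rres R (h'.trans h) r := by
  simp only [rres, ← CommRingCat.comp_apply, ← R.map_comp]
  rfl

theorem rres_self (h : U ≤ U) (r : RSec R U) : rres R h r = r := by
  have : (homOfLE h).op = 𝟙 (op U) := rfl
  simp [rres]

theorem mres_mres (h : V ≤ U) (h' : W ≤ V) (m : MSec M U) :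
    mres M h' (mres M h m) = mres M (h'.trans h) m := by
  have := congrArg (fun f => f.hom m) (M.presheaf.map_comp (homOfLE h).op (homOfLE h').op)
  exact this.symm

theorem mres_self (h : U ≤ U) (m : MSec M U) : mres M h m = m := by
  have := congrArg (fun f => f.hom m) (M.presheaf.map_id (op U))
  exact this

theorem mres_smul (h : V ≤ U) (r : RSec R U) (m : MSec M U) :
    mres M h (r • m) = rres R h r • mres M h m :=
  M.map_smul (homOfLE h).op r m

end Lemmas

/-- `𝓗om_R(M, N)(U)`: the `R`-linear morphisms `M|_U ⟶ N|_U`, that is, the families of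
`R(V)`-linear maps `M(V) → N(V)`, for `V ⊆ U` open, which commute with restriction. -/
def homSec {X : TopCat.{u}} {R : TopCat.Presheaf CommRingCat.{u} X} (M N : PMod R) (U : Opens X) :
    AddSubgroup (∀ V : {V : Opens X // V ≤ U}, MSec M V.1 →ₗ[RSec R V.1] MSec N V.1) where
  carrier := {φ | ∀ (V W : {V : Opens X // V ≤ U}) (h : W.1 ≤ V.1) (s : MSec M V.1),
    mres N h (φ V s) = φ W (mres M h s)}
  add_mem' := by
    intro φ ψ hφ hψ V W h s
    simp only [Pi.add_apply, LinearMap.add_apply, map_add, hφ V W h s, hψ V W h s]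
  zero_mem' := by intro V W h s; simp
  neg_mem' := by
    intro φ hφ V W h s
    simp only [Pi.neg_apply, LinearMap.neg_apply, map_neg, hφ V W h s]

section HomSec

variable {X : TopCat.{u}} {R : TopCat.Presheaf CommRingCat.{u} X} {M N : PMod R} {U V W : Opens X}

/-- Evaluation of a section of `𝓗om_R(M, N)` on a smaller open subset. -/
def homApp (φ : homSec M N U) (h : V ≤ U) : MSec M V →ₗ[RSec R V] MSec N V := φ.1 ⟨V, h⟩

theorem homSec_ext {φ ψ : homSec M N U}
    (H : ∀ (V : Opens X) (h : V ≤ U) (s : MSec M V), homApp φ h s = homApp ψ h s) : φ = ψ := by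
  apply Subtype.ext
  funext V
  exact LinearMap.ext fun s => H V.1 V.2 s

theorem mres_homApp (φ : homSec M N U) (h : V ≤ U) (h' : W ≤ V) (s : MSec M V) :
    mres N h' (homApp φ h s) = homApp φ (h'.trans h) (mres M h' s) :=
  φ.2 ⟨V, h⟩ ⟨W, h'.trans h⟩ h' s

instance : Module (RSec R U) (homSec M N U) where
  smul r φ := ⟨fun V => rres R V.2 r • φ.1 V, by
    intro V W h s
    have := φ.2 V W h s
    simp only [LinearMap.smul_apply, mres_smul, rres_rres, this]⟩
  one_smul φ := by
    apply Subtype.ext; funext V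
    change rres R V.2 1 • φ.1 V = φ.1 V
    rw [map_one, one_smul]
  mul_smul r s φ := by
    apply Subtype.ext; funext V
    change rres R V.2 (r * s) • φ.1 V = rres R V.2 r • rres R V.2 s • φ.1 V
    rw [map_mul, mul_smul]
  smul_zero r := by
    apply Subtype.ext; funext V
    change rres R V.2 r • (0 : MSec M V.1 →ₗ[RSec R V.1] MSec N V.1) = 0
    rw [smul_zero]
  smul_add r φ ψ := by
    apply Subtype.ext; funext V
    change rres R V.2 r • (φ.1 V + ψ.1 V) = rres R V.2 r • φ.1 V + rres R V.2 r • ψ.1 V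
    rw [smul_add]
  add_smul r s φ := by
    apply Subtype.ext; funext V
    change rres R V.2 (r + s) • φ.1 V = rres R V.2 r • φ.1 V + rres R V.2 s • φ.1 V
    rw [map_add, add_smul]
  zero_smul φ := by
    apply Subtype.ext; funext V
    change rres R V.2 0 • φ.1 V = 0
    rw [map_zero, zero_smul]

theorem homApp_smul (r : RSec R U) (φ : homSec M N U) (h : V ≤ U) (s : MSec M V) :
    homApp (r • φ) h s = rres R h r • homApp φ h s := rfl

theorem homApp_add (φ ψ : homSec M N U) (h : V ≤ U) (s : MSec M V) :
    homApp (φ + ψ) h s = homApp φ h s + homApp ψ h s := rfl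

/-- Restriction of sections of `𝓗om_R(M, N)`. -/
def homRes (h : V ≤ U) : homSec M N U →+ homSec M N V where
  toFun φ := ⟨fun W => φ.1 ⟨W.1, W.2.trans h⟩, fun W₁ W₂ h' s => φ.2 ⟨W₁.1, _⟩ ⟨W₂.1, _⟩ h' s⟩
  map_zero' := rfl
  map_add' _ _ := rfl

theorem homApp_homRes (φ : homSec M N U) (h : V ≤ U) (h' : W ≤ V) (s : MSec M W) :
    homApp (homRes h φ) h' s = homApp φ (h'.trans h) s := rfl

theorem homRes_smul (h : V ≤ U) (r : RSec R U) (φ : homSec M N U) :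
    homRes h (r • φ) = rres R h r • homRes h φ := by
  refine homSec_ext fun W h' s => ?_
  simp only [homApp_homRes, homApp_smul, rres_rres]

/-- The gluing of sections for the sheaf `N`. -/
theorem exists_glue {ι : Type u} (hN : TopCat.Presheaf.IsSheaf N.presheaf) (V : ι → Opens X)
    (hV : U = iSup V) (s : ∀ i, MSec N (V i))
    (hs : ∀ i j, mres N (inf_le_left : V i ⊓ V j ≤ V i) (s i) =
      mres N (inf_le_right : V i ⊓ V j ≤ V j) (s j)) :
    ∃! t : MSec N U, ∀ i (h : V i ≤ U), mres N h t = s i := by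
  subst hV
  obtain ⟨t, ht, ht'⟩ := ((TopCat.Presheaf.isSheaf_iff_isSheafUniqueGluing N.presheaf).1 hN) V s
    (fun i j => hs i j)
  exact ⟨t, fun i h => ht i, fun t' h => ht' t' fun i => h i _⟩

theorem eq_of_locally {ι : Type u} (hN : TopCat.Presheaf.IsSheaf N.presheaf) (V : ι → Opens X)
    (hV : U = iSup V) (s t : MSec N U)
    (hs : ∀ i (h : V i ≤ U), mres N h s = mres N h t) : s = t := by
  have hle : ∀ i, V i ≤ U := fun i => hV ▸ le_iSup V i
  obtain ⟨t', -, h'⟩ := exists_glue hN V hV (fun i => mres N (hle i) s)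
    (fun i j => by rw [mres_mres, mres_mres])
  rw [h' s fun i h => rfl, h' t fun i h => (hs i h).symm]

end HomSec




section Glue

variable {X : TopCat.{u}} {R : TopCat.Presheaf CommRingCat.{u} X} {M N : PMod R} {U : Opens X}

/-- Sections of `𝓗om_R(M, N)` glue uniquely when `N` is a sheaf. -/
theorem existsUnique_homSec {ι : Type u} (hN : TopCat.Presheaf.IsSheaf N.presheaf)
    (V : ι → Opens X) (hV : U = iSup V) (φ : ∀ i, homSec M N (V i))
    (hφ : ∀ i j, homRes (inf_le_left : V i ⊓ V j ≤ V i) (φ i) =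
      homRes (inf_le_right : V i ⊓ V j ≤ V j) (φ j)) :
    ∃! ψ : homSec M N U, ∀ i (h : V i ≤ U), homRes h ψ = φ i := by
  have hW : ∀ W : {W : Opens X // W ≤ U}, W.1 = iSup fun i => W.1 ⊓ V i := by
    intro W
    rw [← inf_iSup_eq, ← hV, inf_eq_left.2 W.2]
  have key : ∀ (W : {W : Opens X // W ≤ U}) (s : MSec M W.1), ∃! t : MSec N W.1,
      ∀ i (h : W.1 ⊓ V i ≤ W.1),
        mres N h t = homApp (φ i) inf_le_right (mres M h s) := by
    intro W s
    refine exists_glue hN (fun i => W.1 ⊓ V i) (hW W)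
      (fun i => homApp (φ i) inf_le_right (mres M inf_le_left s)) fun i j => ?_
    have h₁ : (W.1 ⊓ V i) ⊓ (W.1 ⊓ V j) ≤ V i ⊓ V j :=
      inf_le_inf inf_le_right inf_le_right
    rw [mres_homApp, mres_homApp, mres_mres, mres_mres]
    have := congrArg (fun ψ => homApp ψ h₁ (mres M (inf_le_left.trans inf_le_left) s)) (hφ i j)
    exact this
  choose t ht ht' using key
  have eq_of : ∀ (W : {W : Opens X // W ≤ U}) (a b : MSec N W.1),
      (∀ i (h : W.1 ⊓ V i ≤ W.1), mres N h a = mres N h b) → a = b := fun W a b h =>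
    eq_of_locally hN (fun i => W.1 ⊓ V i) (hW W) a b h
  refine ⟨⟨fun W => ⟨⟨t W, fun a b => eq_of _ _ _ fun i h => ?_⟩,
    fun r a => eq_of _ _ _ fun i h => ?_⟩, fun W₁ W₂ h s => ?_⟩, fun i h => ?_, fun ψ hψ => ?_⟩
  · rw [map_add, ht _ _ i h, ht _ _ i h, ht _ _ i h, map_add, map_add]
  · dsimp only [RingHom.id_apply]
    rw [ht _ _ i h, mres_smul, map_smul, mres_smul, ht _ _ i h]
  · change mres N h (t W₁ s) = t W₂ (mres M h s)
    refine eq_of _ _ _ fun i h' => ?_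
    have h₁ : W₂.1 ⊓ V i ≤ W₁.1 ⊓ V i := inf_le_inf_right _ h
    rw [ht _ _ i h', mres_mres, mres_mres, ← mres_mres N inf_le_left h₁, ht _ _ i, mres_homApp,
      mres_mres]
  · refine homSec_ext fun W h' s => ?_
    rw [homApp_homRes]
    refine eq_of ⟨W, h'.trans h⟩ _ _ fun j h'' => ?_
    change mres N h'' (t ⟨W, h'.trans h⟩ s) = _
    rw [ht _ _ j h'', mres_homApp]
    have h₁ : W ⊓ V j ≤ V i ⊓ V j := inf_le_inf_right _ h'
    have := congrArg (fun ψ => homApp ψ h₁ (mres M inf_le_left s)) (hφ i j)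
    exact this.symm
  · refine homSec_ext fun W h s => ?_
    refine ht' ⟨W, h⟩ s _ fun i h' => ?_
    rw [mres_homApp]
    have hi : V i ≤ U := hV ▸ le_iSup V i
    rw [← hψ i hi, homApp_homRes]

end Glue

/-- The presheaf of `R`-modules `𝓗om_R(M, N)`; it is a sheaf when `N` is one. -/
def homPMod {X : TopCat.{u}} {R : TopCat.Presheaf CommRingCat.{u} X} (M N : PMod R) : PMod R :=
  letI P : (Opens X)ᵒᵖ ⥤ Ab.{u} :=
    { obj := fun U => AddCommGrpCat.of (homSec M N U.unop)
      map := fun f => AddCommGrpCat.ofHom (homRes f.unop.le)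
      map_id := fun _ => rfl
      map_comp := fun _ _ => rfl }
  letI (U : (Opens X)ᵒᵖ) : Module ((R ⋙ forget₂ CommRingCat.{u} RingCat.{u}).obj U) (P.obj U) :=
    inferInstanceAs (Module (RSec R U.unop) (homSec M N U.unop))
  PresheafOfModules.ofPresheaf P fun _ _ f r φ => homRes_smul f.unop.le r φ

theorem homPMod_isSheaf {X : TopCat.{u}} {R : TopCat.Presheaf CommRingCat.{u} X} (M N : PMod R)
    (hN : TopCat.Presheaf.IsSheaf N.presheaf) :
    TopCat.Presheaf.IsSheaf (homPMod M N).presheaf := by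
  rw [TopCat.Presheaf.isSheaf_iff_isSheafUniqueGluing]
  intro ι V φ hφ
  obtain ⟨ψ, h, h'⟩ := existsUnique_homSec (M := M) hN V rfl φ hφ
  exact ⟨ψ, fun i => h i (le_iSup V i), fun ψ' h'' => h' ψ' fun i hi => h'' i⟩


/-! ### The symmetric algebra of a module -/

section Sym

variable {X : TopCat.{u}} {R : TopCat.Presheaf CommRingCat.{u} X} (F : PMod R) {U V W : Opens X}

/-- The map `Sym_{R(U)} F(U) → Sym_{R(V)} F(V)` induced by restriction. -/
def symRes (h : V ≤ U) :
    SymmetricAlgebra (RSec R U) (MSec F U) →+* SymmetricAlgebra (RSec R V) (MSec F V) :=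
  letI : Algebra (RSec R U) (SymmetricAlgebra (RSec R V) (MSec F V)) :=
    ((algebraMap (RSec R V) (SymmetricAlgebra (RSec R V) (MSec F V))).comp (rres R h)).toAlgebra
  (SymmetricAlgebra.lift (R := RSec R U) (M := MSec F U)
    { toFun := fun m => SymmetricAlgebra.ι (RSec R V) (MSec F V) (mres F h m)
      map_add' := fun m m' => by rw [map_add, map_add]
      map_smul' := fun r m => by
        rw [mres_smul, map_smul, Algebra.smul_def]
        exact (Algebra.smul_def r _).symm }).toRingHom

theorem symRes_algebraMap (h : V ≤ U) (r : RSec R U) :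
    symRes F h (algebraMap _ _ r) = algebraMap _ _ (rres R h r) := by
  let _ : Algebra (RSec R U) (SymmetricAlgebra (RSec R V) (MSec F V)) :=
    ((algebraMap (RSec R V) (SymmetricAlgebra (RSec R V) (MSec F V))).comp (rres R h)).toAlgebra
  exact AlgHom.commutes _ r

theorem symRes_ι (h : V ≤ U) (m : MSec F U) :
    symRes F h (SymmetricAlgebra.ι _ _ m) = SymmetricAlgebra.ι _ _ (mres F h m) := by
  let _ : Algebra (RSec R U) (SymmetricAlgebra (RSec R V) (MSec F V)) :=
    ((algebraMap (RSec R V) (SymmetricAlgebra (RSec R V) (MSec F V))).comp (rres R h)).toAlgebra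
  exact SymmetricAlgebra.lift_ι_apply _ m

theorem symRes_symRes (h : V ≤ U) (h' : W ≤ V) (a : SymmetricAlgebra (RSec R U) (MSec F U)) :
    symRes F h' (symRes F h a) = symRes F (h'.trans h) a := by
  induction a using SymmetricAlgebra.induction with
  | algebraMap r => simp only [symRes_algebraMap, rres_rres]
  | ι m => simp only [symRes_ι, mres_mres]
  | mul a b ha hb => simp only [map_mul, ha, hb]
  | add a b ha hb => simp only [map_add, ha, hb]

theorem symRes_self (h : U ≤ U) (a : SymmetricAlgebra (RSec R U) (MSec F U)) :
    symRes F h a = a := by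
  induction a using SymmetricAlgebra.induction with
  | algebraMap r => rw [symRes_algebraMap, rres_self]
  | ι m => rw [symRes_ι, mres_self]
  | mul a b ha hb => simp only [map_mul, ha, hb]
  | add a b ha hb => simp only [map_add, ha, hb]

/-- The presheaf of rings `U ↦ Sym_{R(U)} F(U)`. -/
def symPresheaf : TopCat.Presheaf CommRingCat.{u} X where
  obj U := CommRingCat.of (SymmetricAlgebra (RSec R U.unop) (MSec F U.unop))
  map f := CommRingCat.ofHom (symRes F f.unop.le)
  map_id _ := CommRingCat.hom_ext (RingHom.ext fun a => symRes_self F le_rfl a)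
  map_comp f g := CommRingCat.hom_ext (RingHom.ext fun a =>
    (symRes_symRes F f.unop.le g.unop.le a).symm)

/-- The `i`-th symmetric power `Symⁱ_{R(U)} F(U)`, as a submodule of the symmetric algebra. -/
def symPower (i : ℕ) (U : Opens X) :
    Submodule (RSec R U) (SymmetricAlgebra (RSec R U) (MSec F U)) :=
  LinearMap.range (SymmetricAlgebra.ι (RSec R U) (MSec F U)) ^ i

theorem symRes_mem (h : V ≤ U) (i : ℕ) {a : SymmetricAlgebra (RSec R U) (MSec F U)}
    (ha : a ∈ symPower F i U) : symRes F h a ∈ symPower F i V := by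
  induction i generalizing a with
  | zero =>
    rw [symPower, pow_zero, Submodule.mem_one] at ha ⊢
    obtain ⟨r, rfl⟩ := ha
    exact ⟨rres R h r, (symRes_algebraMap F h r).symm⟩
  | succ i ih =>
    rw [symPower, pow_succ] at ha ⊢
    induction ha using Submodule.mul_induction_on' with
    | mem_mul_mem a ha b hb =>
      rw [map_mul]
      refine Submodule.mul_mem_mul (ih ha) ?_
      obtain ⟨m, rfl⟩ := hb
      exact ⟨mres F h m, (symRes_ι F h m).symm⟩
    | add a _ b _ ha hb =>
      rw [map_add]
      exact add_mem ha hb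

end Sym

/-! ### Sheaves of algebras with homogeneous parts -/

/-- A sheaf of commutative `𝒪_X`-algebras `A` on a scheme together with subsheaves `A_i` (`i ≥ 0`) of
homogeneous sections of degree `i`, such that `𝒪_X → A_0` and `A_i A_j ⊆ A_{i+j}`.
Nothing else about the `A_i` enters the constructions below; they are only applied to the symmetric
algebra of a module, with its symmetric powers as homogeneous parts. -/
structure GrAlg (X : Scheme.{u}) where
  ring : TopCat.Presheaf CommRingCat.{u} X.toTopCat
  isSheaf : ring.IsSheaf
  /-- the structure morphism `𝒪_X → A` -/
  unit : X.presheaf ⟶ ring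
  /-- the sections of `A_i` over `U` -/
  deg (i : ℕ) (U : X.Opens) : AddSubgroup (RSec ring U)
  res_mem {i : ℕ} {U V : X.Opens} (h : V ≤ U) {a : RSec ring U} :
    a ∈ deg i U → rres ring h a ∈ deg i V
  unit_mem {U : X.Opens} (r : RSec X.presheaf U) : (unit.app (op U)).hom r ∈ deg 0 U
  mul_mem {i j : ℕ} {U : X.Opens} {a b : RSec ring U} :
    a ∈ deg i U → b ∈ deg j U → a * b ∈ deg (i + j) U
  of_locally {i : ℕ} {U : X.Opens} {a : RSec ring U} :
    (∀ x ∈ U, ∃ (V : X.Opens) (h : V ≤ U), x ∈ V ∧ rres ring h a ∈ deg i V) → a ∈ deg i U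

/-- The structure morphism `𝒪_X → A` on sections. -/
def aunit {X : Scheme.{u}} (A : GrAlg X) (U : X.Opens) : RSec X.presheaf U →+* RSec A.ring U :=
  (A.unit.app (op U)).hom

theorem rres_aunit {X : Scheme.{u}} (A : GrAlg X) {U V : X.Opens} (h : V ≤ U)
    (r : RSec X.presheaf U) :
    rres A.ring h (aunit A U r) = aunit A V (rres X.presheaf h r) :=
  (congrArg (fun f => f.hom r) (A.unit.naturality (homOfLE h).op)).symm

theorem aunit_mem {X : Scheme.{u}} (A : GrAlg X) {U : X.Opens} (r : RSec X.presheaf U) :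
    aunit A U r ∈ A.deg 0 U := A.unit_mem r

/-- The presheaf of modules underlying a sheaf of `𝒪_X`-modules. -/
def toPMod {X : Scheme.{u}} (E : X.Modules) : PMod X.presheaf := E.val

/-- The sheaf of `𝒪_X`-modules given by a presheaf of modules which is a sheaf. -/
def ofPMod {X : Scheme.{u}} (M : PMod X.presheaf) (hM : TopCat.Presheaf.IsSheaf M.presheaf) :
    X.Modules where
  val := M
  isSheaf := hM

/-- The dual `E^∨ = 𝓗om_{𝒪_X}(E, 𝒪_X)`. -/
def dual {X : Scheme.{u}} (E : X.Modules) : X.Modules :=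
  ofPMod (homPMod (toPMod E) (toPMod (SheafOfModules.unit X.ringCatSheaf)))
    (homPMod_isSheaf _ _ (SheafOfModules.unit X.ringCatSheaf).isSheaf)

section SymAlg

variable {X : Scheme.{u}} (F : X.Modules)

/-- The sheaf of rings associated with `U ↦ Sym_{𝒪_X(U)} F(U)`. -/
def symRing : TopCat.Sheaf CommRingCat.{u} X.toTopCat :=
  (presheafToSheaf (Opens.grothendieckTopology X.toTopCat) CommRingCat.{u}).obj
    (symPresheaf (toPMod F))

/-- The canonical morphism from the presheaf `U ↦ Sym_{𝒪_X(U)} F(U)` to the associated sheaf. -/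
def toSymRing : symPresheaf (toPMod F) ⟶ (symRing F).obj :=
  toSheafify (Opens.grothendieckTopology X.toTopCat) (symPresheaf (toPMod F))

/-- `toSymRing` on sections. -/
def toSymSec (U : X.Opens) :
    SymmetricAlgebra (RSec X.presheaf U) (MSec (toPMod F) U) →+* RSec (symRing F).obj U :=
  ((toSymRing F).app (op U)).hom

theorem rres_toSymSec {U V : X.Opens} (h : V ≤ U)
    (a : SymmetricAlgebra (RSec X.presheaf U) (MSec (toPMod F) U)) :
    rres (symRing F).obj h (toSymSec F U a) = toSymSec F V (symRes (toPMod F) h a) :=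
  (congrArg (fun f => f.hom a) ((toSymRing F).naturality (homOfLE h).op)).symm

/-- The structure morphism `𝒪_X → Sym F`. -/
def symUnit : X.presheaf ⟶ (symRing F).obj where
  app U := CommRingCat.ofHom ((toSymSec F U.unop).comp (algebraMap _ _))
  naturality U V f := by
    refine CommRingCat.hom_ext (RingHom.ext fun r => ?_)
    change toSymSec F V.unop (algebraMap _ _ (rres X.presheaf f.unop.le r)) =
      rres (symRing F).obj f.unop.le (toSymSec F U.unop (algebraMap _ _ r))
    rw [rres_toSymSec, symRes_algebraMap]

/-- The symmetric algebra `Sym_{𝒪_X} F = ⨁_i Symⁱ F`; the sections of `Symⁱ F` are those which come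
locally from the symmetric powers `Symⁱ_{𝒪_X(V)} F(V)`. -/
def symAlg : GrAlg X where
  ring := (symRing F).obj
  isSheaf := (symRing F).property
  unit := symUnit F
  deg i U :=
    { carrier := {a | ∀ x ∈ U, ∃ (V : X.Opens) (h : V ≤ U), x ∈ V ∧
        ∃ t ∈ symPower (toPMod F) i V, rres (symRing F).obj h a = toSymSec F V t}
      add_mem' := by
        intro a b ha hb x hx
        obtain ⟨V, hV, hxV, s, hs, h⟩ := ha x hx
        obtain ⟨W, hW, hxW, t, ht, h'⟩ := hb x hx
        refine ⟨V ⊓ W, inf_le_left.trans hV, ⟨hxV, hxW⟩,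
          symRes (toPMod F) inf_le_left s + symRes (toPMod F) inf_le_right t,
          add_mem (symRes_mem _ _ _ hs) (symRes_mem _ _ _ ht), ?_⟩
        rw [map_add, map_add, ← rres_toSymSec, ← rres_toSymSec, ← h, ← h', rres_rres, rres_rres]
      zero_mem' := fun x hx => ⟨U, le_rfl, hx, 0, zero_mem _, by rw [map_zero, map_zero]⟩
      neg_mem' := by
        intro a ha x hx
        obtain ⟨V, hV, hxV, s, hs, h⟩ := ha x hx
        exact ⟨V, hV, hxV, -s, neg_mem hs, by rw [map_neg, map_neg, h]⟩ }
  res_mem := by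
    intro i U W h a ha x hx
    obtain ⟨V, hV, hxV, s, hs, h'⟩ := ha x (h hx)
    refine ⟨W ⊓ V, inf_le_left, ⟨hx, hxV⟩, symRes (toPMod F) inf_le_right s,
      symRes_mem _ _ _ hs, ?_⟩
    rw [← rres_toSymSec, ← h', rres_rres, rres_rres]
  unit_mem := by
    intro U r x hx
    refine ⟨U, le_rfl, hx, algebraMap _ _ r, ?_, ?_⟩
    · rw [symPower, pow_zero]
      exact Submodule.mem_one.2 ⟨r, rfl⟩
    · rw [rres_self]
      rfl
  mul_mem := by
    intro i j U a b ha hb x hx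
    obtain ⟨V, hV, hxV, s, hs, h⟩ := ha x hx
    obtain ⟨W, hW, hxW, t, ht, h'⟩ := hb x hx
    refine ⟨V ⊓ W, inf_le_left.trans hV, ⟨hxV, hxW⟩,
      symRes (toPMod F) inf_le_left s * symRes (toPMod F) inf_le_right t, ?_, ?_⟩
    · rw [symPower, pow_add]
      exact Submodule.mul_mem_mul (symRes_mem _ _ _ hs) (symRes_mem _ _ _ ht)
    · rw [map_mul, map_mul, ← rres_toSymSec, ← rres_toSymSec, ← h, ← h', rres_rres, rres_rres]
  of_locally := by
    intro i U a ha x hx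
    obtain ⟨V, hV, hxV, h⟩ := ha x hx
    obtain ⟨W, hW, hxW, t, ht, h'⟩ := h x hxV
    exact ⟨W, hW.trans hV, hxW, t, ht, by rw [← h', rres_rres]⟩

end SymAlg


/-! ### Graded modules, powers of the irrelevant ideal, graded localization -/

/-- A graded `A`-module: a sheaf of `A`-modules `G` with subsheaves `G_p` (`p ∈ ℤ`) such that
`A_i G_p ⊆ G_{i+p}` and such that `G` is the direct sum (as a sheaf) of the `G_p`. -/
structure GrMod {X : Scheme.{u}} (A : GrAlg X) where
  mod : PMod A.ring
  isSheaf : TopCat.Presheaf.IsSheaf mod.presheaf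
  /-- the sections of `G_p` over `U` -/
  deg (p : ℤ) (U : X.Opens) : AddSubgroup (MSec mod U)
  res_mem {p : ℤ} {U V : X.Opens} (h : V ≤ U) {m : MSec mod U} :
    m ∈ deg p U → mres mod h m ∈ deg p V
  of_locally {p : ℤ} {U : X.Opens} {m : MSec mod U} :
    (∀ x ∈ U, ∃ (V : X.Opens) (h : V ≤ U), x ∈ V ∧ mres mod h m ∈ deg p V) → m ∈ deg p U
  smul_mem {i : ℕ} {p : ℤ} {U : X.Opens} {a : RSec A.ring U} {m : MSec mod U} :
    a ∈ A.deg i U → m ∈ deg p U → a • m ∈ deg (i + p) U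
  iSupIndep_deg (U : X.Opens) : iSupIndep fun p => deg p U
  exists_mem_iSup_deg {U : X.Opens} (m : MSec mod U) {x : X} (hx : x ∈ U) :
    ∃ (V : X.Opens) (h : V ≤ U), x ∈ V ∧ mres mod h m ∈ ⨆ p, deg p V

/-- The `𝒪_X`-module underlying a graded `A`-module. -/
def GrMod.toModules {X : Scheme.{u}} {A : GrAlg X} (G : GrMod A) : X.Modules :=
  ofPMod ((PresheafOfModules.restrictScalars
    (Functor.whiskerRight A.unit (forget₂ CommRingCat.{u} RingCat.{u}))).obj G.mod) G.isSheaf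

/-- A graded `A`-module is quasi-coherent if it is so as an `𝒪_X`-module. -/
def GrMod.IsQuasicoherent {X : Scheme.{u}} {A : GrAlg X} (G : GrMod A) : Prop :=
  SheafOfModules.IsQuasicoherent (R := X.ringCatSheaf) G.toModules

section Localization

variable {X : Scheme.{u}} (A : GrAlg X)

/-- The ideal of `A(U)` generated by the homogeneous sections of positive degree. -/
def positiveIdeal (U : X.Opens) : Ideal (RSec A.ring U) :=
  Ideal.span {a | ∃ i, 0 < i ∧ a ∈ A.deg i U}

theorem rres_mem_positiveIdeal_pow {U V : X.Opens} (h : V ≤ U) (k : ℕ) {a : RSec A.ring U}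
    (ha : a ∈ positiveIdeal A U ^ k) : rres A.ring h a ∈ positiveIdeal A V ^ k := by
  have h₁ : (positiveIdeal A U).map (rres A.ring h) ≤ positiveIdeal A V := by
    rw [positiveIdeal, Ideal.map_span, Ideal.span_le]
    rintro _ ⟨b, ⟨i, hi, hb⟩, rfl⟩
    exact Ideal.subset_span ⟨i, hi, A.res_mem h hb⟩
  have h₂ := Ideal.mem_map_of_mem (rres A.ring h) ha
  rw [Ideal.map_pow] at h₂
  exact Ideal.pow_right_mono h₁ k h₂

/-- The sections over `U` of the sheaf of ideals `I^k ⊆ A`, where `I = ⨁_{i > 0} A_i`: they belong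
locally to the `k`-th power of the ideal generated by the homogeneous sections of positive
degree. -/
def idealPow (k : ℕ) (U : X.Opens) : Ideal (RSec A.ring U) where
  carrier := {a | ∀ x ∈ U, ∃ (V : X.Opens) (h : V ≤ U), x ∈ V ∧
    rres A.ring h a ∈ positiveIdeal A V ^ k}
  add_mem' := by
    intro a b ha hb x hx
    obtain ⟨V, hV, hxV, h⟩ := ha x hx
    obtain ⟨W, hW, hxW, h'⟩ := hb x hx
    refine ⟨V ⊓ W, inf_le_left.trans hV, ⟨hxV, hxW⟩, ?_⟩
    rw [map_add, ← rres_rres hV inf_le_left a, ← rres_rres hW inf_le_right b]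
    exact add_mem (rres_mem_positiveIdeal_pow A _ k h) (rres_mem_positiveIdeal_pow A _ k h')
  zero_mem' := fun x hx => ⟨U, le_rfl, hx, by rw [map_zero]; exact zero_mem _⟩
  smul_mem' := by
    intro c a ha x hx
    obtain ⟨V, hV, hxV, h⟩ := ha x hx
    refine ⟨V, hV, hxV, ?_⟩
    rw [smul_eq_mul, map_mul]
    exact Ideal.mul_mem_left _ _ h

theorem rres_mem_idealPow (k : ℕ) {U V : X.Opens} (h : V ≤ U) {a : RSec A.ring U}
    (ha : a ∈ idealPow A k U) : rres A.ring h a ∈ idealPow A k V := by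
  intro x hx
  obtain ⟨W, hW, hxW, h'⟩ := ha x (h hx)
  refine ⟨V ⊓ W, inf_le_left, ⟨hx, hxW⟩, ?_⟩
  rw [rres_rres, ← rres_rres hW inf_le_right a]
  exact rres_mem_positiveIdeal_pow A _ k h'

theorem idealPow_le {k l : ℕ} (h : k ≤ l) (U : X.Opens) : idealPow A l U ≤ idealPow A k U := by
  intro a ha x hx
  obtain ⟨V, hV, hxV, h'⟩ := ha x hx
  exact ⟨V, hV, hxV, Ideal.pow_le_pow_right h h'⟩

/-- The sheaf of ideals `I^k` as an `A`-module. -/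
def idealPMod (k : ℕ) : PMod A.ring :=
  letI P : (X.Opens)ᵒᵖ ⥤ Ab.{u} :=
    { obj := fun U => AddCommGrpCat.of (idealPow A k U.unop)
      map := fun f => AddCommGrpCat.ofHom
        { toFun := fun a => ⟨rres A.ring f.unop.le a.1, rres_mem_idealPow A k _ a.2⟩
          map_zero' := Subtype.ext (map_zero _)
          map_add' := fun _ _ => Subtype.ext (map_add _ _ _) }
      map_id := fun _ => AddCommGrpCat.hom_ext
        (AddMonoidHom.ext fun a => Subtype.ext (rres_self _ a.1))
      map_comp := fun f g => AddCommGrpCat.hom_ext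
        (AddMonoidHom.ext fun a => Subtype.ext (rres_rres f.unop.le g.unop.le a.1).symm) }
  letI (U : (X.Opens)ᵒᵖ) :
      Module ((A.ring ⋙ forget₂ CommRingCat.{u} RingCat.{u}).obj U) (P.obj U) :=
    inferInstanceAs (Module (RSec A.ring U.unop) (idealPow A k U.unop))
  PresheafOfModules.ofPresheaf P fun _ _ _ _ _ => Subtype.ext (map_mul _ _ _)

/-- A section of `A` which belongs to `I^k`, as a section of `I^k`. -/
def mkIdeal (k : ℕ) {U : X.Opens} (a : RSec A.ring U) (ha : a ∈ idealPow A k U) :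
    MSec (idealPMod A k) U :=
  (⟨a, ha⟩ : idealPow A k U)

theorem mres_mkIdeal (k : ℕ) {U V : X.Opens} (h : V ≤ U) (a : RSec A.ring U)
    (ha : a ∈ idealPow A k U) :
    mres (idealPMod A k) h (mkIdeal A k a ha) =
      mkIdeal A k (rres A.ring h a) (rres_mem_idealPow A k h ha) := rfl

theorem smul_mkIdeal (k : ℕ) {U : X.Opens} (b a : RSec A.ring U) (ha : a ∈ idealPow A k U) :
    b • mkIdeal A k a ha = mkIdeal A k (b * a) (Ideal.mul_mem_left _ b ha) := rfl

/-- The inclusion `I^l ⊆ I^k` for `k ≤ l`, on sections. -/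
def idealIncl {k l : ℕ} (h : k ≤ l) (U : X.Opens) :
    MSec (idealPMod A l) U →ₗ[RSec A.ring U] MSec (idealPMod A k) U :=
  Submodule.inclusion (idealPow_le A h U)

variable {A} (G : GrMod A)

/-- The sections over `U` of `𝓗om_A(I^k, G)_p = 𝓗om_A(I^k, G(p))`: the `A`-linear morphisms
`I^k|_U → G|_U` which map `(I^k)_i` to `G_{i+p}` for all `i`. -/
def grHom (k : ℕ) (p : ℤ) (U : X.Opens) : AddSubgroup (homSec (idealPMod A k) G.mod U) where
  carrier := {φ | ∀ (V : X.Opens) (h : V ≤ U) (i : ℕ) (a : RSec A.ring V)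
    (ha : a ∈ idealPow A k V), a ∈ A.deg i V → homApp φ h (mkIdeal A k a ha) ∈ G.deg (i + p) V}
  add_mem' := fun hφ hψ V h i a ha hi => add_mem (hφ V h i a ha hi) (hψ V h i a ha hi)
  zero_mem' := fun V _ i _ _ _ => zero_mem (G.deg (i + p) V)
  neg_mem' := fun hφ V h i a ha hi => neg_mem (hφ V h i a ha hi)

/-- The product `a φ ∈ 𝓗om_A(I^k, G)_{i+p}` of `a ∈ A_i` and `φ ∈ 𝓗om_A(I^k, G)_p`. -/
def grHomMul {k : ℕ} {i : ℕ} {p : ℤ} {U : X.Opens} (a : A.deg i U) (φ : grHom G k p U) :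
    grHom G k (i + p) U :=
  ⟨a.1 • φ.1, fun V h j b hb hj => by
    rw [homApp_smul, show (j : ℤ) + (i + p) = i + (j + p) by ring]
    exact G.smul_mem (A.res_mem h a.2) (φ.2 V h j b hb hj)⟩

instance (k : ℕ) (p : ℤ) (U : X.Opens) : Module (RSec X.presheaf U) (grHom G k p U) where
  smul r φ := ⟨aunit A U r • φ.1, fun V h j b hb hj => by
    have := G.smul_mem (A.res_mem h (aunit_mem A r)) (φ.2 V h j b hb hj)
    rw [Nat.cast_zero, zero_add] at this
    exact this⟩
  one_smul φ := Subtype.ext <| by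
    change aunit A U (1 : RSec X.presheaf U) • φ.1 = φ.1
    rw [map_one, one_smul]
  mul_smul r s φ := Subtype.ext <| by
    change aunit A U (r * s) • φ.1 =
      aunit A U r • aunit A U s • φ.1
    rw [map_mul, mul_smul]
  smul_zero r := Subtype.ext (smul_zero (aunit A U r))
  smul_add r φ ψ := Subtype.ext (smul_add (aunit A U r) φ.1 ψ.1)
  add_smul r s φ := Subtype.ext <| by
    change aunit A U (r + s) • φ.1 =
      aunit A U r • φ.1 + aunit A U s • φ.1
    rw [map_add, add_smul]
  zero_smul φ := Subtype.ext <| by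
    change aunit A U (0 : RSec X.presheaf U) • φ.1 = 0
    rw [map_zero, zero_smul]

/-- Restriction of sections of `𝓗om_A(I^k, G)_p`. -/
def grHomRes (k : ℕ) (p : ℤ) {U V : X.Opens} (h : V ≤ U) : grHom G k p U →+ grHom G k p V where
  toFun φ := ⟨homRes h φ.1, fun W h' i a ha hi => φ.2 W (h'.trans h) i a ha hi⟩
  map_zero' := rfl
  map_add' _ _ := rfl

theorem grHomRes_smul (k : ℕ) (p : ℤ) {U V : X.Opens} (h : V ≤ U) (r : RSec X.presheaf U)
    (φ : grHom G k p U) :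
    grHomRes G k p h (r • φ) = rres X.presheaf h r • grHomRes G k p h φ :=
  Subtype.ext ((homRes_smul h (aunit A U r) φ.1).trans (by rw [rres_aunit]; rfl))

/-- The presheaf of `𝒪_X`-modules `𝓗om_A(I^k, G)_p`. -/
def grHomPMod (k : ℕ) (p : ℤ) : PMod X.presheaf :=
  letI P : (X.Opens)ᵒᵖ ⥤ Ab.{u} :=
    { obj := fun U => AddCommGrpCat.of (grHom G k p U.unop)
      map := fun f => AddCommGrpCat.ofHom (grHomRes G k p f.unop.le)
      map_id := fun _ => rfl
      map_comp := fun _ _ => rfl }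
  letI (U : (X.Opens)ᵒᵖ) :
      Module ((X.presheaf ⋙ forget₂ CommRingCat.{u} RingCat.{u}).obj U) (P.obj U) :=
    inferInstanceAs (Module (RSec X.presheaf U.unop) (grHom G k p U.unop))
  PresheafOfModules.ofPresheaf P fun _ _ f r φ => grHomRes_smul G k p f.unop.le r φ

theorem grHomPMod_isSheaf (k : ℕ) (p : ℤ) :
    TopCat.Presheaf.IsSheaf (grHomPMod G k p).presheaf := by
  rw [TopCat.Presheaf.isSheaf_iff_isSheafUniqueGluing]
  intro ι V φ hφ
  let φ' : ∀ i, grHom G k p (V i) := φ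
  obtain ⟨ψ, h, h'⟩ := existsUnique_homSec (M := idealPMod A k) G.isSheaf V rfl
    (fun i => (φ' i).1) (fun i j => congrArg Subtype.val (hφ i j))
  have hψ : ψ ∈ grHom G k p (iSup V) := by
    intro W hW i a ha hi
    refine G.of_locally fun x hx => ?_
    obtain ⟨j, hj⟩ := Opens.mem_iSup.1 (hW hx)
    refine ⟨W ⊓ V j, inf_le_left, ⟨hx, hj⟩, ?_⟩
    rw [mres_homApp, mres_mkIdeal, ← homApp_homRes ψ (le_iSup V j) inf_le_right, h j]
    exact (φ' j).2 _ inf_le_right i _ _ (A.res_mem inf_le_left hi)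
  refine ⟨(⟨ψ, hψ⟩ : grHom G k p (iSup V)),
    fun i => Subtype.ext (h i (le_iSup V i)), fun ψ' h'' => Subtype.ext ?_⟩
  exact h' _ fun i hi => congrArg Subtype.val (h'' i)

/-- The `𝒪_X`-module `𝓗om_A(I^k, G)_p`. -/
def grHomModules (k : ℕ) (p : ℤ) : X.Modules := ofPMod (grHomPMod G k p) (grHomPMod_isSheaf G k p)

/-- A morphism between the underlying presheaves of modules, as a morphism of `𝒪_X`-modules. -/
def ofPModHom {M N : PMod X.presheaf} {hM : TopCat.Presheaf.IsSheaf M.presheaf}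
    {hN : TopCat.Presheaf.IsSheaf N.presheaf} (f : M ⟶ N) : ofPMod M hM ⟶ ofPMod N hN :=
  SheafOfModules.Hom.mk f

/-- The map `𝓗om_A(I^k, G)_p → 𝓗om_A(I^l, G)_p`, for `k ≤ l`, induced by `I^l ⊆ I^k`. -/
def grHomTrans {k l : ℕ} (h : k ≤ l) (p : ℤ) (U : X.Opens) : grHom G k p U →+ grHom G l p U where
  toFun φ := ⟨⟨fun V => (φ.1.1 V).comp (idealIncl A h V.1), fun V W h' s =>
      φ.1.2 V W h' (idealIncl A h V.1 s)⟩,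
    fun V hV i a ha hi => φ.2 V hV i a (idealPow_le A h V ha) hi⟩
  map_zero' := rfl
  map_add' _ _ := rfl

/-- The inductive system `k ↦ 𝓗om_A(I^k, G)_p` of `𝒪_X`-modules. -/
def grHomSystem (p : ℤ) : ℕ ⥤ X.Modules where
  obj k := grHomModules G k p
  map f := ofPModHom (PresheafOfModules.homMk
    { app := fun U => AddCommGrpCat.ofHom (grHomTrans G f.le p U.unop)
      naturality := fun _ _ _ => rfl }
    fun _ _ _ => rfl)
  map_id _ := rfl
  map_comp _ _ := rfl

/-- The degree `p` part `G(*I)_p = lim_k 𝓗om_A(I^k, G)_p` of the graded localization. -/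
def grLoc (p : ℤ) : X.Modules := Limits.colimit (grHomSystem G p)

/-- The section of `G(*I)_p` defined by a section of `𝓗om_A(I^k, G)_p`. -/
def grLocι (k : ℕ) (p : ℤ) (U : X.Opens) : grHom G k p U →+ MSec (toPMod (grLoc G p)) U :=
  ((Limits.colimit.ι (grHomSystem G p) k).app U).hom

/-- The `𝒪_X`-module structure on the sections of `A_i`. -/
instance (i : ℕ) (U : X.Opens) : Module (RSec X.presheaf U) (A.deg i U) where
  smul r a := ⟨aunit A U r * a.1, by
    have := A.mul_mem (aunit_mem A r) a.2
    rwa [zero_add] at this⟩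
  one_smul a := Subtype.ext <| by
    change aunit A U (1 : RSec X.presheaf U) * a.1 = a.1
    rw [map_one, one_mul]
  mul_smul r s a := Subtype.ext <| by
    change aunit A U (r * s) * a.1 =
      aunit A U r * (aunit A U s * a.1)
    rw [map_mul, mul_assoc]
  smul_zero r := Subtype.ext (mul_zero (aunit A U r))
  smul_add r a b := Subtype.ext (mul_add (aunit A U r) a.1 b.1)
  add_smul r s a := Subtype.ext <| by
    change aunit A U (r + s) * a.1 =
      aunit A U r * a.1 + aunit A U s * a.1
    rw [map_add, add_mul]
  zero_smul a := Subtype.ext <| by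
    change aunit A U (0 : RSec X.presheaf U) * a.1 = 0
    rw [map_zero, zero_mul]

/-- Restriction of sections of `A_i`. -/
def degRes (i : ℕ) {U V : X.Opens} (h : V ≤ U) : A.deg i U →+ A.deg i V where
  toFun a := ⟨rres A.ring h a.1, A.res_mem h a.2⟩
  map_zero' := Subtype.ext (map_zero _)
  map_add' _ _ := Subtype.ext (map_add _ _ _)

theorem degRes_smul (i : ℕ) {U V : X.Opens} (h : V ≤ U) (r : RSec X.presheaf U) (a : A.deg i U) :
    degRes i h (r • a) = rres X.presheaf h r • degRes i h a := Subtype.ext <| by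
  change rres A.ring h (aunit A U r * a.1) =
    aunit A V (rres X.presheaf h r) * rres A.ring h a.1
  rw [map_mul, rres_aunit]

variable (A) in
/-- `A_i` as a presheaf of `𝒪_X`-modules. -/
def degPMod (i : ℕ) : PMod X.presheaf :=
  letI P : (X.Opens)ᵒᵖ ⥤ Ab.{u} :=
    { obj := fun U => AddCommGrpCat.of (A.deg i U.unop)
      map := fun f => AddCommGrpCat.ofHom (degRes i f.unop.le)
      map_id := fun _ => AddCommGrpCat.hom_ext
        (AddMonoidHom.ext fun a => Subtype.ext (rres_self _ a.1))
      map_comp := fun f g => AddCommGrpCat.hom_ext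
        (AddMonoidHom.ext fun a => Subtype.ext (rres_rres f.unop.le g.unop.le a.1).symm) }
  letI (U : (X.Opens)ᵒᵖ) :
      Module ((X.presheaf ⋙ forget₂ CommRingCat.{u} RingCat.{u}).obj U) (P.obj U) :=
    inferInstanceAs (Module (RSec X.presheaf U.unop) (A.deg i U.unop))
  PresheafOfModules.ofPresheaf P fun _ _ f r a => degRes_smul i f.unop.le r a

/-- The sheaf `𝓗om_{𝒪_X}(A_i, M)`. -/
def homDeg (i : ℕ) (M : X.Modules) : X.Modules :=
  ofPMod (homPMod (degPMod A i) (toPMod M)) (homPMod_isSheaf _ _ M.isSheaf)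

theorem mres_grLocι (k : ℕ) (p : ℤ) {U V : X.Opens} (h : V ≤ U) (φ : grHom G k p U) :
    mres (toPMod (grLoc G p)) h (grLocι G k p U φ) = grLocι G k p V (grHomRes G k p h φ) :=
  (PresheafOfModules.naturality_apply (Limits.colimit.ι (grHomSystem G p) k).val
    (homOfLE h).op φ).symm

theorem grLocι_smul (k : ℕ) (p : ℤ) {U : X.Opens} (r : RSec X.presheaf U) (φ : grHom G k p U) :
    grLocι G k p U (r • φ) = r • grLocι G k p U φ :=
  (Limits.colimit.ι (grHomSystem G p) k).app_smul r φ

theorem grLocι_trans {k l : ℕ} (h : k ≤ l) (p : ℤ) {U : X.Opens} (φ : grHom G k p U) :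
    grLocι G l p U (grHomTrans G h p U φ) = grLocι G k p U φ := by
  have := Limits.colimit.w (grHomSystem G p) (homOfLE h)
  exact congrArg (fun f => (f.app U).hom φ) this

theorem grHomMul_add {k i : ℕ} {p : ℤ} {U : X.Opens} (a b : A.deg i U) (φ : grHom G k p U) :
    grHomMul G (a + b) φ = grHomMul G a φ + grHomMul G b φ :=
  Subtype.ext (add_smul a.1 b.1 φ.1)

theorem grHomMul_smul {k i : ℕ} {p : ℤ} {U : X.Opens} (r : RSec X.presheaf U) (a : A.deg i U)
    (φ : grHom G k p U) : grHomMul G (r • a) φ = r • grHomMul G a φ :=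
  Subtype.ext (mul_smul (aunit A U r) a.1 φ.1)

theorem add_grHomMul {k i : ℕ} {p : ℤ} {U : X.Opens} (a : A.deg i U) (φ ψ : grHom G k p U) :
    grHomMul G a (φ + ψ) = grHomMul G a φ + grHomMul G a ψ :=
  Subtype.ext (smul_add a.1 φ.1 ψ.1)

theorem grHomMul_zero {k i : ℕ} {p : ℤ} {U : X.Opens} (a : A.deg i U) :
    grHomMul G a (0 : grHom G k p U) = 0 :=
  Subtype.ext (smul_zero a.1)

theorem smul_grHomMul {k i : ℕ} {p : ℤ} {U : X.Opens} (r : RSec X.presheaf U) (a : A.deg i U)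
    (φ : grHom G k p U) : grHomMul G a (r • φ) = r • grHomMul G a φ :=
  Subtype.ext (smul_comm a.1 (aunit A U r) φ.1)

theorem grHomRes_grHomMul {k i : ℕ} {p : ℤ} {U V : X.Opens} (h : V ≤ U) (a : A.deg i U)
    (φ : grHom G k p U) :
    grHomRes G k (i + p) h (grHomMul G a φ) = grHomMul G (degRes i h a) (grHomRes G k p h φ) :=
  Subtype.ext (homRes_smul h a.1 φ.1)

/-- Multiplication by `φ ∈ 𝓗om_A(I^k, G)_p(V)` as a map `A_i(V) → G(*I)_{i+p}(V)`. -/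
def grLocMulRight (i : ℕ) {k : ℕ} {p : ℤ} {V : X.Opens} (φ : grHom G k p V) :
    A.deg i V →ₗ[RSec X.presheaf V] MSec (toPMod (grLoc G (i + p))) V where
  toFun a := grLocι G k (i + p) V (grHomMul G a φ)
  map_add' a b := (congrArg (grLocι G k (i + p) V) (grHomMul_add G a b φ)).trans
    ((grLocι G k (i + p) V).map_add _ _)
  map_smul' r a := (congrArg (grLocι G k (i + p) V) (grHomMul_smul G r a φ)).trans
    (grLocι_smul G k (i + p) r _)

/-- The map `φ ↦ (a ↦ a φ)` from `𝓗om_A(I^k, G)_p` to `𝓗om_{𝒪_X}(A_i, G(*I)_{i+p})`,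
on sections. -/
def grHomAct (i k : ℕ) (p : ℤ) (U : X.Opens) :
    grHom G k p U →+ homSec (degPMod A i) (toPMod (grLoc G (i + p))) U where
  toFun φ := ⟨fun V => grLocMulRight G i (grHomRes G k p V.2 φ), fun V W h a =>
    (mres_grLocι G k (i + p) h (grHomMul G (i := i) a (grHomRes G k p V.2 φ))).trans
      (congrArg (grLocι G k (i + p) W.1)
        (grHomRes_grHomMul G (i := i) h a (grHomRes G k p V.2 φ)))⟩
  map_zero' := by
    refine Subtype.ext (funext fun V => LinearMap.ext fun a => ?_)
    refine (congrArg (grLocι G k (i + p) V.1) ?_).trans ((grLocι G k (i + p) V.1).map_zero)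
    exact grHomMul_zero G (i := i) a
  map_add' φ ψ := by
    refine Subtype.ext (funext fun V => LinearMap.ext fun a => ?_)
    refine (congrArg (grLocι G k (i + p) V.1) ?_).trans ((grLocι G k (i + p) V.1).map_add _ _)
    exact add_grHomMul G (i := i) a (grHomRes G k p V.2 φ) (grHomRes G k p V.2 ψ)

theorem homApp_grHomAct (i k : ℕ) (p : ℤ) {U V : X.Opens} (h : V ≤ U) (φ : grHom G k p U)
    (a : A.deg i V) :
    homApp (grHomAct G i k p U φ) h a = grLocMulRight G i (grHomRes G k p h φ) a := rfl

theorem grLocMulRight_smul (i : ℕ) {k : ℕ} {p : ℤ} {V : X.Opens} (r : RSec X.presheaf V)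
    (φ : grHom G k p V) (a : A.deg i V) :
    grLocMulRight G i (r • φ) a = r • grLocMulRight G i φ a :=
  (congrArg (grLocι G k (i + p) V) (smul_grHomMul G r a φ)).trans
    (grLocι_smul G k (i + p) r (grHomMul G a φ))

theorem grHomAct_smul (i k : ℕ) (p : ℤ) (U : X.Opens) (r : RSec X.presheaf U)
    (φ : grHom G k p U) : grHomAct G i k p U (r • φ) = r • grHomAct G i k p U φ := by
  refine homSec_ext fun V h a => ?_
  refine Eq.trans ?_ (homApp_smul r (grHomAct G i k p U φ) h a).symm
  refine (homApp_grHomAct G i k p h (r • φ) a).trans ?_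
  rw [grHomRes_smul]
  exact grLocMulRight_smul G i _ _ a

theorem grHomAct_trans (i : ℕ) {k l : ℕ} (h : k ≤ l) (p : ℤ) (U : X.Opens) (φ : grHom G k p U) :
    grHomAct G i l p U (grHomTrans G h p U φ) = grHomAct G i k p U φ := by
  refine Subtype.ext (funext fun V => LinearMap.ext fun a => ?_)
  exact grLocι_trans G h (i + p) (grHomMul G (i := i) a (grHomRes G k p V.2 φ))

/-- The action of `A` on `G(*I)`, as a morphism `G(*I)_p → 𝓗om_{𝒪_X}(A_i, G(*I)_{i+p})`: it is
induced by `φ ↦ (a ↦ a φ)` on the `𝓗om_A(I^k, G)`. -/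
def grLocAct (i : ℕ) (p : ℤ) : grLoc G p ⟶ homDeg (A := A) i (grLoc G (i + p)) :=
  Limits.colimit.desc (grHomSystem G p)
    { pt := homDeg (A := A) i (grLoc G (i + p))
      ι :=
        { app := fun k => ofPModHom (PresheafOfModules.homMk
            { app := fun U => AddCommGrpCat.ofHom (grHomAct G i k p U.unop)
              naturality := fun _ _ _ => rfl }
            fun U r φ => grHomAct_smul G i k p U.unop r φ)
          naturality := fun k l f => by
            refine Scheme.Modules.hom_ext _ _ fun U => ?_
            refine AddCommGrpCat.hom_ext (AddMonoidHom.ext fun φ => ?_)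
            exact grHomAct_trans G i f.le p U φ } }

/-- The product `a s ∈ G(*I)_{i+p}(U)` of `a ∈ A_i(U)` and `s ∈ G(*I)_p(U)`. -/
def grLocMul (i : ℕ) (p : ℤ) (U : X.Opens) (a : A.deg i U) (s : MSec (toPMod (grLoc G p)) U) :
    MSec (toPMod (grLoc G (i + p))) U :=
  homApp (((grLocAct G i p).app U).hom s : homSec (degPMod A i) (toPMod (grLoc G (i + p))) U)
    le_rfl a

end Localization


/-! ### The relative `Proj` and the sheaves `G~(p)` -/

section Proj

variable {X : Scheme.{u}} (A : GrAlg X)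

/-- The stalk of `A` at a point. -/
abbrev AStalk (x : X) : Type u := 
  TopCat.Presheaf.stalk (C := CommRingCat.{u}) (X := X.toTopCat) A.ring x

/-- The germ at `x` of a section of `A`. -/
def agerm {U : X.Opens} {x : X} (hx : x ∈ U) : RSec A.ring U →+* AStalk A x :=
  (TopCat.Presheaf.germ (C := CommRingCat.{u}) (X := X.toTopCat) A.ring U x hx).hom

theorem agerm_rres {U V : X.Opens} {x : X} (h : V ≤ U) (hx : x ∈ V) (a : RSec A.ring U) :
    agerm A hx (rres A.ring h a) = agerm A (h hx) a :=
  congrArg (fun f => f.hom a)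
    (TopCat.Presheaf.germ_res (X := X.toTopCat) A.ring (homOfLE h) x hx)

/-- The points of `Proj_X A` over `x`: the homogeneous prime ideals of the stalk `A_x` which lie over
the maximal ideal of `𝒪_{X,x}` and do not contain all the homogeneous elements of positive
degree. Here the homogeneous elements of degree `i` of `A_x` are the germs of the sections of
`A_i`. -/
structure ProjPoint where
  pt : X
  ideal : Ideal (AStalk A pt)
  isPrime : ideal.IsPrime
  comap_eq : ideal.comap ((TopCat.Presheaf.stalkFunctor CommRingCat.{u} pt).map A.unit).hom =
    IsLocalRing.maximalIdeal (X.presheaf.stalk pt)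
  homogeneous : ideal = Ideal.span {a | a ∈ ideal ∧
    ∃ (i : ℕ) (U : X.Opens) (hx : pt ∈ U), ∃ s ∈ A.deg i U, agerm A hx s = a}
  relevant : ∃ (i : ℕ) (U : X.Opens) (hx : pt ∈ U), 0 < i ∧ ∃ s ∈ A.deg i U, agerm A hx s ∉ ideal

attribute [instance] ProjPoint.isPrime

variable {A}

/-- The set `D(V, g)` of the points of `Proj_X A` over `V` at which `g ∈ A(V)` does not vanish. -/
def basicSet {V : X.Opens} (g : RSec A.ring V) : Set (ProjPoint A) :=
  {y | ∃ h : y.pt ∈ V, agerm A h g ∉ y.ideal}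

/-- The Zariski topology: the sets `D(V, g)`, for `V ⊆ X` open and `g ∈ A_d(V)` for some `d ≥ 0`, form
a basis of open sets. -/
instance : TopologicalSpace (ProjPoint A) :=
  TopologicalSpace.generateFrom
    {D | ∃ (V : X.Opens) (d : ℕ) (g : RSec A.ring V), g ∈ A.deg d V ∧ D = basicSet g}

theorem isOpen_basicSet {V : X.Opens} {d : ℕ} {g : RSec A.ring V} (hg : g ∈ A.deg d V) :
    IsOpen (basicSet g) :=
  TopologicalSpace.isOpen_generateFrom_of_mem ⟨V, d, g, hg, rfl⟩

variable (A) in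
/-- The topological space `Proj_X A`. -/
abbrev proj : TopCat.{u} := TopCat.of (ProjPoint A)

variable (A) in
theorem one_mem_deg (U : X.Opens) : (1 : RSec A.ring U) ∈ A.deg 0 U := by
  have := aunit_mem A (1 : RSec X.presheaf U)
  rwa [map_one] at this

variable (A) in
/-- The projection `Proj_X A → X`. -/
def projπ : proj A ⟶ X.toTopCat :=
  TopCat.ofHom
    { toFun := fun (y : ProjPoint A) => y.pt
      continuous_toFun := continuous_def.2 fun U hU => by
        refine TopologicalSpace.isOpen_generateFrom_of_mem
          ⟨⟨U, hU⟩, 0, 1, one_mem_deg A _, ?_⟩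
        ext y
        refine ⟨fun h => ⟨h, fun h' => y.isPrime.ne_top ?_⟩, fun h => h.1⟩
        rw [map_one] at h'
        exact (Ideal.eq_top_iff_one _).2 h' }

variable (G : GrMod A)

/-- The stalk of `G` at a point. -/
abbrev GStalk (x : X) : Type u :=
  TopCat.Presheaf.stalk (C := Ab.{u}) (X := X.toTopCat) G.mod.presheaf x

/-- The germ at `x` of a section of `G`. -/
def ggerm {U : X.Opens} {x : X} (hx : x ∈ U) : MSec G.mod U →+ GStalk G x :=
  (TopCat.Presheaf.germ (C := Ab.{u}) (X := X.toTopCat) G.mod.presheaf U x hx).hom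

theorem ggerm_mres {U V : X.Opens} {x : X} (h : V ≤ U) (hx : x ∈ V) (m : MSec G.mod U) :
    ggerm G hx (mres G.mod h m) = ggerm G (h hx) m :=
  congrArg (fun f => f.hom m)
    (TopCat.Presheaf.germ_res (X := X.toTopCat) G.mod.presheaf (homOfLE h) x hx)

theorem ggerm_smul {U : X.Opens} {x : X} (hx : x ∈ U) (a : RSec A.ring U) (m : MSec G.mod U) :
    ggerm G hx (a • m) = agerm A hx a • ggerm G hx m :=
  PresheafOfModules.germ_smul G.mod x U hx a m

/-- The localization `G_{x,𝔭}` of the stalk `G_x` at the prime ideal `𝔭` of `A_x`, for a point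
`(x, 𝔭)` of `Proj_X A`. -/
abbrev Fib (y : ProjPoint A) : Type u := LocalizedModule y.ideal.primeCompl (GStalk G y.pt)

/-- The canonical map `G_x → G_{x,𝔭}`. -/
abbrev toFib (y : ProjPoint A) : GStalk G y.pt →ₗ[AStalk A y.pt] Fib G y :=
  LocalizedModule.mkLinearMap y.ideal.primeCompl (GStalk G y.pt)

theorem fib_cancel {y : ProjPoint A} {b : AStalk A y.pt} (hb : b ∉ y.ideal) {s t : Fib G y}
    (h : b • s = b • t) : s = t :=
  (IsLocalizedModule.smul_injective (toFib G y) (⟨b, hb⟩ : y.ideal.primeCompl)) h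

/-- `s = m / g` on `W' ⊆ W`, for a function `s` on `W ⊆ Proj_X A` with values in the localized
stalks of `G`: here `W'` lies over `V` and `g ∈ A(V)` vanishes nowhere on `W'`. (The germ of `g` then
acts bijectively on the localized stalks of `G` at the points of `W'`.) -/
def IsFracOn {W : Opens (proj A)} (s : ∀ y : W, Fib G y.1) (W' : Opens (proj A)) {V : X.Opens}
    (m : MSec G.mod V) (g : RSec A.ring V) : Prop :=
  ∀ y : W, y.1 ∈ W' → ∃ h : y.1.pt ∈ V, agerm A h g ∉ y.1.ideal ∧
    agerm A h g • s y = toFib G y.1 (ggerm G h m)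

/-- The sections over `W` of the sheaf `G~(p)` on `Proj_X A`: the functions with values in the localized
stalks of `G` which are given, on a neighbourhood of each point, by a fraction `m / g` with
`m ∈ G_{d+p}(V)` and `g ∈ A_d(V)` for some `d ≥ 0` and some open `V ⊆ X`. -/
def tildeSec (p : ℤ) (W : Opens (proj A)) : AddSubgroup (∀ y : W, Fib G y.1) where
  carrier := {s | ∀ y : W, ∃ (V : X.Opens) (d : ℕ), ∃ m ∈ G.deg (d + p) V, ∃ g ∈ A.deg d V,
    ∃ W' : Opens (proj A), y.1 ∈ W' ∧ IsFracOn G s W' m g}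
  add_mem' := by
    intro s t hs ht y
    obtain ⟨V, d, m, hm, g, hg, W₁, hy, h⟩ := hs y
    obtain ⟨V', d', m', hm', g', hg', W₂, hy', h'⟩ := ht y
    have e₁ : V ⊓ V' ≤ V := inf_le_left
    have e₂ : V ⊓ V' ≤ V' := inf_le_right
    refine ⟨V ⊓ V', d + d', rres A.ring e₂ g' • mres G.mod e₁ m +
      rres A.ring e₁ g • mres G.mod e₂ m', add_mem ?_ ?_, rres A.ring e₁ g * rres A.ring e₂ g',
      A.mul_mem (A.res_mem e₁ hg) (A.res_mem e₂ hg'), W₁ ⊓ W₂, ⟨hy, hy'⟩, ?_⟩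
    · have := G.smul_mem (A.res_mem e₂ hg') (G.res_mem e₁ hm)
      rwa [show (d' : ℤ) + (d + p) = (d + d' : ℕ) + p by push_cast; ring] at this
    · have := G.smul_mem (A.res_mem e₁ hg) (G.res_mem e₂ hm')
      rwa [show (d : ℤ) + (d' + p) = (d + d' : ℕ) + p by push_cast; ring] at this
    · intro z hz
      obtain ⟨hV, hgz, h₁⟩ := h z hz.1
      obtain ⟨hV', hgz', h₂⟩ := h' z hz.2
      have hVV : z.1.pt ∈ V ⊓ V' := ⟨hV, hV'⟩
      refine ⟨hVV, ?_, ?_⟩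
      · rw [map_mul, agerm_rres, agerm_rres]
        exact fun h => (z.1.isPrime.mem_or_mem h).elim hgz hgz'
      · rw [map_mul, map_add, ggerm_smul, ggerm_smul, agerm_rres, agerm_rres, ggerm_mres,
          ggerm_mres, map_add, map_smul, map_smul, ← h₁, ← h₂, Pi.add_apply, smul_add, mul_smul,
          mul_smul]
        congr 1
        rw [smul_comm]
  zero_mem' := by
    intro y
    obtain ⟨i, U, hx, -, g, hg, h⟩ := y.1.relevant
    refine ⟨U, i, 0, zero_mem _, g, hg, ⟨basicSet g, isOpen_basicSet hg⟩, ⟨hx, h⟩, fun z hz => ?_⟩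
    obtain ⟨hz, hz'⟩ := hz
    refine ⟨hz, hz', ?_⟩
    rw [map_zero, map_zero, Pi.zero_apply, smul_zero]
  neg_mem' := by
    intro s hs y
    obtain ⟨V, d, m, hm, g, hg, W', hy, h⟩ := hs y
    refine ⟨V, d, -m, neg_mem hm, g, hg, W', hy, fun z hz => ?_⟩
    obtain ⟨h₁, h₂, h₃⟩ := h z hz
    refine ⟨h₁, h₂, ?_⟩
    rw [map_neg, map_neg, ← h₃, Pi.neg_apply, smul_neg]

/-- Restriction of sections of `G~(p)`. -/
def tildeRes (p : ℤ) {W W' : Opens (proj A)} (h : W' ≤ W) : tildeSec G p W →+ tildeSec G p W' where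
  toFun s := ⟨fun y => s.1 ⟨y.1, h y.2⟩, fun y => by
    obtain ⟨V, d, m, hm, g, hg, W₁, hy, h'⟩ := s.2 ⟨y.1, h y.2⟩
    exact ⟨V, d, m, hm, g, hg, W₁, hy, fun z => h' ⟨z.1, h z.2⟩⟩⟩
  map_zero' := rfl
  map_add' _ _ := rfl

/-- The sheaf `G~(p)` on `Proj_X A`, as a presheaf of abelian groups. -/
def tildePresheaf (p : ℤ) : TopCat.Presheaf Ab.{u} (proj A) where
  obj W := AddCommGrpCat.of (tildeSec G p W.unop)
  map f := AddCommGrpCat.ofHom (tildeRes G p f.unop.le)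
  map_id _ := rfl
  map_comp _ _ := rfl

theorem tildePresheaf_isSheaf (p : ℤ) : (tildePresheaf G p).IsSheaf := by
  rw [TopCat.Presheaf.isSheaf_iff_isSheafUniqueGluing]
  intro ι W s hs
  let s' : ∀ i, tildeSec G p (W i) := s
  have hs' : ∀ (i j : ι) (y : ProjPoint A) (hi : y ∈ W i) (hj : y ∈ W j),
      (s' i).1 ⟨y, hi⟩ = (s' j).1 ⟨y, hj⟩ := fun i j y hi hj =>
    congrArg (fun t : tildeSec G p (W i ⊓ W j) => t.1 ⟨y, ⟨hi, hj⟩⟩) (hs i j)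
  have hW : ∀ y : (iSup W : Opens (proj A)), ∃ i, y.1 ∈ W i := fun y => Opens.mem_iSup.1 y.2
  choose c hc using hW
  refine ⟨(⟨fun y => (s' (c y)).1 ⟨y.1, hc y⟩, fun y => ?_⟩ : tildeSec G p (iSup W)),
    fun i => Subtype.ext (funext fun y => hs' _ _ _ _ _), fun t ht => Subtype.ext (funext fun y => ?_)⟩
  · obtain ⟨V, d, m, hm, g, hg, W', hy, h⟩ := (s' (c y)).2 ⟨y.1, hc y⟩
    refine ⟨V, d, m, hm, g, hg, W' ⊓ W (c y), ⟨hy, hc y⟩, fun z hz => ?_⟩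
    obtain ⟨h₁, h₂, h₃⟩ := h ⟨z.1, hz.2⟩ hz.1
    refine ⟨h₁, h₂, ?_⟩
    rw [← h₃]
    exact congrArg _ (hs' _ _ z.1 _ _)
  · exact congrArg (fun t : tildeSec G p (W (c y)) => t.1 ⟨y.1, hc y⟩) (ht (c y))

end Proj


/-! ### The direct image of `G~(p)` and the canonical morphism -/

section Canonical

variable {X : Scheme.{u}} {A : GrAlg X} (G : GrMod A)

variable (A) in
/-- The inverse image of `U ⊆ X` in `Proj_X A`. -/
abbrev preim (U : X.Opens) : Opens (proj A) := (Opens.map (projπ A)).obj U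

theorem pt_mem {U : X.Opens} (y : preim A U) : y.1.pt ∈ U := y.2

theorem mul_mem_tildeSec {i : ℕ} {p q : ℤ} (hq : i + p = q) {U : X.Opens} {a : RSec A.ring U}
    (ha : a ∈ A.deg i U) (s : tildeSec G p (preim A U)) :
    (fun y => agerm A (pt_mem y) a • s.1 y : ∀ y : preim A U, Fib G y.1) ∈
      tildeSec G q (preim A U) := by
  subst hq
  intro y
  obtain ⟨V, d, m, hm, g, hg, W', hy, h⟩ := s.2 y
  have e₁ : U ⊓ V ≤ U := inf_le_left
  have e₂ : U ⊓ V ≤ V := inf_le_right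
  refine ⟨U ⊓ V, d, rres A.ring e₁ a • mres G.mod e₂ m, ?_, rres A.ring e₂ g, A.res_mem e₂ hg, W',
    hy, fun z hz => ?_⟩
  · have := G.smul_mem (A.res_mem e₁ ha) (G.res_mem e₂ hm)
    rwa [show (i : ℤ) + (d + p) = d + (i + p) by ring] at this
  · obtain ⟨h₁, h₂, h₃⟩ := h z hz
    have hUV : z.1.pt ∈ U ⊓ V := ⟨z.2, h₁⟩
    refine ⟨hUV, ?_, ?_⟩
    · rwa [agerm_rres]
    · rw [agerm_rres, ggerm_smul, agerm_rres, ggerm_mres, map_smul, ← h₃, smul_comm]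

/-- The product `a s ∈ π̄_*G~(i+p)(U)` of `a ∈ A_i(U)` and `s ∈ π̄_*G~(p)(U)`. -/
def tildeMul (i : ℕ) (p : ℤ) (U : X.Opens) (a : A.deg i U) (s : tildeSec G p (preim A U)) :
    tildeSec G (i + p) (preim A U) :=
  ⟨fun y => agerm A (pt_mem y) a.1 • s.1 y, mul_mem_tildeSec G rfl a.2 s⟩

instance (p : ℤ) (U : X.Opens) : Module (RSec X.presheaf U) (tildeSec G p (preim A U)) where
  smul r s := ⟨fun y => agerm A (pt_mem y) (aunit A U r) • s.1 y,
    mul_mem_tildeSec G (by rw [Nat.cast_zero, zero_add]) (aunit_mem A r) s⟩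
  one_smul s := Subtype.ext <| funext fun y => by
    change agerm A (pt_mem y) (aunit A U (1 : RSec X.presheaf U)) • s.1 y = s.1 y
    rw [map_one, map_one, one_smul]
  mul_smul r r' s := Subtype.ext <| funext fun y => by
    change agerm A (pt_mem y) (aunit A U (r * r')) • s.1 y =
      agerm A (pt_mem y) (aunit A U r) • agerm A (pt_mem y) (aunit A U r') • s.1 y
    rw [map_mul, map_mul, mul_smul]
  smul_zero r := Subtype.ext <| funext fun y => smul_zero (agerm A (pt_mem y) (aunit A U r))
  smul_add r s t := Subtype.ext <| funext fun y =>
    smul_add (agerm A (pt_mem y) (aunit A U r)) (s.1 y) (t.1 y)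
  add_smul r r' s := Subtype.ext <| funext fun y => by
    change agerm A (pt_mem y) (aunit A U (r + r')) • s.1 y =
      agerm A (pt_mem y) (aunit A U r) • s.1 y + agerm A (pt_mem y) (aunit A U r') • s.1 y
    rw [map_add, map_add, add_smul]
  zero_smul s := Subtype.ext <| funext fun y => by
    change agerm A (pt_mem y) (aunit A U (0 : RSec X.presheaf U)) • s.1 y = 0
    rw [map_zero, map_zero, zero_smul]

theorem preim_mono {U V : X.Opens} (h : V ≤ U) : preim A V ≤ preim A U := fun _ hy => h hy

theorem tildeRes_smul (p : ℤ) {U V : X.Opens} (h : V ≤ U) (r : RSec X.presheaf U)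
    (s : tildeSec G p (preim A U)) :
    tildeRes G p (preim_mono h) (r • s) =
      rres X.presheaf h r • tildeRes G p (preim_mono h) s :=
  Subtype.ext <| funext fun y => by
    change agerm A (h (pt_mem y)) (aunit A U r) • s.1 ⟨y.1, h y.2⟩ =
      agerm A (pt_mem y) (aunit A V (rres X.presheaf h r)) • s.1 ⟨y.1, h y.2⟩
    rw [← rres_aunit, agerm_rres]

/-- The direct image `π̄_*G~(p)` as a presheaf of `𝒪_X`-modules. -/
def directImagePMod (p : ℤ) : PMod X.presheaf :=
  letI P : (X.Opens)ᵒᵖ ⥤ Ab.{u} :=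
    { obj := fun U => AddCommGrpCat.of (tildeSec G p (preim A U.unop))
      map := fun f => AddCommGrpCat.ofHom (tildeRes G p (preim_mono f.unop.le))
      map_id := fun _ => rfl
      map_comp := fun _ _ => rfl }
  letI (U : (X.Opens)ᵒᵖ) :
      Module ((X.presheaf ⋙ forget₂ CommRingCat.{u} RingCat.{u}).obj U) (P.obj U) :=
    inferInstanceAs (Module (RSec X.presheaf U.unop) (tildeSec G p (preim A U.unop)))
  PresheafOfModules.ofPresheaf P fun _ _ f r s => tildeRes_smul G p f.unop.le r s

theorem directImagePMod_isSheaf (p : ℤ) :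
    TopCat.Presheaf.IsSheaf (directImagePMod G p).presheaf :=
  TopCat.Sheaf.pushforward_sheaf_of_sheaf (projπ A) (tildePresheaf_isSheaf G p)

/-- The `𝒪_X`-module `π̄_*G~(p)`. -/
def directImage (p : ℤ) : X.Modules := ofPMod (directImagePMod G p) (directImagePMod_isSheaf G p)

variable (A) in
theorem pow_mem_deg {i : ℕ} {U : X.Opens} {a : RSec A.ring U} (ha : a ∈ A.deg i U) (k : ℕ) :
    a ^ k ∈ A.deg (k * i) U := by
  induction k with
  | zero =>
    rw [pow_zero, zero_mul]
    exact one_mem_deg A U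
  | succ k ih =>
    rw [pow_succ, add_mul, one_mul]
    exact A.mul_mem ih ha

/-- Near each point of `Proj_X A` some homogeneous section of `I^k` does not vanish. -/
theorem exists_denom (k : ℕ) (y : ProjPoint A) {U : X.Opens} (hU : y.pt ∈ U) :
    ∃ (V : X.Opens) (_ : V ≤ U) (hy : y.pt ∈ V) (d : ℕ) (g : RSec A.ring V)
      (_ : g ∈ idealPow A k V), g ∈ A.deg d V ∧ agerm A hy g ∉ y.ideal := by
  obtain ⟨i, V, hx, hi, s, hs, h⟩ := y.relevant
  have e : U ⊓ V ≤ V := inf_le_right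
  have hUV : y.pt ∈ U ⊓ V := ⟨hU, hx⟩
  refine ⟨U ⊓ V, inf_le_left, hUV, k * i, rres A.ring e s ^ k, fun x hx => ?_,
    pow_mem_deg A (A.res_mem e hs) k, fun h' => h ?_⟩
  · refine ⟨U ⊓ V, le_rfl, hx, ?_⟩
    rw [rres_self]
    have hm : rres A.ring e s ∈ positiveIdeal A (U ⊓ V) :=
      Ideal.subset_span ⟨i, hi, A.res_mem e hs⟩
    exact Ideal.pow_mem_pow hm k
  · rw [map_pow, agerm_rres] at h'
    exact y.isPrime.mem_of_pow_mem k h'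

/-- Every `φ ∈ 𝓗om_A(I^k, G)_p(U)` has a well-defined value `φ(g) / g` at a point of `Proj_X A` over
`U`, where `g` is any section of `I^k` near the point which does not vanish there. This is
the value of the image of `1` under the morphism `𝒪 = (I^k)~ → G~(p)` induced by `φ`. -/
theorem exists_value {k : ℕ} {p : ℤ} {U : X.Opens} (φ : grHom G k p U) (y : preim A U) :
    ∃ t : Fib G y.1, ∀ (V : X.Opens) (h : V ≤ U) (hy : y.1.pt ∈ V) (g : RSec A.ring V)
      (hg : g ∈ idealPow A k V),
      agerm A hy g • t = toFib G y.1 (ggerm G hy (homApp φ.1 h (mkIdeal A k g hg))) := by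
  obtain ⟨V₀, h₀, hy₀, d, g₀, hg₀, -, hn₀⟩ := exists_denom (A := A) k y.1 y.2
  refine ⟨LocalizedModule.mk (ggerm G hy₀ (homApp φ.1 h₀ (mkIdeal A k g₀ hg₀)))
    ⟨agerm A hy₀ g₀, hn₀⟩, fun V h hy g hg => fib_cancel G hn₀ ?_⟩
  have e₀ : V₀ ⊓ V ≤ V₀ := inf_le_left
  have e : V₀ ⊓ V ≤ V := inf_le_right
  have hyy : y.1.pt ∈ V₀ ⊓ V := ⟨hy₀, hy⟩
  have key : agerm A hy g • ggerm G hy₀ (homApp φ.1 h₀ (mkIdeal A k g₀ hg₀)) =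
      agerm A hy₀ g₀ • ggerm G hy (homApp φ.1 h (mkIdeal A k g hg)) := by
    rw [← agerm_rres A e hyy, ← agerm_rres A e₀ hyy, ← ggerm_mres G e hyy, ← ggerm_mres G e₀ hyy,
      ← ggerm_smul, ← ggerm_smul, mres_homApp, mres_homApp, mres_mkIdeal, mres_mkIdeal,
      ← LinearMap.map_smul, ← LinearMap.map_smul, smul_mkIdeal, smul_mkIdeal]
    congr 2
    simp only [mul_comm]
  rw [smul_comm, ← map_smul, ← key, map_smul]
  congr 1
  rw [LocalizedModule.smul'_mk]
  exact LocalizedModule.mk_cancel (⟨agerm A hy₀ g₀, hn₀⟩ : y.1.ideal.primeCompl) _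

/-- The value `φ(g) / g`. -/
def value {k : ℕ} {p : ℤ} {U : X.Opens} (φ : grHom G k p U) (y : preim A U) : Fib G y.1 :=
  (exists_value G φ y).choose

theorem smul_value {k : ℕ} {p : ℤ} {U : X.Opens} (φ : grHom G k p U) (y : preim A U)
    {V : X.Opens} (h : V ≤ U) (hy : y.1.pt ∈ V) (g : RSec A.ring V) (hg : g ∈ idealPow A k V) :
    agerm A hy g • value G φ y =
      toFib G y.1 (ggerm G hy (homApp φ.1 h (mkIdeal A k g hg))) :=
  (exists_value G φ y).choose_spec V h hy g hg

theorem value_mem {k : ℕ} {p : ℤ} {U : X.Opens} (φ : grHom G k p U) :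
    (fun y => value G φ y) ∈ tildeSec G p (preim A U) := by
  intro y
  obtain ⟨V, h, hy, d, g, hg, hd, hn⟩ := exists_denom (A := A) k y.1 y.2
  refine ⟨V, d, homApp φ.1 h (mkIdeal A k g hg), φ.2 V h d g hg hd, g, hd,
    ⟨basicSet g, isOpen_basicSet hd⟩, ⟨hy, hn⟩, fun z hz => ?_⟩
  obtain ⟨hz, hz'⟩ := hz
  exact ⟨hz, hz', smul_value G φ z h hz g hg⟩

theorem value_eq {k : ℕ} {p : ℤ} {U : X.Opens} (φ : grHom G k p U) (y : preim A U)
    (t : Fib G y.1)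
    (ht : ∀ (V : X.Opens) (h : V ≤ U) (hy : y.1.pt ∈ V) (g : RSec A.ring V)
      (hg : g ∈ idealPow A k V),
      agerm A hy g • t = toFib G y.1 (ggerm G hy (homApp φ.1 h (mkIdeal A k g hg)))) :
    value G φ y = t := by
  obtain ⟨V, h, hy, d, g, hg, -, hn⟩ := exists_denom (A := A) k y.1 y.2
  exact fib_cancel G hn ((smul_value G φ y h hy g hg).trans (ht V h hy g hg).symm)

/-- The map `𝓗om_A(I^k, G)_p → π̄_*G~(p)`, `φ ↦ φ(g) / g`, on sections over `U`. -/
def unitImage (k : ℕ) (p : ℤ) (U : X.Opens) : grHom G k p U →+ tildeSec G p (preim A U) where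
  toFun φ := ⟨fun y => value G φ y, value_mem G φ⟩
  map_zero' := Subtype.ext <| funext fun y => value_eq G _ y _ fun V h hy g hg =>
    (smul_zero _).trans ((toFib G y.1).map_zero.symm.trans
      (congrArg (toFib G y.1) (ggerm G hy).map_zero.symm))
  map_add' φ ψ := Subtype.ext <| funext fun y => value_eq G _ y _ fun V h hy g hg => by
    refine (smul_add (agerm A hy g) (value G φ y) (value G ψ y)).trans ?_
    rw [smul_value G φ y h hy g hg, smul_value G ψ y h hy g hg, ← map_add, ← map_add]
    rfl

theorem homApp_smul_grHom {k : ℕ} {p : ℤ} {U V : X.Opens} (h : V ≤ U) (r : RSec X.presheaf U)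
    (φ : grHom G k p U) (s : MSec (idealPMod A k) V) :
    homApp (r • φ).1 h s = rres A.ring h (aunit A U r) • homApp φ.1 h s := rfl

theorem value_smul {k : ℕ} {p : ℤ} {U : X.Opens} (r : RSec X.presheaf U) (φ : grHom G k p U)
    (y : preim A U) :
    value G (r • φ) y = agerm A (pt_mem y) (aunit A U r) • value G φ y := by
  refine value_eq G (r • φ) y _ fun V h hy g hg => ?_
  have h₁ := smul_comm (agerm A hy g) (agerm A (pt_mem y) (aunit A U r)) (value G φ y)
  refine h₁.trans ?_
  rw [homApp_smul_grHom, ggerm_smul, agerm_rres, map_smul]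
  exact congrArg _ (smul_value G φ y h hy g hg)

theorem unitImage_smul (k : ℕ) (p : ℤ) (U : X.Opens) (r : RSec X.presheaf U)
    (φ : grHom G k p U) : unitImage G k p U (r • φ) = r • unitImage G k p U φ :=
  Subtype.ext <| funext fun y => value_smul G r φ y

theorem unitImage_res (k : ℕ) (p : ℤ) {U V : X.Opens} (h : V ≤ U) (φ : grHom G k p U) :
    unitImage G k p V (grHomRes G k p h φ) =
      tildeRes G p (preim_mono h) (unitImage G k p U φ) :=
  Subtype.ext <| funext fun y => value_eq G _ y _ fun _ h' hy g hg =>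
    smul_value G φ ⟨y.1, h y.2⟩ (h'.trans h) hy g hg

theorem unitImage_trans {k l : ℕ} (h : k ≤ l) (p : ℤ) (U : X.Opens) (φ : grHom G k p U) :
    unitImage G l p U (grHomTrans G h p U φ) = unitImage G k p U φ :=
  Subtype.ext <| funext fun y => value_eq G _ y _ fun _ h' hy g hg =>
    smul_value G φ y h' hy g (idealPow_le A h _ hg)

/-- The canonical morphism `𝓗om_A(I^k, G)_p → π̄_*G~(p)`. -/
def unitImageHom (k : ℕ) (p : ℤ) : grHomModules G k p ⟶ directImage G p :=
  ofPModHom (PresheafOfModules.homMk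
    { app := fun U => AddCommGrpCat.ofHom (unitImage G k p U.unop)
      naturality := fun _ _ f => AddCommGrpCat.hom_ext
        (AddMonoidHom.ext fun φ => unitImage_res G k p f.unop.le φ) }
    fun U r φ => unitImage_smul G k p U.unop r φ)

/-- The degree `p` part `G(*I)_p → π̄_*G~(p)` of the canonical morphism. -/
def canonicalMap (p : ℤ) : grLoc G p ⟶ directImage G p :=
  Limits.colimit.desc (grHomSystem G p)
    { pt := directImage G p
      ι :=
        { app := fun k => unitImageHom G k p
          naturality := fun k l f => by
            refine Scheme.Modules.hom_ext _ _ fun U => ?_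
            refine AddCommGrpCat.hom_ext (AddMonoidHom.ext fun φ => ?_)
            exact unitImage_trans G f.le p U φ } }

/-- `canonicalMap` on sections. -/
def canonicalSec (p : ℤ) (U : X.Opens) :
    MSec (toPMod (grLoc G p)) U →+ tildeSec G p (preim A U) :=
  ((canonicalMap G p).app U).hom

end Canonical

/-- `E` is locally free of rank `n`. -/
def IsVectorBundle {X : Scheme.{u}} (E : X.Modules) (n : ℕ) : Prop :=
  ∀ x : X, ∃ (U : X.Opens) (_ : x ∈ U) (e : Fin n → MSec (toPMod E) U),
    ∀ (V : X.Opens) (h : V ≤ U), Function.Bijective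
      fun c : Fin n → RSec X.presheaf V => ∑ j, c j • mres (toPMod E) h (e j)

end GradedLocalization

end

/-!
The canonical morphism is an isomorphism in degree `p` once `π̄_*G~(p)` is known to be the colimit of
the `𝓗om_A(I^k, G)_p`, and for this it suffices that the maps `φ ↦ φ(g) / g` are jointly surjective
locally on `X` and that every `φ` with image zero becomes zero locally on `X` after restriction to
some `I^l` (`nonempty_isColimit_unitCocone`). Compatibility with the action of `A` follows, since
then every section of `G(*I)_p` comes locally from some `φ` (`canonicalSec_grLocMul`).

Both local statements are proved over an affine open subset `U` on which `E` is free. There `A` is a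
polynomial algebra in sections `x_1, …, x_n` of degree one (`isPolyChart_symAlg`), and sections of the
quasi-coherent module `G` over a basic open subset `D(r)` extend to `U` up to powers of `r`. Every
homogeneous prime ideal of `𝒪(U)[X_1, …, X_n]` which does not contain all the variables gives a point
of `Proj` (`exists_projPoint`), so that there is a Nullstellensatz: a homogeneous polynomial `f` of
positive degree belongs to the radical of a homogeneous ideal as soon as it vanishes at its zeros in
`Proj` (`mem_radical_of_forall_projPoint`).

Applied to the annihilator of a homogeneous section `m` of `G` over `U`, it shows that `m` is killed
by a power of `f` if its image in `G~` vanishes on `f ≠ 0`. With `m = φ(x_j^k)` this gives local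
injectivity: if `x_j^K φ(x_j^k) = 0` for all `j`, then `φ` vanishes on the monomials divisible by some
`x_j^(K+k)`, hence on `I^l` for large `l`.

Applied to the ideal generated by the denominators of a section `s` of `G~(p)`, it shows that on
`x_j ≠ 0` this section is a fraction `m_j / x_j^N` with `m_j` defined over `U` (`exists_isFrac_pow`).
After enlarging `N` we have `x_i^N m_j = x_j^N m_i` (`exists_compatible_numerators`), so
`x^β ↦ x^(β - N e_j) m_j`, for any `j` with `β_j ≥ N`, is a well-defined morphism on `I^k` for `k > nN`
(`exists_grHom_of_numerators`), and its image is `s`.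
-/

noncomputable section

namespace GradedLocalization

/-! ### Gluing morphisms from local relations -/

section Glue

variable {X : TopCat.{u}} {R : TopCat.Presheaf CommRingCat.{u} X} {M N : PMod R} {U : Opens X}

/-- Gluing of sections which are characterized by a local relation. -/
theorem existsUnique_of_rel (hN : TopCat.Presheaf.IsSheaf N.presheaf)
    (Rel : ∀ V : Opens X, V ≤ U → MSec N V → Prop)
    (hres : ∀ (V W : Opens X) (hV : V ≤ U) (hW : W ≤ V) (t : MSec N V),
      Rel V hV t → Rel W (hW.trans hV) (mres N hW t))
    (huniq : ∀ (V : Opens X) (hV : V ≤ U) (t t' : MSec N V), Rel V hV t → Rel V hV t' → t = t')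
    (hex : ∀ x ∈ U, ∃ (V : Opens X) (hV : V ≤ U), x ∈ V ∧ ∃ t, Rel V hV t) :
    ∃! t : MSec N U, ∀ (V : Opens X) (hV : V ≤ U) (t' : MSec N V),
      Rel V hV t' → mres N hV t = t' := by
  choose V hV hx t ht using fun x : U => hex x.1 x.2
  have hU : U = iSup V := le_antisymm
    (fun x hxU => Opens.mem_iSup.2 ⟨⟨x, hxU⟩, hx ⟨x, hxU⟩⟩) (iSup_le hV)
  obtain ⟨s, hs, -⟩ := exists_glue hN V hU t fun x y =>
    huniq _ (inf_le_left.trans (hV x)) _ _ (hres _ _ (hV x) inf_le_left _ (ht x))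
      (hres _ _ (hV y) inf_le_right _ (ht y))
  refine ⟨s, fun W hW t' ht' => ?_, fun s' hs' => ?_⟩
  · refine eq_of_locally hN (fun x => W ⊓ V x) (by rw [← inf_iSup_eq, ← hU, inf_eq_left.2 hW]) _ _
      fun x h => ?_
    have h₁ : mres N h (mres N hW s) = mres N inf_le_right (t x) := by
      rw [← hs x (hV x), mres_mres, mres_mres]
    rw [h₁]
    exact huniq _ (h.trans hW) _ _ (hres _ _ (hV x) inf_le_right _ (ht x))
      (hres _ _ hW inf_le_left _ ht')
  · exact eq_of_locally hN V hU _ _ fun x h => (hs' _ h _ (ht x)).trans (hs x h).symm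

/-- A morphism of sheaves of modules given by a functional relation between sections which is
compatible with restriction and linear combinations and which is defined locally. -/
theorem exists_homSec_of_rel (hN : TopCat.Presheaf.IsSheaf N.presheaf)
    (Rel : ∀ V : Opens X, V ≤ U → MSec M V → MSec N V → Prop)
    (hres : ∀ (V W : Opens X) (hV : V ≤ U) (hW : W ≤ V) (s : MSec M V) (t : MSec N V),
      Rel V hV s t → Rel W (hW.trans hV) (mres M hW s) (mres N hW t))
    (huniq : ∀ (V : Opens X) (hV : V ≤ U) (s : MSec M V) (t t' : MSec N V),
      Rel V hV s t → Rel V hV s t' → t = t')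
    (hadd : ∀ (V : Opens X) (hV : V ≤ U) (s s' : MSec M V) (t t' : MSec N V),
      Rel V hV s t → Rel V hV s' t' → Rel V hV (s + s') (t + t'))
    (hsmul : ∀ (V : Opens X) (hV : V ≤ U) (r : RSec R V) (s : MSec M V) (t : MSec N V) (x : X),
      x ∈ V → Rel V hV s t → ∃ (W : Opens X) (hW : W ≤ V), x ∈ W ∧
        Rel W (hW.trans hV) (mres M hW (r • s)) (mres N hW (r • t)))
    (hex : ∀ (V : Opens X) (hV : V ≤ U) (s : MSec M V) (x : X), x ∈ V →
      ∃ (W : Opens X) (hW : W ≤ V), x ∈ W ∧ ∃ t, Rel W (hW.trans hV) (mres M hW s) t) :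
    ∃ φ : homSec M N U, ∀ (V : Opens X) (hV : V ≤ U) (s : MSec M V) (t : MSec N V),
      Rel V hV s t → homApp φ hV s = t := by
  have key : ∀ (V : {V : Opens X // V ≤ U}) (s : MSec M V.1), ∃! t : MSec N V.1,
      ∀ (W : Opens X) (hW : W ≤ V.1) (t' : MSec N W),
        Rel W (hW.trans V.2) (mres M hW s) t' → mres N hW t = t' := by
    intro V s
    refine existsUnique_of_rel hN (fun W hW t => Rel W (hW.trans V.2) (mres M hW s) t) ?_ ?_ ?_
    · intro W W' hW hW' t ht
      have := hres _ _ (hW.trans V.2) hW' _ _ ht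
      rwa [mres_mres] at this
    · intro W hW t t' ht ht'
      exact huniq _ _ _ _ _ ht ht'
    · intro x hx
      obtain ⟨W, hW, hxW, t, ht⟩ := hex V.1 V.2 s x hx
      exact ⟨W, hW, hxW, t, ht⟩
  choose f hf hf' using key
  have loc : ∀ (V : {V : Opens X // V ≤ U}) (s : MSec M V.1) (t : MSec N V.1),
      (∀ x ∈ V.1, ∃ (W : Opens X) (hW : W ≤ V.1), x ∈ W ∧
        Rel W (hW.trans V.2) (mres M hW s) (mres N hW t)) → f V s = t := by
    intro V s t h
    choose W hW hxW hR using fun x : V.1 => h x.1 x.2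
    exact eq_of_locally hN W (le_antisymm
      (fun x hx => Opens.mem_iSup.2 ⟨⟨x, hx⟩, hxW ⟨x, hx⟩⟩) (iSup_le hW)) _ _
      fun x h => hf V s (W x) h _ (hR x)
  have loc' : ∀ (V : {V : Opens X // V ≤ U}) (s : MSec M V.1) (x : X), x ∈ V.1 →
      ∃ (W : Opens X) (hW : W ≤ V.1), x ∈ W ∧
        Rel W (hW.trans V.2) (mres M hW s) (mres N hW (f V s)) := by
    intro V s x hx
    obtain ⟨W, hW, hxW, t, ht⟩ := hex V.1 V.2 s x hx
    exact ⟨W, hW, hxW, by rw [hf V s W hW t ht]; exact ht⟩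
  refine ⟨⟨fun V => ⟨⟨f V, fun s s' => loc V _ _ fun x hx => ?_⟩,
    fun r s => loc V _ _ fun x hx => ?_⟩, fun V W h s => ?_⟩, fun V hV s t h => ?_⟩
  · obtain ⟨W, hW, hxW, h⟩ := loc' V s x hx
    obtain ⟨W', hW', hxW', h'⟩ := loc' V s' x hx
    refine ⟨W ⊓ W', inf_le_left.trans hW, ⟨hxW, hxW'⟩, ?_⟩
    have h₁ := hres _ (W ⊓ W') _ inf_le_left _ _ h
    have h₂ := hres _ (W ⊓ W') _ inf_le_right _ _ h'
    rw [mres_mres, mres_mres] at h₁ h₂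
    rw [map_add, map_add]
    exact hadd _ _ _ _ _ _ h₁ h₂
  · obtain ⟨W, hW, hxW, h⟩ := loc' V s x hx
    obtain ⟨W', hW', hxW', h'⟩ := hsmul W (hW.trans V.2) (rres R hW r) _ _ x hxW h
    refine ⟨W', hW'.trans hW, hxW', ?_⟩
    rwa [← mres_smul, ← mres_smul, mres_mres, mres_mres] at h'
  · refine (loc W _ _ fun x hx => ?_).symm
    obtain ⟨W', hW', hxW', h'⟩ := loc' V s x (h hx)
    refine ⟨W.1 ⊓ W', inf_le_left, ⟨hx, hxW'⟩, ?_⟩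
    have h₁ := hres _ (W.1 ⊓ W') _ inf_le_right _ _ h'
    rw [mres_mres, mres_mres] at h₁ ⊢
    exact h₁
  · refine loc ⟨V, hV⟩ s t fun x hx => ⟨V, le_rfl, hx, ?_⟩
    rw [mres_self, mres_self]
    exact h

end Glue

/-! ### The direct image as a colimit -/

section Formal

variable {X : Scheme.{u}} {A : GrAlg X} (G : GrMod A)

/-- A section of `𝓗om_R(M, N)` over the whole space, as a morphism of presheaves of modules. -/
def homOfHomSec {M N : PMod X.presheaf} (φ : homSec M N ⊤) : M ⟶ N :=
  PresheafOfModules.homMk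
    { app := fun U => AddCommGrpCat.ofHom (homApp φ (le_top : U.unop ≤ ⊤)).toAddMonoidHom
      naturality := fun U _ f => AddCommGrpCat.hom_ext (AddMonoidHom.ext fun s =>
        (mres_homApp φ (le_top : U.unop ≤ ⊤) f.unop.le s).symm) }
    fun U r s => (homApp φ (le_top : U.unop ≤ ⊤)).map_smul r s

/-- The cocone `𝓗om_A(I^k, G)_p → π̄_*G~(p)` which induces the canonical morphism. -/
def unitCocone (p : ℤ) : Limits.Cocone (grHomSystem G p) where
  pt := directImage G p
  ι :=
    { app := fun k => unitImageHom G k p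
      naturality := fun k l f => by
        refine Scheme.Modules.hom_ext _ _ fun U => ?_
        refine AddCommGrpCat.hom_ext (AddMonoidHom.ext fun φ => ?_)
        exact unitImage_trans G f.le p U φ }

variable {G}

/-- The value of a cocone on `k ↦ 𝓗om_A(I^k, G)_p` at a section. -/
def coconeSec {p : ℤ} (T : Limits.Cocone (grHomSystem G p)) (k : ℕ) (U : X.Opens) :
    grHom G k p U →+ MSec (toPMod T.pt) U :=
  ((T.ι.app k).app U).hom

theorem coconeSec_res {p : ℤ} (T : Limits.Cocone (grHomSystem G p)) (k : ℕ) {U V : X.Opens}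
    (h : V ≤ U) (φ : grHom G k p U) :
    mres (toPMod T.pt) h (coconeSec T k U φ) = coconeSec T k V (grHomRes G k p h φ) :=
  (PresheafOfModules.naturality_apply (T.ι.app k).val (homOfLE h).op φ).symm

theorem coconeSec_smul {p : ℤ} (T : Limits.Cocone (grHomSystem G p)) (k : ℕ) {U : X.Opens}
    (r : RSec X.presheaf U) (φ : grHom G k p U) :
    coconeSec T k U (r • φ) = r • coconeSec T k U φ :=
  (T.ι.app k).app_smul r φ

theorem coconeSec_trans {p : ℤ} (T : Limits.Cocone (grHomSystem G p)) {k l : ℕ} (h : k ≤ l)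
    {U : X.Opens} (φ : grHom G k p U) :
    coconeSec T l U (grHomTrans G h p U φ) = coconeSec T k U φ :=
  congrArg (fun f => (f.app U).hom φ) (T.w (homOfLE h))

theorem mres_unitImage (k : ℕ) (p : ℤ) {U V : X.Opens} (h : V ≤ U) (φ : grHom G k p U) :
    mres (directImagePMod G p) h (unitImage G k p U φ) =
      unitImage G k p V (grHomRes G k p h φ) := (unitImage_res G k p h φ).symm

variable (G) in
/-- Each section of `𝓗om_A(I^k, G)_p` with zero image in `π̄_*G~(p)` is killed locally by restriction
to some `I^l ⊆ I^k`. -/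
def LocallyInjective (p : ℤ) : Prop :=
  ∀ (k : ℕ) (U : X.Opens) (φ : grHom G k p U), unitImage G k p U φ = 0 →
    ∀ x ∈ U, ∃ (V : X.Opens) (hV : V ≤ U) (l : ℕ) (hl : k ≤ l), x ∈ V ∧
      grHomTrans G hl p V (grHomRes G k p hV φ) = 0

variable (G) in
/-- Each section of `π̄_*G~(p)` comes locally from some `𝓗om_A(I^k, G)_p`. -/
def LocallySurjective (p : ℤ) : Prop :=
  ∀ (U : X.Opens) (t : tildeSec G p (preim A U)), ∀ x ∈ U,
    ∃ (V : X.Opens) (hV : V ≤ U) (k : ℕ) (φ : grHom G k p V), x ∈ V ∧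
      unitImage G k p V φ = tildeRes G p (preim_mono hV) t

theorem eq_of_locally_of_mem {R : TopCat.Presheaf CommRingCat.{u} X.toTopCat} {N : PMod R}
    (hN : TopCat.Presheaf.IsSheaf N.presheaf) {U : X.Opens} (s t : MSec N U)
    (h : ∀ x ∈ U, ∃ (V : X.Opens) (hV : V ≤ U), x ∈ V ∧ mres N hV s = mres N hV t) : s = t := by
  choose V hV hx h using fun x : U => h x.1 x.2
  exact eq_of_locally hN V (le_antisymm
    (fun x hx' => Opens.mem_iSup.2 ⟨⟨x, hx'⟩, hx ⟨x, hx'⟩⟩) (iSup_le hV)) _ _ fun x _ => h x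

theorem coconeSec_eq_zero {p : ℤ} (hinj : LocallyInjective G p)
    (T : Limits.Cocone (grHomSystem G p)) {k : ℕ} {V : X.Opens} (φ : grHom G k p V)
    (h : unitImage G k p V φ = 0) : coconeSec T k V φ = 0 := by
  refine eq_of_locally_of_mem (N := toPMod T.pt) T.pt.isSheaf _ _ fun x hx => ?_
  obtain ⟨W, hW, l, hl, hxW, h₁⟩ := hinj k V φ h x hx
  refine ⟨W, hW, hxW, ?_⟩
  rw [map_zero, coconeSec_res]
  refine (coconeSec_trans T hl (grHomRes G k p hW φ)).symm.trans ?_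
  exact (congrArg (coconeSec T l W) h₁).trans (map_zero _)

theorem coconeSec_eq {p : ℤ} (hinj : LocallyInjective G p)
    (T : Limits.Cocone (grHomSystem G p)) {k l : ℕ} {V : X.Opens} (φ : grHom G k p V)
    (ψ : grHom G l p V) (h : unitImage G k p V φ = unitImage G l p V ψ) :
    coconeSec T k V φ = coconeSec T l V ψ := by
  have h₁ := coconeSec_eq_zero hinj T (grHomTrans G (le_max_left k l) p V φ -
    grHomTrans G (le_max_right k l) p V ψ) <|
    (AddMonoidHom.map_sub (unitImage G (max k l) p V) _ _).trans
      (sub_eq_zero.2 ((unitImage_trans G _ p V φ).trans (h.trans (unitImage_trans G _ p V ψ).symm)))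
  have h₂ := sub_eq_zero.1 ((AddMonoidHom.map_sub (coconeSec T (max k l) V) _ _).symm.trans h₁)
  exact (coconeSec_trans T _ φ).symm.trans (h₂.trans (coconeSec_trans T _ ψ))

theorem unitImage_add_trans {p : ℤ} (k l : ℕ) {V : X.Opens} (φ : grHom G k p V)
    (ψ : grHom G l p V) :
    unitImage G (max k l) p V (grHomTrans G (le_max_left k l) p V φ +
      grHomTrans G (le_max_right k l) p V ψ) = unitImage G k p V φ + unitImage G l p V ψ := by
  exact (AddMonoidHom.map_add (unitImage G (max k l) p V) _ _).trans
    (congrArg₂ (· + ·) (unitImage_trans G _ p V φ) (unitImage_trans G _ p V ψ))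

theorem mres_directImagePMod (p : ℤ) {U V : X.Opens} (h : V ≤ U) (s : tildeSec G p (preim A U)) :
    mres (directImagePMod G p) h s = tildeRes G p (preim_mono h) s := rfl

/-- The relation between the images of a section of some `𝓗om_A(I^k, G)_p` in `π̄_*G~(p)` and in the
point of a cocone. -/
def CoconeRel {p : ℤ} (T : Limits.Cocone (grHomSystem G p)) (V : X.Opens)
    (s : MSec (directImagePMod G p) V) (t : MSec (toPMod T.pt) V) : Prop :=
  ∃ (k : ℕ) (ψ : grHom G k p V), unitImage G k p V ψ = s ∧ coconeSec T k V ψ = t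

theorem CoconeRel.res {p : ℤ} {T : Limits.Cocone (grHomSystem G p)} {V W : X.Opens} (hW : W ≤ V)
    {s : MSec (directImagePMod G p) V} {t : MSec (toPMod T.pt) V} (h : CoconeRel T V s t) :
    CoconeRel T W (mres _ hW s) (mres _ hW t) := by
  obtain ⟨k, ψ, rfl, rfl⟩ := h
  exact ⟨k, grHomRes G k p hW ψ, (mres_unitImage k p hW ψ).symm, (coconeSec_res T k hW ψ).symm⟩

theorem CoconeRel.add {p : ℤ} {T : Limits.Cocone (grHomSystem G p)} {V : X.Opens}
    {s s' : MSec (directImagePMod G p) V} {t t' : MSec (toPMod T.pt) V} (h : CoconeRel T V s t)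
    (h' : CoconeRel T V s' t') : CoconeRel T V (s + s') (t + t') := by
  obtain ⟨k, φ, rfl, rfl⟩ := h
  obtain ⟨l, ψ, rfl, rfl⟩ := h'
  exact ⟨max k l, grHomTrans G (le_max_left k l) p V φ + grHomTrans G (le_max_right k l) p V ψ,
    unitImage_add_trans k l φ ψ, (AddMonoidHom.map_add (coconeSec T (max k l) V) _ _).trans
      (congrArg₂ (· + ·) (coconeSec_trans T _ φ) (coconeSec_trans T _ ψ))⟩

theorem CoconeRel.smul {p : ℤ} {T : Limits.Cocone (grHomSystem G p)} {V : X.Opens}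
    {s : MSec (directImagePMod G p) V} {t : MSec (toPMod T.pt) V} (h : CoconeRel T V s t)
    (r : RSec X.presheaf V) : CoconeRel T V (r • s) (r • t) := by
  obtain ⟨k, φ, rfl, rfl⟩ := h
  exact ⟨k, r • φ, unitImage_smul G k p V r φ, coconeSec_smul T k r φ⟩

/-- The morphism from `π̄_*G~(p)` to the point of a cocone. -/
theorem exists_homSec_cocone {p : ℤ} (hinj : LocallyInjective G p) (hsurj : LocallySurjective G p)
    (T : Limits.Cocone (grHomSystem G p)) :
    ∃ φ : homSec (directImagePMod G p) (toPMod T.pt) ⊤,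
      ∀ (V : X.Opens) (s : MSec (directImagePMod G p) V) (t : MSec (toPMod T.pt) V),
        CoconeRel T V s t → homApp φ (le_top : V ≤ ⊤) s = t := by
  obtain ⟨φ, hφ⟩ := exists_homSec_of_rel (M := directImagePMod G p) (N := toPMod T.pt) (U := ⊤)
    T.pt.isSheaf (fun V _ s t => CoconeRel T V s t) (fun _ _ _ hW _ _ h => h.res hW)
    (by
      rintro V hV s t t' ⟨k, φ, hφ, rfl⟩ ⟨l, ψ, hψ, rfl⟩
      exact coconeSec_eq hinj T φ ψ (hφ.trans hψ.symm))
    (fun _ _ _ _ _ _ h h' => h.add h')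
    (fun V hV r s t x hx h => ⟨V, le_rfl, hx, (h.smul r).res le_rfl⟩)
    (by
      intro V hV s x hx
      obtain ⟨W, hW, k, φ, hxW, h⟩ := hsurj V s x hx
      exact ⟨W, hW, hxW, coconeSec T k W φ, k, φ, h.trans (mres_directImagePMod p hW s).symm, rfl⟩)
  exact ⟨φ, fun V s t h => hφ V le_top s t h⟩

/-- If `φ ↦ φ(g) / g` is locally injective, up to restriction to smaller powers of `I`, and locally
surjective, then `π̄_*G~(p)` is the colimit of the `𝓗om_A(I^k, G)_p`. -/
theorem nonempty_isColimit_unitCocone {p : ℤ} (hinj : LocallyInjective G p)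
    (hsurj : LocallySurjective G p) : Nonempty (Limits.IsColimit (unitCocone G p)) := by
  choose φ hφ' using fun T : Limits.Cocone (grHomSystem G p) => exists_homSec_cocone hinj hsurj T
  have hφ : ∀ (T : Limits.Cocone (grHomSystem G p)) (V : X.Opens) (k : ℕ) (ψ : grHom G k p V),
      homApp (φ T) (le_top : V ≤ ⊤) (unitImage G k p V ψ) = coconeSec T k V ψ :=
    fun T V k ψ => hφ' T V (unitImage G k p V ψ) (coconeSec T k V ψ) ⟨k, ψ, rfl, rfl⟩
  refine ⟨{ desc := fun T => ofPModHom (homOfHomSec (φ T)), fac := fun T k => ?_,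
            uniq := fun T m hm => ?_ }⟩
  · refine Scheme.Modules.hom_ext _ _ fun U => ?_
    refine AddCommGrpCat.hom_ext (AddMonoidHom.ext fun ψ => ?_)
    exact hφ T U k ψ
  · refine Scheme.Modules.hom_ext _ _ fun U => ?_
    refine AddCommGrpCat.hom_ext (AddMonoidHom.ext fun t => ?_)
    refine eq_of_locally_of_mem (N := toPMod T.pt) T.pt.isSheaf _ _ fun x hx => ?_
    obtain ⟨V, h', k, ψ, hxV, h⟩ := hsurj U t x hx
    refine ⟨V, h', hxV, ?_⟩
    have h₁ : mres (toPMod T.pt) h' ((m.app U).hom t) =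
        (m.app V).hom (tildeRes G p (preim_mono h') t) :=
      (PresheafOfModules.naturality_apply m.val (homOfLE h').op t).symm
    refine h₁.trans ?_
    have h₂ : (m.app V).hom (tildeRes G p (preim_mono h') t) = coconeSec T k V ψ := by
      rw [← h]
      exact congrArg (fun f => (f.app V).hom ψ) (hm k)
    refine h₂.trans ?_
    rw [← hφ T, h]
    exact (mres_homApp (φ T) le_top h' t).symm

theorem isIso_canonicalMap_of_isColimit {p : ℤ} (h : Limits.IsColimit (unitCocone G p)) :
    IsIso (canonicalMap G p) :=
  (((Limits.colimit.isColimit (grHomSystem G p)).coconePointUniqueUpToIso h).isIso_hom :)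

variable (G)

theorem canonicalSec_grLocι (k : ℕ) (p : ℤ) (U : X.Opens) (φ : grHom G k p U) :
    canonicalSec G p U (grLocι G k p U φ) = unitImage G k p U φ :=
  congrArg (fun f => (f.app U).hom φ)
    (Limits.colimit.ι_desc (F := grHomSystem G p) (unitCocone G p) k)

theorem unitImage_grHomMul {k i : ℕ} {p : ℤ} {U : X.Opens} (a : A.deg i U) (φ : grHom G k p U) :
    unitImage G k (i + p) U (grHomMul G a φ) = tildeMul G i p U a (unitImage G k p U φ) := by
  refine Subtype.ext (funext fun y => value_eq G _ y _ fun V h hy g hg => ?_)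
  have h₁ : homApp (grHomMul G a φ).1 h (mkIdeal A k g hg) =
      rres A.ring h a.1 • homApp φ.1 h (mkIdeal A k g hg) := rfl
  rw [h₁, ggerm_smul, agerm_rres, map_smul, ← smul_value G φ y h hy g hg]
  exact smul_comm (agerm A hy g) (agerm A (pt_mem y) a.1) (value G φ y)

theorem mres_grLocMul (i : ℕ) (p : ℤ) {U V : X.Opens} (h : V ≤ U) (a : A.deg i U)
    (s : MSec (toPMod (grLoc G p)) U) :
    mres (toPMod (grLoc G (i + p))) h (grLocMul G i p U a s) =
      grLocMul G i p V (degRes i h a) (mres (toPMod (grLoc G p)) h s) := by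
  have h₁ := PresheafOfModules.naturality_apply (grLocAct G i p).val (homOfLE h).op s
  have h₂ : (((grLocAct G i p).app V).hom (mres (toPMod (grLoc G p)) h s) :
      homSec (degPMod A i) (toPMod (grLoc G (i + p))) V) =
      homRes h (((grLocAct G i p).app U).hom s) := h₁
  refine (mres_homApp (((grLocAct G i p).app U).hom s :
    homSec (degPMod A i) (toPMod (grLoc G (i + p))) U) le_rfl h a).trans ?_
  exact (congrArg (fun f => homApp f (le_refl V) (degRes i h a)) h₂).symm

theorem grLocMul_grLocι (i k : ℕ) (p : ℤ) (U : X.Opens) (a : A.deg i U) (φ : grHom G k p U) :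
    grLocMul G i p U a (grLocι G k p U φ) = grLocι G k (i + p) U (grHomMul G a φ) := by
  have h := congrArg (fun f => (f.app U).hom φ)
    (Limits.colimit.ι_desc (F := grHomSystem G p) _ k :
      Limits.colimit.ι (grHomSystem G p) k ≫ grLocAct G i p = _)
  exact congrArg (fun f : homSec (degPMod A i) (toPMod (grLoc G (i + p))) U =>
    homApp f (le_refl U) a) h

theorem mres_canonicalSec (p : ℤ) {U V : X.Opens} (h : V ≤ U) (s : MSec (toPMod (grLoc G p)) U) :
    tildeRes G p (preim_mono h) (canonicalSec G p U s) =
      canonicalSec G p V (mres (toPMod (grLoc G p)) h s) :=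
  (PresheafOfModules.naturality_apply (canonicalMap G p).val (homOfLE h).op s).symm

theorem tildeRes_tildeMul (i : ℕ) (p : ℤ) {U V : X.Opens} (h : V ≤ U) (a : A.deg i U)
    (s : tildeSec G p (preim A U)) :
    tildeRes G (i + p) (preim_mono h) (tildeMul G i p U a s) =
      tildeMul G i p V (degRes i h a) (tildeRes G p (preim_mono h) s) :=
  Subtype.ext <| funext fun y => congrArg (· • s.1 ⟨y.1, h y.2⟩)
    (agerm_rres A h (pt_mem y) a.1).symm

variable {G}

/-- The canonical morphism is linear over `A` if it is an isomorphism and if each section of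
`π̄_*G~(p)` comes locally from some `𝓗om_A(I^k, G)_p`: then each section of `G(*I)_p` does, too. -/
theorem canonicalSec_grLocMul (i : ℕ) (p : ℤ) [IsIso (canonicalMap G p)]
    (hsurj : LocallySurjective G p)
    (U : X.Opens) (a : A.deg i U) (s : MSec (toPMod (grLoc G p)) U) :
    canonicalSec G (i + p) U (grLocMul G i p U a s) =
      tildeMul G i p U a (canonicalSec G p U s) := by
  refine eq_of_locally_of_mem (N := directImagePMod G (i + p)) (directImagePMod_isSheaf G (i + p))
    _ _ fun x hx => ?_
  obtain ⟨V, h', k, φ, hxV, h⟩ := hsurj U (canonicalSec G p U s) x hx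
  refine ⟨V, h', hxV, ?_⟩
  have hinj : Function.Injective (canonicalSec G p V) :=
    (ConcreteCategory.bijective_of_isIso ((canonicalMap G p).app V)).1
  have hs : mres (toPMod (grLoc G p)) h' s = grLocι G k p V φ := by
    refine hinj ?_
    rw [canonicalSec_grLocι, h]
    exact (mres_canonicalSec G p h' s).symm
  refine (mres_canonicalSec G (i + p) h' (grLocMul G i p U a s)).trans ?_
  refine Eq.trans ?_ (tildeRes_tildeMul G i p h' a (canonicalSec G p U s)).symm
  rw [mres_grLocMul, hs, grLocMul_grLocι, canonicalSec_grLocι, unitImage_grHomMul, h]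

end Formal

/-! ### Sections of quasi-coherent modules over basic open subsets -/

section Quasicoherent

variable {X : Scheme.{u}}

/-- Over the affine open set `U`, the restriction `M(U) → M(D(r))` is the localization at `r`, for
all `r ∈ 𝒪_X(U)`. -/
def IsLocalizingOn (M : PMod X.presheaf) (U : X.Opens) : Prop :=
  ∀ r : RSec X.presheaf U,
    (∀ m : MSec M U, mres M (X.basicOpen_le r) m = 0 → ∃ N : ℕ, r ^ N • m = 0) ∧
    ∀ m : MSec M (X.basicOpen r), ∃ (N : ℕ) (m' : MSec M U),
      mres M (X.basicOpen_le r) m' = rres X.presheaf (X.basicOpen_le r) r ^ N • m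

theorem fromSpec_appIso_inv {U : X.Opens} (hU : IsAffineOpen U) (V : (Spec Γ(X, U)).Opens)
    (h : hU.fromSpec ''ᵁ V ≤ U) (r : Γ(X, U)) :
    (hU.fromSpec.appIso V).inv ((Spec Γ(X, U)).presheaf.map V.leTop.op
      ((Scheme.ΓSpecIso Γ(X, U)).inv r)) = X.presheaf.map (homOfLE h).op r := by
  have hV : V ≤ hU.fromSpec ⁻¹ᵁ U := by rw [hU.fromSpec_preimage_self]; exact le_top
  have h₁ : (Scheme.ΓSpecIso Γ(X, U)).inv ≫ (Spec Γ(X, U)).presheaf.map V.leTop.op =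
      hU.fromSpec.app U ≫ (Spec Γ(X, U)).presheaf.map (homOfLE hV).op := by
    rw [hU.fromSpec_app_self, Category.assoc, ← Functor.map_comp]
    rfl
  have h₂ : (Scheme.ΓSpecIso Γ(X, U)).inv ≫ (Spec Γ(X, U)).presheaf.map V.leTop.op ≫
      (hU.fromSpec.appIso V).inv = X.presheaf.map (homOfLE h).op := by
    rw [reassoc_of% h₁, Scheme.Hom.appIso_inv_naturality, Scheme.Hom.app_appIso_inv_assoc]
    exact (X.presheaf.map_comp _ _).symm
  exact congrArg (fun f => f.hom r) h₂

/-- A section of `M` over the image of `V` under an open immersion, as a section of the restriction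
of `M`. -/
def restrictSec {Y : Scheme.{u}} (f : Y ⟶ X) [IsOpenImmersion f] (M : X.Modules) {V : Y.Opens}
    (x : MSec (toPMod M) (f ''ᵁ V)) : Γ(M.restrict f, V) := x

theorem smul_restrictSec (M : X.Modules) {U : X.Opens} (hU : IsAffineOpen U)
    {V : (Spec Γ(X, U)).Opens} (h : hU.fromSpec ''ᵁ V ≤ U) (a : Γ(X, U))
    (x : MSec (toPMod M) (hU.fromSpec ''ᵁ V)) :
    a • restrictSec hU.fromSpec M x =
      restrictSec hU.fromSpec M ((rres X.presheaf h a : RSec X.presheaf (hU.fromSpec ''ᵁ V)) • x) :=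
  congrArg (fun b : RSec X.presheaf (hU.fromSpec ''ᵁ V) => restrictSec hU.fromSpec M (b • x))
    (fromSpec_appIso_inv hU V h a)

theorem mres_eq_zero_of_le {M : PMod X.presheaf} {U V : X.Opens} (h : U ≤ V) (h' : V ≤ U)
    {m : MSec M V} (hm : mres M h m = 0) : m = 0 := by
  have := congrArg (mres M h') hm
  rwa [mres_mres, mres_self, map_zero] at this

/-- The restriction of `M` to the affine scheme `U` is the sheaf associated with the module `M(U)`. -/
theorem isLocalizingOn_of_isQuasicoherent (M : X.Modules) [hM : M.IsQuasicoherent] {U : X.Opens}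
    (hU : IsAffineOpen U) : IsLocalizingOn (toPMod M) U := by
  intro r
  let f := ((modulesSpecToSheaf.obj (M.restrict hU.fromSpec)).obj.map
        (PrimeSpectrum.basicOpen r).leTop.op).hom
  have h₀ : IsLocalizedModule (.powers r) f :=
    (isIso_fromTildeΓ_iff_isLocalizing (M.restrict hU.fromSpec)).1 inferInstance r
  have e₁ : hU.fromSpec ''ᵁ ⊤ = U := by
    rw [Scheme.Hom.image_top_eq_opensRange, hU.opensRange_fromSpec]
  have e₂ : hU.fromSpec ''ᵁ PrimeSpectrum.basicOpen r = X.basicOpen r :=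
    hU.fromSpec_image_basicOpen r
  have hle : hU.fromSpec ''ᵁ PrimeSpectrum.basicOpen r ≤ hU.fromSpec ''ᵁ ⊤ :=
    e₂.le.trans ((X.basicOpen_le r).trans e₁.ge)
  have hf : ∀ x : MSec (toPMod M) (hU.fromSpec ''ᵁ ⊤), f (restrictSec hU.fromSpec M x) =
      restrictSec hU.fromSpec M (mres (toPMod M) hle x) := fun x => rfl
  refine ⟨fun m hm => ?_, fun m => ?_⟩
  · obtain ⟨⟨_, N, rfl⟩, hN⟩ := (IsLocalizedModule.eq_zero_iff (.powers r) f).1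
      (show f (restrictSec hU.fromSpec M (mres (toPMod M) e₁.le m)) = 0 by
        rw [hf, mres_mres, ← mres_mres (toPMod M) (X.basicOpen_le r) e₂.le, hm, map_zero]
        rfl)
    refine ⟨N, mres_eq_zero_of_le e₁.le e₁.ge ?_⟩
    have h₁ := (smul_restrictSec M hU e₁.le (r ^ N) (mres (toPMod M) e₁.le m)).symm.trans hN
    rw [mres_smul]
    exact h₁
  · obtain ⟨⟨m', ⟨_, N, rfl⟩⟩, hN⟩ := IsLocalizedModule.surj (.powers r) f
      (restrictSec hU.fromSpec M (mres (toPMod M) e₂.le m))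
    let m₁ : MSec (toPMod M) (hU.fromSpec ''ᵁ ⊤) := m'
    refine ⟨N, mres (toPMod M) e₁.ge m₁, ?_⟩
    have h₁ : rres X.presheaf (e₂.le.trans (X.basicOpen_le r)) (r ^ N) • mres (toPMod M) e₂.le m =
        mres (toPMod M) hle m₁ :=
      (smul_restrictSec M hU (e₂.le.trans (X.basicOpen_le r)) (r ^ N)
        (mres (toPMod M) e₂.le m)).symm.trans hN
    have h₂ := congrArg (mres (toPMod M) e₂.ge) h₁
    rw [mres_smul, mres_mres, mres_mres, mres_self, rres_rres, map_pow] at h₂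
    rw [mres_mres, h₂]

end Quasicoherent

/-! ### Homogeneous components of sections of `G` -/

section Component

variable {X : Scheme.{u}} {A : GrAlg X} (G : GrMod A)

/-- The section `t` is the component of degree `p` of the section `s`. -/
def IsComponent (p : ℤ) {V : X.Opens} (s t : MSec G.mod V) : Prop :=
  t ∈ G.deg p V ∧ s - t ∈ ⨆ (q : ℤ) (_ : q ≠ p), G.deg q V

variable {G}

theorem IsComponent.eq {p : ℤ} {V : X.Opens} {s t t' : MSec G.mod V} (h : IsComponent G p s t)
    (h' : IsComponent G p s t') : t = t' := by
  have h₁ : t - t' ∈ G.deg p V := sub_mem h.1 h'.1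
  have h₂ : t - t' ∈ ⨆ (q : ℤ) (_ : q ≠ p), G.deg q V := by
    have := sub_mem h'.2 h.2
    rwa [sub_sub_sub_cancel_left] at this
  exact sub_eq_zero.1 ((AddSubgroup.disjoint_def.1 (G.iSupIndep_deg V p)) h₁ h₂)

theorem IsComponent.of_map {p : ℤ} {V W : X.Opens} (f : MSec G.mod V →+ MSec G.mod W)
    (hf : ∀ (q : ℤ) (m : MSec G.mod V), m ∈ G.deg q V → f m ∈ G.deg q W)
    {s t : MSec G.mod V} (h : IsComponent G p s t) : IsComponent G p (f s) (f t) := by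
  refine ⟨hf p t h.1, ?_⟩
  rw [← map_sub]
  have h₁ : (⨆ (q : ℤ) (_ : q ≠ p), G.deg q V) ≤
      (⨆ (q : ℤ) (_ : q ≠ p), G.deg q W).comap f :=
    iSup₂_le fun q hq m hm => AddSubgroup.mem_comap.2
      (le_iSup₂ (f := fun (q : ℤ) (_ : q ≠ p) => G.deg q W) q hq (hf q m hm))
  exact h₁ h.2

theorem IsComponent.add {p : ℤ} {V : X.Opens} {s s' t t' : MSec G.mod V}
    (h : IsComponent G p s t) (h' : IsComponent G p s' t') :
    IsComponent G p (s + s') (t + t') :=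
  ⟨add_mem h.1 h'.1, by rw [add_sub_add_comm]; exact add_mem h.2 h'.2⟩

theorem IsComponent.of_mem {p : ℤ} {V : X.Opens} {s : MSec G.mod V} (h : s ∈ G.deg p V) :
    IsComponent G p s s := ⟨h, by rw [sub_self]; exact zero_mem _⟩

theorem aunit_smul_mem {p : ℤ} {V : X.Opens} (r : RSec X.presheaf V) {m : MSec G.mod V}
    (hm : m ∈ G.deg p V) : aunit A V r • m ∈ G.deg p V := by
  have := G.smul_mem (aunit_mem A r) hm
  rwa [Nat.cast_zero, zero_add] at this

theorem IsComponent.smul {p : ℤ} {V : X.Opens} {s t : MSec G.mod V} (h : IsComponent G p s t)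
    (r : RSec X.presheaf V) : IsComponent G p (aunit A V r • s) (aunit A V r • t) :=
  h.of_map (DistribSMul.toAddMonoidHom (MSec G.mod V) (aunit A V r))
    fun _ _ hm => aunit_smul_mem r hm

theorem exists_isComponent {p : ℤ} {V : X.Opens} {s : MSec G.mod V}
    (h : s ∈ ⨆ q, G.deg q V) : ∃ t, IsComponent G p s t := by
  rw [iSup_split_single _ p] at h
  obtain ⟨t, ht, t', ht', rfl⟩ := AddSubgroup.mem_sup.1 h
  exact ⟨t, ht, by rwa [add_sub_cancel_left]⟩

variable (G) in
/-- The projection of `G` to its homogeneous part of degree `p`. -/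
theorem exists_projection (p : ℤ) :
    ∃ φ : homSec (toPMod G.toModules) (toPMod G.toModules) ⊤,
      ∀ (V : X.Opens) (s t : MSec G.mod V), IsComponent G p s t →
        homApp φ (le_top : V ≤ ⊤) s = t := by
  obtain ⟨φ, hφ⟩ := exists_homSec_of_rel (M := toPMod G.toModules) (N := toPMod G.toModules) (U := ⊤)
    G.isSheaf (fun V _ s t => IsComponent G (V := V) p s t)
    (fun V W _ hW s t h => h.of_map (mres G.mod hW) fun q m hm => G.res_mem hW hm)
    (fun V _ s t t' h h' => h.eq h') (fun V _ s s' t t' h h' => h.add h')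
    (fun V _ r s t x hx h => ⟨V, le_rfl, hx,
      (h.smul r).of_map (mres G.mod le_rfl) fun q m hm => G.res_mem le_rfl hm⟩)
    (fun V _ s x hx => by
      obtain ⟨W, hW, hxW, h⟩ := G.exists_mem_iSup_deg s hx
      exact ⟨W, hW, hxW, exists_isComponent h⟩)
  exact ⟨φ, fun V s t h => hφ V le_top s t h⟩

theorem IsComponent.of_homApp {p : ℤ} {φ : homSec (toPMod G.toModules) (toPMod G.toModules) ⊤}
    (hφ : ∀ (V : X.Opens) (s t : MSec G.mod V), IsComponent G p s t →
        homApp φ (le_top : V ≤ ⊤) s = t) {V : X.Opens} (s : MSec G.mod V) :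
    (homApp φ (le_top : V ≤ ⊤) s : MSec G.mod V) ∈ G.deg p V := by
  refine G.of_locally fun x hx => ?_
  obtain ⟨W, hW, hxW, h⟩ := G.exists_mem_iSup_deg s hx
  obtain ⟨t, ht⟩ := exists_isComponent (p := p) h
  refine ⟨W, hW, hxW, ?_⟩
  have h₁ := (mres_homApp φ le_top hW s).trans (hφ W _ t ht)
  exact h₁ ▸ ht.1

/-- A section of `G_p` over `D(r)` extends to `U` after multiplication by a power of `r`. -/
theorem exists_extension {U : X.Opens} (hG : IsLocalizingOn (toPMod G.toModules) U) (p : ℤ)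
    (r : RSec X.presheaf U) {m : MSec G.mod (X.basicOpen r)} (hm : m ∈ G.deg p (X.basicOpen r)) :
    ∃ (N : ℕ), ∃ m' ∈ G.deg p U, mres G.mod (X.basicOpen_le r) m' =
      rres A.ring (X.basicOpen_le r) (aunit A U r) ^ N • m := by
  obtain ⟨φ, hφ⟩ := exists_projection G p
  obtain ⟨N, m', h⟩ := (hG r).2 m
  -- The extension `m'` of `r ^ N • m` need not be homogeneous; its component of degree `p` is
  -- another extension.
  refine ⟨N, homApp φ le_top m', IsComponent.of_homApp hφ m', ?_⟩
  refine (mres_homApp φ le_top (X.basicOpen_le r) m').trans ?_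
  have h₁ : mres G.mod (X.basicOpen_le r) m' =
      aunit A (X.basicOpen r) (rres X.presheaf (X.basicOpen_le r) r ^ N) • m := h
  rw [rres_aunit, ← map_pow]
  refine hφ _ _ _ ?_
  have h₂ := (IsComponent.of_mem hm).smul (rres X.presheaf (X.basicOpen_le r) r ^ N)
  exact h₁.symm ▸ h₂

/-- A section of `G` over `U` which vanishes on `D(r)` is killed by a power of `r`. -/
theorem exists_pow_smul_eq_zero {U : X.Opens} (hG : IsLocalizingOn (toPMod G.toModules) U)
    (r : RSec X.presheaf U) {m : MSec G.mod U} (hm : mres G.mod (X.basicOpen_le r) m = 0) :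
    ∃ N : ℕ, aunit A U r ^ N • m = 0 := by
  obtain ⟨N, h⟩ := (hG r).1 m hm
  refine ⟨N, ?_⟩
  rw [← map_pow]
  exact h

/-- If a sum of homogeneous elements of distinct degrees vanishes, so does each of them. -/
theorem smul_eq_zero_of_sum {V : X.Opens} {d : ℤ} {m : MSec G.mod V} (hm : m ∈ G.deg d V)
    (s : Finset ℕ) (a : ℕ → RSec A.ring V) (ha : ∀ i, a i ∈ A.deg i V)
    (h : (∑ i ∈ s, a i) • m = 0) {j : ℕ} (hj : j ∈ s) : a j • m = 0 := by
  have h₁ : IsComponent G (j + d) 0 (a j • m) := by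
    refine ⟨G.smul_mem (ha j) hm, ?_⟩
    rw [← h, ← Finset.add_sum_erase s a hj, add_smul, add_sub_cancel_left, Finset.sum_smul]
    refine sum_mem fun i hi => ?_
    have hij : ((i : ℤ) + d) ≠ j + d := by
      have := Finset.ne_of_mem_erase hi
      omega
    exact le_iSup₂ (f := fun (q : ℤ) (_ : q ≠ j + d) => G.deg q V) _ hij (G.smul_mem (ha i) hm)
  exact h₁.eq (IsComponent.of_mem (zero_mem _))

end Component

/-! ### Polynomial charts -/

section Chart

variable {X : Scheme.{u}} {n : ℕ}

/-- The evaluation of polynomials over `𝒪_X(V)` at sections `x_j` of `A`. -/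
def polyEv (A : GrAlg X) {U : X.Opens} (x : Fin n → RSec A.ring U) {V : X.Opens} (h : V ≤ U) :
    MvPolynomial (Fin n) (RSec X.presheaf V) →+* RSec A.ring V :=
  MvPolynomial.eval₂Hom (aunit A V) fun j => rres A.ring h (x j)

section

variable (A : GrAlg X) {U : X.Opens} (x : Fin n → RSec A.ring U) {V W : X.Opens}

theorem polyEv_C (h : V ≤ U) (r : RSec X.presheaf V) :
    polyEv A x h (MvPolynomial.C r) = aunit A V r := MvPolynomial.eval₂Hom_C _ _ r

theorem polyEv_X (h : V ≤ U) (j : Fin n) :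
    polyEv A x h (MvPolynomial.X j) = rres A.ring h (x j) := MvPolynomial.eval₂Hom_X' _ _ j

theorem rres_polyEv (h : V ≤ U) (h' : W ≤ V) (f : MvPolynomial (Fin n) (RSec X.presheaf V)) :
    rres A.ring h' (polyEv A x h f) =
      polyEv A x (h'.trans h) (MvPolynomial.map (rres X.presheaf h') f) := by
  induction f using MvPolynomial.induction_on with
  | C r => rw [MvPolynomial.map_C, polyEv_C, polyEv_C, rres_aunit]
  | add f g hf hg => simp only [map_add, hf, hg]
  | mul_X f j hf => rw [map_mul, map_mul, map_mul, map_mul, hf, MvPolynomial.map_X, polyEv_X,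
      polyEv_X, rres_rres]

end

/-- Over `U`, the sheaf of algebras `A` is the polynomial algebra in the sections `x_j` of degree
one. -/
structure IsPolyChart (A : GrAlg X) {U : X.Opens} (x : Fin n → RSec A.ring U) : Prop where
  mem_deg : ∀ j, x j ∈ A.deg 1 U
  injective : ∀ (V : X.Opens) (h : V ≤ U), Function.Injective (polyEv A x h)
  exists_polyEv_eq : ∀ (V : X.Opens) (h : V ≤ U) (a : RSec A.ring V), ∀ z ∈ V,
    ∃ (W : X.Opens) (hW : W ≤ V), z ∈ W ∧ ∃ f, polyEv A x (hW.trans h) f = rres A.ring hW a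
  exists_homogeneous : ∀ (V : X.Opens) (h : V ≤ U) (i : ℕ) (a : RSec A.ring V), a ∈ A.deg i V →
    ∀ z ∈ V, ∃ (W : X.Opens) (hW : W ≤ V), z ∈ W ∧ ∃ f, f.IsHomogeneous i ∧
      polyEv A x (hW.trans h) f = rres A.ring hW a

/-- The map from the presheaf of symmetric algebras to its sheafification is locally injective. -/
theorem toSymSec_eq_zero (F : X.Modules) {V : X.Opens}
    {t : SymmetricAlgebra (RSec X.presheaf V) (MSec (toPMod F) V)} (h : toSymSec F V t = 0)
    {z : X} (hz : z ∈ V) : ∃ (W : X.Opens) (hW : W ≤ V), z ∈ W ∧ symRes (toPMod F) hW t = 0 := by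
  have h₁ := Presheaf.equalizerSieve_mem (Opens.grothendieckTopology X.toTopCat)
    (toSheafify (Opens.grothendieckTopology X.toTopCat) (symPresheaf (toPMod F)))
    (X := op V) t 0 (h.trans (map_zero (toSymSec F V)).symm)
  obtain ⟨W, f, hf, hzW⟩ := h₁ z hz
  exact ⟨W, f.le, hzW, (show symRes (toPMod F) f.le t = symRes (toPMod F) f.le 0 from hf).trans
    (map_zero _)⟩

/-- The map from the presheaf of symmetric algebras to its sheafification is locally surjective. -/
theorem exists_toSymSec_eq (F : X.Modules) {V : X.Opens} (a : RSec (symRing F).obj V)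
    {z : X} (hz : z ∈ V) : ∃ (W : X.Opens) (hW : W ≤ V), z ∈ W ∧
      ∃ t, toSymSec F W t = rres (symRing F).obj hW a := by
  have h₁ := Presheaf.imageSieve_mem (Opens.grothendieckTopology X.toTopCat)
    (toSheafify (Opens.grothendieckTopology X.toTopCat) (symPresheaf (toPMod F)))
    (U := op V) a
  obtain ⟨W, f, ⟨t, ht⟩, hzW⟩ := h₁ z hz
  exact ⟨W, f.le, hzW, t, ht⟩

/-- The sections `x_j` of `F` over `U` form a basis of `F(V)` for all open `V ⊆ U`. -/
def IsFrame (F : PMod X.presheaf) {U : X.Opens} (x : Fin n → MSec F U) : Prop :=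
  ∀ (V : X.Opens) (h : V ≤ U), Function.Bijective
    fun c : Fin n → RSec X.presheaf V => ∑ j, c j • mres F h (x j)

/-- The isomorphism `𝒪_X(V)ⁿ ≃ F(V)` given by a frame. -/
def IsFrame.equiv {F : PMod X.presheaf} {U : X.Opens} {x : Fin n → MSec F U} (hx : IsFrame F x)
    {V : X.Opens} (h : V ≤ U) : (Fin n → RSec X.presheaf V) ≃ₗ[RSec X.presheaf V] MSec F V :=
  LinearEquiv.ofBijective (Fintype.linearCombination (RSec X.presheaf V) fun j => mres F h (x j))
    (hx V h)

theorem IsFrame.equiv_apply {F : PMod X.presheaf} {U : X.Opens} {x : Fin n → MSec F U}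
    (hx : IsFrame F x) {V : X.Opens} (h : V ≤ U) (c : Fin n → RSec X.presheaf V) :
    hx.equiv h c = ∑ j, c j • mres F h (x j) := rfl

/-- The basis of `F(V)` given by a frame. -/
def IsFrame.basis {F : PMod X.presheaf} {U : X.Opens} {x : Fin n → MSec F U} (hx : IsFrame F x)
    {V : X.Opens} (h : V ≤ U) : Module.Basis (Fin n) (RSec X.presheaf V) (MSec F V) :=
  Module.Basis.ofEquivFun (hx.equiv h).symm

theorem IsFrame.basis_apply {F : PMod X.presheaf} {U : X.Opens} {x : Fin n → MSec F U}
    (hx : IsFrame F x) {V : X.Opens} (h : V ≤ U) (j : Fin n) :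
    hx.basis h j = mres F h (x j) := by
  rw [IsFrame.basis, Module.Basis.coe_ofEquivFun, LinearEquiv.symm_symm]
  dsimp only
  rw [IsFrame.equiv_apply,
    Finset.sum_eq_single j (fun i _ hi => by rw [Pi.single_eq_of_ne hi, zero_smul])
      (fun h => absurd (Finset.mem_univ j) h), Pi.single_eq_same, one_smul]

theorem mres_sum {F : PMod X.presheaf} {U V : X.Opens} (h : V ≤ U) (c : Fin n → RSec X.presheaf U)
    (x : Fin n → MSec F U) : mres F h (∑ j, c j • x j) =
      ∑ j, rres X.presheaf h (c j) • mres F h (x j) := by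
  rw [map_sum]
  exact Finset.sum_congr rfl fun j _ => mres_smul F h _ _

theorem IsFrame.equiv_symm_mres {F : PMod X.presheaf} {U : X.Opens} {x : Fin n → MSec F U}
    (hx : IsFrame F x) {V W : X.Opens} (h : V ≤ U) (h' : W ≤ V) (s : MSec F V) (j : Fin n) :
    (hx.equiv (h'.trans h)).symm (mres F h' s) j =
      rres X.presheaf h' ((hx.equiv h).symm s j) := by
  obtain ⟨c, rfl⟩ := (hx.equiv h).surjective s
  have : mres F h' (hx.equiv h c) = hx.equiv (h'.trans h) fun j => rres X.presheaf h' (c j) := by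
    simp only [IsFrame.equiv_apply, mres_sum, mres_mres]
  rw [this, LinearEquiv.symm_apply_apply, LinearEquiv.symm_apply_apply]

section Dual

variable (E : X.Modules) {U : X.Opens} {e : Fin n → MSec (toPMod E) U}

/-- The elements of the frame of `E^∨` dual to a frame of `E`. -/
def dualFrame (he : IsFrame (toPMod E) e) (j : Fin n) : MSec (toPMod (dual E)) U :=
  (⟨fun V =>
    { toFun := fun s => ((he.equiv V.2).symm s j : RSec X.presheaf V.1)
      map_add' := fun s t => congrFun ((he.equiv V.2).symm.map_add s t) j
      map_smul' := fun r s => congrFun ((he.equiv V.2).symm.map_smul r s) j },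
    fun V _ h s => (he.equiv_symm_mres V.2 h s j).symm⟩ :
    homSec (toPMod E) (toPMod (SheafOfModules.unit X.ringCatSheaf)) U)

/-- Evaluation of the sections of `𝓗om_R(M, N)` at a section of `M`, as an additive map. -/
def homEval {R : TopCat.Presheaf CommRingCat.{u} X.toTopCat} {M N : PMod R} {V W : X.Opens}
    (h : W ≤ V) (s : MSec M W) : homSec M N V →+ MSec N W where
  toFun φ := homApp φ h s
  map_zero' := rfl
  map_add' _ _ := rfl

/-- The structure sheaf as a presheaf of modules over itself. -/
abbrev unitPMod (X : Scheme.{u}) : PMod X.presheaf := toPMod (SheafOfModules.unit X.ringCatSheaf)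

theorem homApp_sum_dualFrame (he : IsFrame (toPMod E) e) {V W : X.Opens} (h : V ≤ U)
    (c : Fin n → RSec X.presheaf V) (hW : W ≤ V) (s : MSec (toPMod E) W) :
    (homApp (∑ j, c j • homRes h (dualFrame E he j) : homSec (toPMod E) (unitPMod X) V) hW s :
      RSec X.presheaf W) =
      ∑ j, rres X.presheaf hW (c j) * (he.equiv (hW.trans h)).symm s j :=
  map_sum (homEval (N := unitPMod X) hW s) (fun j => c j • homRes h (dualFrame E he j)) Finset.univ

theorem isFrame_dualFrame (he : IsFrame (toPMod E) e) :
    IsFrame (toPMod (dual E)) (dualFrame E he) := by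
  intro V h
  constructor
  · intro c c' hc
    funext k
    have h₁ : ∀ c : Fin n → RSec X.presheaf V,
        (homApp (∑ j, c j • homRes h (dualFrame E he j) : homSec (toPMod E) (unitPMod X) V)
          le_rfl (he.equiv h (Pi.single k 1)) : RSec X.presheaf V) = c k := by
      intro c
      rw [homApp_sum_dualFrame, LinearEquiv.symm_apply_apply, Finset.sum_eq_single k
        (fun j _ hj => by rw [Pi.single_eq_of_ne hj, mul_zero])
        (fun hk => absurd (Finset.mem_univ k) hk), Pi.single_eq_same, mul_one, rres_self]
    have h₂ := congrArg (fun φ : homSec (toPMod E) (unitPMod X) V =>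
      (homApp φ le_rfl (he.equiv h (Pi.single k 1)) : RSec X.presheaf V)) hc
    exact (h₁ c).symm.trans (h₂.trans (h₁ c'))
  · intro φ
    let φ' : homSec (toPMod E) (unitPMod X) V := φ
    let c : Fin n → RSec X.presheaf V := fun j => homApp φ' le_rfl (mres (toPMod E) h (e j))
    refine ⟨c, ?_⟩
    have h₁ : (∑ j, c j • homRes h (dualFrame E he j) : homSec (toPMod E) (unitPMod X) V) = φ' := by
      refine homSec_ext fun W hW s => ?_
      refine (homApp_sum_dualFrame E he h c hW s).trans ?_
      obtain ⟨b, rfl⟩ := (he.equiv (hW.trans h)).surjective s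
      rw [LinearEquiv.symm_apply_apply, IsFrame.equiv_apply]
      refine Eq.trans ?_ (map_sum (homApp φ' hW) _ _).symm
      refine Finset.sum_congr rfl fun j _ => ?_
      rw [mul_comm, map_smul]
      have h₂ : rres X.presheaf hW (c j) = homApp φ' hW (mres (toPMod E) (hW.trans h) (e j)) := by
        rw [← mres_mres (toPMod E) h hW]
        exact mres_homApp φ' le_rfl hW _
      exact congrArg (fun t : RSec X.presheaf W => b j * t) h₂
    exact h₁

end Dual

/-- `toSymSec` with values in the sections of the algebra `symAlg F`. -/
def toSymAlg (F : X.Modules) (V : X.Opens) :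
    SymmetricAlgebra (RSec X.presheaf V) (MSec (toPMod F) V) →+* RSec (symAlg F).ring V :=
  toSymSec F V

theorem toSymAlg_algebraMap (F : X.Modules) {V : X.Opens} (r : RSec X.presheaf V) :
    toSymAlg F V (algebraMap _ _ r) = aunit (symAlg F) V r := rfl

theorem rres_toSymAlg (F : X.Modules) {U V : X.Opens} (h : V ≤ U)
    (a : SymmetricAlgebra (RSec X.presheaf U) (MSec (toPMod F) U)) :
    rres (symAlg F).ring h (toSymAlg F U a) = toSymAlg F V (symRes (toPMod F) h a) :=
  rres_toSymSec F h a

/-- The sections of degree one of `Sym F` given by sections of `F`. -/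
def symGen (F : X.Modules) {U : X.Opens} (x : Fin n → MSec (toPMod F) U) (j : Fin n) :
    RSec (symAlg F).ring U := toSymAlg F U (SymmetricAlgebra.ι _ _ (x j))

theorem toSymAlg_equivMvPolynomial_symm (F : X.Modules) {U : X.Opens}
    {x : Fin n → MSec (toPMod F) U} (hx : IsFrame (toPMod F) x) {V : X.Opens} (h : V ≤ U)
    (f : MvPolynomial (Fin n) (RSec X.presheaf V)) :
    toSymAlg F V ((SymmetricAlgebra.equivMvPolynomial (hx.basis h)).symm f) =
      polyEv (symAlg F) (symGen F x) h f := by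
  induction f using MvPolynomial.induction_on with
  | C r => rw [polyEv_C, ← MvPolynomial.algebraMap_eq, AlgEquiv.commutes, toSymAlg_algebraMap]
  | add f g hf hg => rw [map_add, map_add, map_add, hf, hg]
  | mul_X f j hf =>
    rw [map_mul, map_mul, map_mul, hf, polyEv_X, SymmetricAlgebra.equivMvPolynomial_symm_X,
      hx.basis_apply, symGen, rres_toSymAlg, symRes_ι]

theorem symRes_equivMvPolynomial_symm (F : X.Modules) {U : X.Opens}
    {x : Fin n → MSec (toPMod F) U} (hx : IsFrame (toPMod F) x) {V W : X.Opens} (h : V ≤ U)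
    (hW : W ≤ V) (f : MvPolynomial (Fin n) (RSec X.presheaf V)) :
    symRes (toPMod F) hW ((SymmetricAlgebra.equivMvPolynomial (hx.basis h)).symm f) =
      (SymmetricAlgebra.equivMvPolynomial (hx.basis (hW.trans h))).symm
        (MvPolynomial.map (rres X.presheaf hW) f) := by
  induction f using MvPolynomial.induction_on with
  | C r => rw [MvPolynomial.map_C, ← MvPolynomial.algebraMap_eq, ← MvPolynomial.algebraMap_eq,
      AlgEquiv.commutes, AlgEquiv.commutes, symRes_algebraMap]
  | add f g hf hg => simp only [map_add, hf, hg]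
  | mul_X f j hf =>
    rw [map_mul, map_mul, map_mul, map_mul, hf, MvPolynomial.map_X,
      SymmetricAlgebra.equivMvPolynomial_symm_X, SymmetricAlgebra.equivMvPolynomial_symm_X,
      hx.basis_apply, hx.basis_apply, symRes_ι, mres_mres]

theorem isHomogeneous_equivMvPolynomial {R M : Type*} [CommRing R] [AddCommGroup M] [Module R M]
    {σ : Type*} (b : Module.Basis σ R M) (i : ℕ) {t : SymmetricAlgebra R M}
    (ht : t ∈ LinearMap.range (SymmetricAlgebra.ι R M) ^ i) :
    (SymmetricAlgebra.equivMvPolynomial b t).IsHomogeneous i := by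
  induction i generalizing t with
  | zero =>
    rw [pow_zero, Submodule.mem_one] at ht
    obtain ⟨r, rfl⟩ := ht
    rw [AlgEquiv.commutes]
    exact MvPolynomial.isHomogeneous_C _ r
  | succ i ih =>
    rw [pow_succ] at ht
    induction ht using Submodule.mul_induction_on' with
    | mem_mul_mem a ha c hc =>
      rw [map_mul]
      refine (ih ha).mul ?_
      obtain ⟨m, rfl⟩ := hc
      rw [← b.linearCombination_repr m, Finsupp.linearCombination_apply, Finsupp.sum, map_sum,
        map_sum]
      refine MvPolynomial.IsHomogeneous.sum _ _ _ fun j _ => ?_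
      rw [map_smul, map_smul, SymmetricAlgebra.equivMvPolynomial_ι_apply, MvPolynomial.smul_eq_C_mul]
      exact (MvPolynomial.isHomogeneous_X R j).C_mul _
    | add a _ b _ ha hb =>
      rw [map_add]
      exact ha.add hb

/-- A frame of `F` identifies the presheaf of symmetric algebras of `F` with polynomial algebras, and
this presheaf is locally isomorphic to its sheafification. -/
theorem isPolyChart_symAlg (F : X.Modules) {U : X.Opens}
    {x : Fin n → MSec (toPMod F) U} (hx : IsFrame (toPMod F) x) :
    IsPolyChart (symAlg F) (symGen F x) where
  mem_deg j z hz := ⟨U, le_rfl, hz, SymmetricAlgebra.ι _ _ (x j), by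
    rw [symPower, pow_one]
    exact ⟨x j, rfl⟩, rres_self _ _⟩
  injective V h := by
    refine (injective_iff_map_eq_zero _).2 fun f hf => ?_
    rw [← toSymAlg_equivMvPolynomial_symm F hx h] at hf
    ext α
    rw [MvPolynomial.coeff_zero]
    refine eq_of_locally_of_mem (N := toPMod (SheafOfModules.unit X.ringCatSheaf))
      (SheafOfModules.unit X.ringCatSheaf).isSheaf (U := V) _ _ fun z hz => ?_
    obtain ⟨W, hW, hzW, h'⟩ := toSymSec_eq_zero F hf hz
    refine ⟨W, hW, hzW, ?_⟩
    rw [symRes_equivMvPolynomial_symm F hx h hW, EmbeddingLike.map_eq_zero_iff] at h'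
    have h₂ := congrArg (MvPolynomial.coeff α) h'
    rw [MvPolynomial.coeff_map, MvPolynomial.coeff_zero] at h₂
    exact h₂.trans (map_zero (rres X.presheaf hW)).symm
  exists_polyEv_eq V h a z hz := by
    obtain ⟨W, hW, hzW, t, ht⟩ := exists_toSymSec_eq F a hz
    refine ⟨W, hW, hzW, SymmetricAlgebra.equivMvPolynomial (hx.basis (hW.trans h)) t, ?_⟩
    rw [← toSymAlg_equivMvPolynomial_symm F hx, AlgEquiv.symm_apply_apply]
    exact ht
  exists_homogeneous V h i a ha z hz := by
    obtain ⟨W, hW, hzW, t, ht, h'⟩ := ha z hz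
    refine ⟨W, hW, hzW, SymmetricAlgebra.equivMvPolynomial (hx.basis (hW.trans h)) t,
      isHomogeneous_equivMvPolynomial _ i ht, ?_⟩
    rw [← toSymAlg_equivMvPolynomial_symm F hx, AlgEquiv.symm_apply_apply]
    exact h'.symm

end Chart

/-! ### Ideals and denominators in a polynomial chart -/

section ChartLemmas

variable {X : Scheme.{u}} {n : ℕ} {A : GrAlg X} {U : X.Opens} {x : Fin n → RSec A.ring U}

theorem polyEv_mem_deg (hx : IsPolyChart A x) {V : X.Opens} (h : V ≤ U) {i : ℕ}
    {f : MvPolynomial (Fin n) (RSec X.presheaf V)} (hf : f.IsHomogeneous i) :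
    polyEv A x h f ∈ A.deg i V := by
  have hmon : ∀ α : Fin n →₀ ℕ, polyEv A x h (MvPolynomial.monomial α 1) ∈ A.deg α.degree V := by
    intro α
    induction α using Finsupp.induction_linear with
    | zero =>
      have h₁ : (MvPolynomial.monomial (0 : Fin n →₀ ℕ) (1 : RSec X.presheaf V)) = 1 := rfl
      rw [h₁, map_one, map_zero]
      exact one_mem_deg A V
    | add α β hα hβ =>
      have h₁ : MvPolynomial.monomial (α + β) (1 : RSec X.presheaf V) =
          MvPolynomial.monomial α 1 * MvPolynomial.monomial β 1 := by
        rw [MvPolynomial.monomial_mul, one_mul]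
      rw [h₁, map_mul, map_add]
      exact A.mul_mem hα hβ
    | single j k =>
      have h₁ : MvPolynomial.monomial (Finsupp.single j k) (1 : RSec X.presheaf V) =
          MvPolynomial.X j ^ k := (MvPolynomial.X_pow_eq_monomial).symm
      rw [h₁, map_pow, polyEv_X, Finsupp.degree_single]
      have := pow_mem_deg A (A.res_mem h (hx.mem_deg j)) k
      rwa [mul_one] at this
  rw [f.as_sum, map_sum]
  refine sum_mem fun α hα => ?_
  have h₁ : MvPolynomial.monomial α (f.coeff α) =
      MvPolynomial.C (f.coeff α) * MvPolynomial.monomial α 1 := by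
    rw [MvPolynomial.C_mul_monomial, mul_one]
  have h₂ : α.degree = i := by
    rw [Finsupp.degree_eq_weight_one]
    exact hf (MvPolynomial.mem_support_iff.1 hα)
  rw [h₁, map_mul, polyEv_C, ← h₂]
  have := A.mul_mem (aunit_mem A (f.coeff α)) (hmon α)
  rwa [zero_add] at this

theorem map_mem_pow_idealOfVars {R S : Type*} [CommRing R] [CommRing S] (φ : R →+* S) {σ : Type*}
    (k : ℕ) {f : MvPolynomial σ R} (hf : f ∈ MvPolynomial.idealOfVars σ R ^ k) :
    MvPolynomial.map φ f ∈ MvPolynomial.idealOfVars σ S ^ k := by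
  rw [MvPolynomial.mem_pow_idealOfVars_iff] at hf ⊢
  exact fun α hα => hf α (MvPolynomial.support_map_subset φ f hα)

/-- The sections of `A` over `V` which are given, near the point `z`, by polynomials all of whose
monomials have degree at least `k`. -/
def polyIdealAt (hx : IsPolyChart A x) {V : X.Opens} (h : V ≤ U) {z : X} (hz : z ∈ V) (k : ℕ) :
    Ideal (RSec A.ring V) where
  carrier := {a | ∃ (W : X.Opens) (hW : W ≤ V), z ∈ W ∧
    ∃ f ∈ MvPolynomial.idealOfVars (Fin n) (RSec X.presheaf W) ^ k,
      polyEv A x (hW.trans h) f = rres A.ring hW a}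
  zero_mem' := ⟨V, le_rfl, hz, 0, zero_mem _, by rw [map_zero, map_zero]⟩
  add_mem' := by
    rintro a b ⟨W, hW, hzW, f, hf, ha⟩ ⟨W', hW', hzW', g, hg, hb⟩
    refine ⟨W ⊓ W', inf_le_left.trans hW, ⟨hzW, hzW'⟩,
      MvPolynomial.map (rres X.presheaf inf_le_left) f +
        MvPolynomial.map (rres X.presheaf inf_le_right) g,
      add_mem (map_mem_pow_idealOfVars _ k hf) (map_mem_pow_idealOfVars _ k hg), ?_⟩
    rw [map_add, map_add, ← rres_polyEv A x (hW.trans h), ← rres_polyEv A x (hW'.trans h), ha, hb,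
      rres_rres, rres_rres]
  smul_mem' := by
    rintro c a ⟨W, hW, hzW, f, hf, ha⟩
    obtain ⟨W', hW', hzW', g, hg⟩ := hx.exists_polyEv_eq V h c z hz
    refine ⟨W ⊓ W', inf_le_left.trans hW, ⟨hzW, hzW'⟩,
      MvPolynomial.map (rres X.presheaf inf_le_right) g *
        MvPolynomial.map (rres X.presheaf inf_le_left) f,
      Ideal.mul_mem_left _ _ (map_mem_pow_idealOfVars _ k hf), ?_⟩
    rw [smul_eq_mul, map_mul, map_mul, ← rres_polyEv A x (hW.trans h),
      ← rres_polyEv A x (hW'.trans h), ha, hg, rres_rres, rres_rres]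

theorem mul_mem_polyIdealAt (hx : IsPolyChart A x) {V : X.Opens} (h : V ≤ U) {z : X} (hz : z ∈ V)
    {k l : ℕ} {a b : RSec A.ring V} (ha : a ∈ polyIdealAt hx h hz k)
    (hb : b ∈ polyIdealAt hx h hz l) : a * b ∈ polyIdealAt hx h hz (k + l) := by
  obtain ⟨W, hW, hzW, f, hf, ha⟩ := ha
  obtain ⟨W', hW', hzW', g, hg, hb⟩ := hb
  refine ⟨W ⊓ W', inf_le_left.trans hW, ⟨hzW, hzW'⟩,
    MvPolynomial.map (rres X.presheaf inf_le_left) f *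
      MvPolynomial.map (rres X.presheaf inf_le_right) g, ?_, ?_⟩
  · rw [pow_add]
    exact Ideal.mul_mem_mul (map_mem_pow_idealOfVars _ k hf) (map_mem_pow_idealOfVars _ l hg)
  · rw [map_mul, map_mul, ← rres_polyEv A x (hW.trans h), ← rres_polyEv A x (hW'.trans h), ha, hb,
      rres_rres, rres_rres]

theorem positiveIdeal_pow_le (hx : IsPolyChart A x) {V : X.Opens} (h : V ≤ U) {z : X} (hz : z ∈ V)
    (k : ℕ) : positiveIdeal A V ^ k ≤ polyIdealAt hx h hz k := by
  have h₁ : positiveIdeal A V ≤ polyIdealAt hx h hz 1 := by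
    rw [positiveIdeal, Ideal.span_le]
    rintro a ⟨i, hi, ha⟩
    obtain ⟨W, hW, hzW, f, hf, h'⟩ := hx.exists_homogeneous V h i a ha z hz
    refine ⟨W, hW, hzW, f, ?_, h'⟩
    rw [MvPolynomial.mem_pow_idealOfVars_iff]
    intro α hα
    have h₁ : α.degree = i := by
      rw [Finsupp.degree_eq_weight_one]
      exact hf (MvPolynomial.mem_support_iff.1 hα)
    rw [h₁]
    exact hi
  induction k with
  | zero =>
    intro a _
    obtain ⟨W, hW, hzW, f, h'⟩ := hx.exists_polyEv_eq V h a z hz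
    exact ⟨W, hW, hzW, f, by rw [pow_zero, Ideal.one_eq_top]; trivial, h'⟩
  | succ k ih =>
    rw [pow_succ, Ideal.mul_le]
    exact fun a ha b hb => mul_mem_polyIdealAt hx h hz (ih ha) (h₁ hb)

/-- The sections of `I^k` are locally the polynomials in the `x_j` all of whose monomials have degree at
least `k`. -/
theorem exists_polyEv_eq_of_mem_idealPow (hx : IsPolyChart A x) {V : X.Opens} (h : V ≤ U) (k : ℕ)
    {a : RSec A.ring V} (ha : a ∈ idealPow A k V) {z : X} (hz : z ∈ V) :
    ∃ (W : X.Opens) (hW : W ≤ V), z ∈ W ∧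
      ∃ f ∈ MvPolynomial.idealOfVars (Fin n) (RSec X.presheaf W) ^ k,
        polyEv A x (hW.trans h) f = rres A.ring hW a := by
  obtain ⟨V', hV', hzV', ha'⟩ := ha z hz
  obtain ⟨W, hW, hzW, f, hf, h'⟩ := positiveIdeal_pow_le hx (hV'.trans h) hzV' k ha'
  exact ⟨W, hW.trans hV', hzW, f, hf, by rw [h', rres_rres]⟩

theorem polyEv_mem_idealPow (hx : IsPolyChart A x) {V : X.Opens} (h : V ≤ U) (k : ℕ)
    {f : MvPolynomial (Fin n) (RSec X.presheaf V)}
    (hf : f ∈ MvPolynomial.idealOfVars (Fin n) (RSec X.presheaf V) ^ k) :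
    polyEv A x h f ∈ idealPow A k V := by
  intro z hz
  refine ⟨V, le_rfl, hz, ?_⟩
  rw [rres_self]
  have h₁ : (MvPolynomial.idealOfVars (Fin n) (RSec X.presheaf V)).map (polyEv A x h) ≤
      positiveIdeal A V := by
    rw [MvPolynomial.idealOfVars, Ideal.map_span, Ideal.span_le]
    rintro _ ⟨_, ⟨j, rfl⟩, rfl⟩
    refine Ideal.subset_span ⟨1, one_pos, ?_⟩
    rw [polyEv_X]
    exact A.res_mem h (hx.mem_deg j)
  have h₂ := Ideal.mem_map_of_mem (polyEv A x h) hf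
  rw [Ideal.map_pow] at h₂
  exact Ideal.pow_right_mono h₁ k h₂

end ChartLemmas

section Away

variable {R S σ : Type*} [CommRing R] [CommRing S] [Algebra R S]

attribute [local instance] MvPolynomial.algebraMvPolynomial

theorem exists_map_eq_C_mul_of_away (r : R) [IsLocalization.Away r S] (f : MvPolynomial σ S) :
    ∃ (N : ℕ) (g : MvPolynomial σ R),
      MvPolynomial.map (algebraMap R S) g = MvPolynomial.C (algebraMap R S r ^ N) * f := by
  obtain ⟨⟨g, ⟨_, _, ⟨N, rfl⟩, rfl⟩⟩, h⟩ := IsLocalization.surj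
    ((Submonoid.powers r).map (MvPolynomial.C (σ := σ))) f
  refine ⟨N, g, h.symm.trans ?_⟩
  rw [mul_comm]
  congr 1
  change MvPolynomial.map (algebraMap R S) (MvPolynomial.C (r ^ N)) = _
  rw [MvPolynomial.map_C, map_pow]

theorem exists_pow_mul_eq_of_away (r : R) [IsLocalization.Away r S] {f g : MvPolynomial σ R}
    (h : MvPolynomial.map (algebraMap R S) f = MvPolynomial.map (algebraMap R S) g) :
    ∃ N : ℕ, MvPolynomial.C (r ^ N) * f = MvPolynomial.C (r ^ N) * g := by
  obtain ⟨⟨_, _, ⟨N, rfl⟩, rfl⟩, h⟩ := (IsLocalization.eq_iff_exists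
    ((Submonoid.powers r).map (MvPolynomial.C (σ := σ))) (MvPolynomial σ S)).1 h
  exact ⟨N, h⟩

end Away

section Affine

variable {X : Scheme.{u}} {n : ℕ} {A : GrAlg X} {U : X.Opens} {x : Fin n → RSec A.ring U}

/-- A polynomial over `𝒪_X(D(r))` becomes a polynomial over `𝒪_X(U)` after multiplication by a
power of `r`. -/
theorem exists_map_eq_C_mul (hU : IsAffineOpen U) (r : RSec X.presheaf U)
    (f : MvPolynomial (Fin n) (RSec X.presheaf (X.basicOpen r))) :
    ∃ (N : ℕ) (g : MvPolynomial (Fin n) (RSec X.presheaf U)),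
      MvPolynomial.map (rres X.presheaf (X.basicOpen_le r)) g =
        MvPolynomial.C (rres X.presheaf (X.basicOpen_le r) r ^ N) * f := by
  let _ : Algebra (RSec X.presheaf U) (RSec X.presheaf (X.basicOpen r)) :=
    (rres X.presheaf (X.basicOpen_le r)).toAlgebra
  have : IsLocalization.Away r (RSec X.presheaf (X.basicOpen r)) := hU.isLocalization_basicOpen r
  exact exists_map_eq_C_mul_of_away r f

theorem exists_pow_mul_eq (hU : IsAffineOpen U) (r : RSec X.presheaf U)
    {f g : MvPolynomial (Fin n) (RSec X.presheaf U)}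
    (h : MvPolynomial.map (rres X.presheaf (X.basicOpen_le r)) f =
      MvPolynomial.map (rres X.presheaf (X.basicOpen_le r)) g) :
    ∃ N : ℕ, MvPolynomial.C (r ^ N) * f = MvPolynomial.C (r ^ N) * g := by
  let _ : Algebra (RSec X.presheaf U) (RSec X.presheaf (X.basicOpen r)) :=
    (rres X.presheaf (X.basicOpen_le r)).toAlgebra
  have : IsLocalization.Away r (RSec X.presheaf (X.basicOpen r)) := hU.isLocalization_basicOpen r
  exact exists_pow_mul_eq_of_away (S := RSec X.presheaf (X.basicOpen r)) r h

theorem exists_germ_eq {z : X} (hz : z ∈ U) (b : AStalk A z) :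
    ∃ (V : X.Opens) (_ : V ≤ U) (hzV : z ∈ V) (a : RSec A.ring V), agerm A hzV a = b := by
  obtain ⟨V, hzV, a, rfl⟩ := TopCat.Presheaf.exists_germ_eq (X := X.toTopCat) A.ring b
  exact ⟨U ⊓ V, inf_le_left, ⟨hz, hzV⟩, rres A.ring inf_le_right a, agerm_rres A _ _ a⟩

/-- Each element of the stalk of `A` is a fraction with numerator in `𝒪_X(U)[X_1, …, X_n]` and
denominator in `𝒪_X(U)`. -/
theorem exists_agerm_mul_eq (hU : IsAffineOpen U) (hx : IsPolyChart A x) {z : X} (hz : z ∈ U)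
    (b : AStalk A z) : ∃ r : RSec X.presheaf U, z ∈ X.basicOpen r ∧
      ∃ f : MvPolynomial (Fin n) (RSec X.presheaf U),
        agerm A hz (aunit A U r) * b = agerm A hz (polyEv A x le_rfl f) := by
  obtain ⟨V, hV, hzV, a, rfl⟩ := exists_germ_eq hz b
  obtain ⟨W, hW, hzW, f, hf⟩ := hx.exists_polyEv_eq V hV a z hzV
  obtain ⟨r, hr, hzr⟩ := hU.exists_basicOpen_le ⟨z, hzW⟩ hz
  obtain ⟨N, g, hg⟩ := exists_map_eq_C_mul hU r (MvPolynomial.map (rres X.presheaf hr) f)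
  refine ⟨r ^ N, ?_, g, ?_⟩
  · rw [Scheme.mem_basicOpen X _ z hz, map_pow]
    exact ((Scheme.mem_basicOpen X _ z hz).1 hzr).pow N
  · have h₁ := congrArg (fun p => agerm A hzr (polyEv A x (X.basicOpen_le r) p)) hg
    dsimp only at h₁
    rw [← rres_polyEv A x le_rfl (X.basicOpen_le r), agerm_rres, map_mul, map_mul, polyEv_C,
      ← rres_polyEv A x (hW.trans hV) hr, hf, ← map_pow, ← rres_aunit, agerm_rres, agerm_rres,
      agerm_rres] at h₁
    exact h₁.symm

end Affine

/-! ### Points of `Proj` from homogeneous primes -/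

section Points

variable {X : Scheme.{u}} {n : ℕ} {A : GrAlg X} {U : X.Opens} {x : Fin n → RSec A.ring U}

variable (A) in
/-- The map `𝒪_{X,z} → A_z` on stalks. -/
def stalkUnit (z : X) : X.presheaf.stalk z →+* AStalk A z :=
  ((TopCat.Presheaf.stalkFunctor CommRingCat.{u} z).map A.unit).hom

theorem agerm_aunit {z : X} (hz : z ∈ U) (r : RSec X.presheaf U) :
    agerm A hz (aunit A U r) = stalkUnit A z ((X.presheaf.germ U z hz).hom r) :=
  (congrArg (fun f => f.hom r) (TopCat.Presheaf.stalkFunctor_map_germ U z hz A.unit)).symm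

theorem isUnit_agerm_aunit {z : X} (hz : z ∈ U) {r : RSec X.presheaf U} (h : z ∈ X.basicOpen r) :
    IsUnit (agerm A hz (aunit A U r)) := by
  rw [agerm_aunit]
  exact ((Scheme.mem_basicOpen X r z hz).1 h).map _

theorem agerm_aunit_notMem_iff (y : ProjPoint A) (hy : y.pt ∈ U) (r : RSec X.presheaf U) :
    agerm A hy (aunit A U r) ∉ y.ideal ↔ y.pt ∈ X.basicOpen r := by
  have h : y.ideal.comap (stalkUnit A y.pt) = IsLocalRing.maximalIdeal (X.presheaf.stalk y.pt) :=
    y.comap_eq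
  rw [agerm_aunit, ← Ideal.mem_comap, h, Scheme.mem_basicOpen X r y.pt hy,
    IsLocalRing.notMem_maximalIdeal]

theorem exists_C_mul_eq_of_agerm_eq (hU : IsAffineOpen U) (hx : IsPolyChart A x) {z : X}
    (hz : z ∈ U) {f g : MvPolynomial (Fin n) (RSec X.presheaf U)}
    (h : agerm A hz (polyEv A x le_rfl f) = agerm A hz (polyEv A x le_rfl g)) :
    ∃ r : RSec X.presheaf U, z ∈ X.basicOpen r ∧
      MvPolynomial.C r * f = MvPolynomial.C r * g := by
  obtain ⟨W, hzW, i, j, hW⟩ := TopCat.Presheaf.germ_eq (X := X.toTopCat) A.ring z hz hz _ _ h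
  obtain ⟨r, hr, hzr⟩ := hU.exists_basicOpen_le ⟨z, hzW⟩ hz
  have h₁ : rres A.ring (X.basicOpen_le r) (polyEv A x le_rfl f) =
      rres A.ring (X.basicOpen_le r) (polyEv A x le_rfl g) := by
    have h₂ : rres A.ring i.le (polyEv A x le_rfl f) = rres A.ring j.le (polyEv A x le_rfl g) := hW
    rw [← rres_rres i.le hr, h₂, rres_rres]
  rw [rres_polyEv, rres_polyEv] at h₁
  obtain ⟨N, hN⟩ := exists_pow_mul_eq hU r (hx.injective _ _ h₁)
  refine ⟨r ^ N, ?_, hN⟩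
  rw [Scheme.mem_basicOpen X _ z hz, map_pow]
  exact ((Scheme.mem_basicOpen X _ z hz).1 hzr).pow N

theorem mem_basicOpen_fromSpec (hU : IsAffineOpen U) (q : PrimeSpectrum (RSec X.presheaf U))
    (r : RSec X.presheaf U) : hU.fromSpec q ∈ X.basicOpen r ↔ r ∉ q.asIdeal := by
  have h : hU.fromSpec ⁻¹ᵁ X.basicOpen r = PrimeSpectrum.basicOpen r :=
    hU.fromSpec_preimage_basicOpen r
  exact (SetLike.ext_iff.1 h q).trans (PrimeSpectrum.mem_basicOpen r q)

theorem fromSpec_mem (hU : IsAffineOpen U) (q : PrimeSpectrum (RSec X.presheaf U)) :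
    hU.fromSpec q ∈ U := by
  exact hU.range_fromSpec.le (Set.mem_range_self q)

/-- A homogeneous prime ideal of `𝒪_X(U)[X_1, …, X_n]` which does not contain all the variables
defines a point of `Proj_X A`. -/
theorem exists_projPoint (hU : IsAffineOpen U) (hx : IsPolyChart A x)
    (P : Ideal (MvPolynomial (Fin n) (RSec X.presheaf U))) [hP : P.IsPrime]
    (hhom : ∀ f ∈ P, ∀ i, MvPolynomial.homogeneousComponent i f ∈ P)
    {j : Fin n} (hj : MvPolynomial.X j ∉ P) :
    ∃ (y : ProjPoint A) (hy : y.pt ∈ U), ∀ f,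
      agerm A hy (polyEv A x le_rfl f) ∈ y.ideal ↔ f ∈ P := by
  let q : PrimeSpectrum (RSec X.presheaf U) := ⟨P.comap MvPolynomial.C, inferInstance⟩
  let z : X := hU.fromSpec q
  have hz : z ∈ U := fromSpec_mem hU q
  have hbo : ∀ r : RSec X.presheaf U, z ∈ X.basicOpen r ↔ MvPolynomial.C r ∉ P :=
    fun r => mem_basicOpen_fromSpec hU q r
  have hC : ∀ r : RSec X.presheaf U, agerm A hz (polyEv A x le_rfl (MvPolynomial.C r)) =
      agerm A hz (aunit A U r) := fun r => by rw [polyEv_C]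
  -- The extension of `P` to the stalk `A_z`, which is the localization of the polynomial ring at the
  -- elements of `𝒪_X(U)` outside of `P`.
  let I : Ideal (AStalk A z) :=
    { carrier := {b | ∃ r : RSec X.presheaf U, z ∈ X.basicOpen r ∧ ∃ f ∈ P,
        agerm A hz (polyEv A x le_rfl (MvPolynomial.C r)) * b = agerm A hz (polyEv A x le_rfl f)}
      zero_mem' := ⟨1, by rw [hbo, map_one]; exact hP.one_notMem, 0, zero_mem _, by simp⟩
      add_mem' := by
        rintro b c ⟨r, hr, f, hf, h⟩ ⟨s, hs, g, hg, h'⟩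
        refine ⟨r * s, ?_, MvPolynomial.C s * f + MvPolynomial.C r * g,
          add_mem (Ideal.mul_mem_left _ _ hf) (Ideal.mul_mem_left _ _ hg), ?_⟩
        · rw [hbo, map_mul]
          exact hP.mul_notMem ((hbo r).1 hr) ((hbo s).1 hs)
        · simp only [map_mul, map_add, ← h, ← h']
          ring
      smul_mem' := by
        rintro c b ⟨r, hr, f, hf, h⟩
        obtain ⟨s, hs, g, h'⟩ := exists_agerm_mul_eq hU hx hz c
        rw [← hC] at h'
        refine ⟨s * r, ?_, g * f, Ideal.mul_mem_left _ _ hf, ?_⟩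
        · rw [hbo, map_mul]
          exact hP.mul_notMem ((hbo s).1 hs) ((hbo r).1 hr)
        · simp only [map_mul, smul_eq_mul, ← h, ← h']
          ring }
  have hI : ∀ f, agerm A hz (polyEv A x le_rfl f) ∈ I ↔ f ∈ P := by
    refine fun f => ⟨?_, fun hf => ⟨1, by rw [hbo, map_one]; exact hP.one_notMem, f, hf, by simp⟩⟩
    rintro ⟨r, hr, g, hg, h⟩
    rw [← map_mul, ← map_mul] at h
    obtain ⟨s, hs, h'⟩ := exists_C_mul_eq_of_agerm_eq hU hx hz h
    have h₁ : MvPolynomial.C s * (MvPolynomial.C r * f) ∈ P := h' ▸ Ideal.mul_mem_left _ _ hg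
    have h₂ := (hP.mem_or_mem h₁).resolve_left ((hbo s).1 hs)
    exact (hP.mem_or_mem h₂).resolve_left ((hbo r).1 hr)
  have hprime : I.IsPrime := by
    refine Ideal.isPrime_iff.2 ⟨fun h => ?_, fun {b c} hbc => ?_⟩
    · have h₁ : agerm A hz (polyEv A x le_rfl 1) ∈ I := by rw [h]; trivial
      exact hP.one_notMem ((hI 1).1 h₁)
    · obtain ⟨r, hr, f, h⟩ := exists_agerm_mul_eq hU hx hz b
      obtain ⟨s, hs, g, h'⟩ := exists_agerm_mul_eq hU hx hz c
      have h₁ : f * g ∈ P := by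
        rw [← hI, map_mul, map_mul, ← h, ← h', mul_mul_mul_comm]
        exact Ideal.mul_mem_left _ _ hbc
      rw [← hC] at h h'
      exact (hP.mem_or_mem h₁).imp (fun hf => ⟨r, hr, f, hf, h⟩) fun hg => ⟨s, hs, g, hg, h'⟩
  refine ⟨⟨z, I, hprime, ?_, ?_, ?_⟩, hz, hI⟩
  · change I.comap (stalkUnit A z) = IsLocalRing.maximalIdeal (X.presheaf.stalk z)
    refine le_antisymm (IsLocalRing.le_maximalIdeal (Ideal.comap_ne_top _ hprime.ne_top))
      fun a ha => ?_
    let _ : Algebra Γ(X, U) (X.presheaf.stalk z) := X.presheaf.algebra_section_stalk ⟨z, hz⟩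
    have := hU.isLocalization_stalk ⟨z, hz⟩
    obtain ⟨⟨s, t⟩, h⟩ := IsLocalization.surj
      (hU.primeIdealOf ⟨z, hz⟩).asIdeal.primeCompl a
    have ht : IsUnit ((X.presheaf.germ U z hz).hom t.1) :=
      IsLocalization.map_units (M := (hU.primeIdealOf ⟨z, hz⟩).asIdeal.primeCompl)
        (X.presheaf.stalk z) t
    have h' : a * (X.presheaf.germ U z hz).hom t.1 = (X.presheaf.germ U z hz).hom s := h
    refine ⟨t.1, (Scheme.mem_basicOpen X _ z hz).2 ht, MvPolynomial.C s, ?_, ?_⟩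
    · by_contra hs
      rw [← hbo, Scheme.mem_basicOpen X _ z hz] at hs
      have h₂ : (X.presheaf.germ U z hz).hom s ∈ IsLocalRing.maximalIdeal (X.presheaf.stalk z) :=
        h' ▸ Ideal.mul_mem_right _ _ ha
      exact h₂ hs
    · rw [hC, hC, agerm_aunit, agerm_aunit, ← h', map_mul, mul_comm]
  · refine le_antisymm (fun b hb => ?_) (Ideal.span_le.2 fun b hb => hb.1)
    obtain ⟨r, hr, f, hf, h⟩ := hb
    rw [hC] at h
    rw [← Ideal.unit_mul_mem_iff_mem _ (isUnit_agerm_aunit hz hr), h,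
      ← MvPolynomial.sum_homogeneousComponent f, map_sum, map_sum]
    refine sum_mem fun i _ => Ideal.subset_span ⟨(hI _).2 (hhom f hf i), i, U, hz, _,
      polyEv_mem_deg hx le_rfl (MvPolynomial.homogeneousComponent_isHomogeneous i f), rfl⟩
  · refine ⟨1, U, hz, one_pos, _, polyEv_mem_deg hx le_rfl (MvPolynomial.isHomogeneous_X _ j), ?_⟩
    rwa [hI]

end Points

/-! ### The Nullstellensatz for `Proj` -/

section HomogeneousPrime

variable {σ R : Type*} [CommRing R]

attribute [local instance] MvPolynomial.gradedAlgebra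

theorem coe_decompose_apply (f : MvPolynomial σ R) (i : ℕ) :
    (DirectSum.decompose (MvPolynomial.homogeneousSubmodule σ R) f i : MvPolynomial σ R) =
      MvPolynomial.homogeneousComponent i f := MvPolynomial.decomposition.decompose'_apply f i

theorem isHomogeneous_iff_homogeneousComponent_mem {I : Ideal (MvPolynomial σ R)} :
    I.IsHomogeneous (MvPolynomial.homogeneousSubmodule σ R) ↔
      ∀ f ∈ I, ∀ i, MvPolynomial.homogeneousComponent i f ∈ I :=
  ⟨fun h f hf i => coe_decompose_apply f i ▸ h i hf,
    fun h i f hf => (coe_decompose_apply f i).symm ▸ h f hf i⟩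

/-- A polynomial which is not in the radical of a homogeneous ideal avoids a homogeneous prime
ideal containing it. -/
theorem exists_homogeneous_prime {I : Ideal (MvPolynomial σ R)}
    (hI : ∀ f ∈ I, ∀ i, MvPolynomial.homogeneousComponent i f ∈ I) {f : MvPolynomial σ R}
    (hf : f ∉ I.radical) : ∃ P : Ideal (MvPolynomial σ R), P.IsPrime ∧ I ≤ P ∧ f ∉ P ∧
      ∀ g ∈ P, ∀ i, MvPolynomial.homogeneousComponent i g ∈ P := by
  rw [(isHomogeneous_iff_homogeneousComponent_mem.2 hI).radical_eq, Submodule.mem_sInf] at hf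
  push Not at hf
  obtain ⟨P, ⟨hP, hIP, hprime⟩, hfP⟩ := hf
  exact ⟨P, hprime, hIP, hfP, isHomogeneous_iff_homogeneousComponent_mem.1 hP⟩

theorem homogeneousComponent_mem_span {S : Set (MvPolynomial σ R)}
    (hS : ∀ f ∈ S, ∃ d, MvPolynomial.IsHomogeneous f d) :
    ∀ f ∈ Ideal.span S, ∀ i, MvPolynomial.homogeneousComponent i f ∈ Ideal.span S :=
  isHomogeneous_iff_homogeneousComponent_mem.1 (Ideal.homogeneous_span _ _ fun f hf => hS f hf)

/-- The homogeneous components of a multiple of a homogeneous polynomial `g` are homogeneous multiples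
of `g`. -/
theorem homogeneousComponent_mul {f g : MvPolynomial σ R} {d : ℕ} (hg : g.IsHomogeneous d)
    (i : ℕ) : ∃ c : MvPolynomial σ R, MvPolynomial.homogeneousComponent i (f * g) = c * g ∧
      (c = 0 ∨ d ≤ i ∧ c.IsHomogeneous (i - d)) := by
  classical
  have h := DirectSum.coe_decompose_mul_of_right_mem (MvPolynomial.homogeneousSubmodule σ R) i
    (a := f) (b := g) hg
  rw [coe_decompose_apply, coe_decompose_apply] at h
  by_cases hd : d ≤ i
  · rw [if_pos hd] at h
    exact ⟨_, h, Or.inr ⟨hd, MvPolynomial.homogeneousComponent_isHomogeneous _ _⟩⟩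
  · rw [if_neg hd] at h
    exact ⟨0, by rw [zero_mul]; exact h, Or.inl rfl⟩

end HomogeneousPrime

section Vanish

variable {X : Scheme.{u}} {n : ℕ} {A : GrAlg X} {U : X.Opens} {x : Fin n → RSec A.ring U}

theorem exists_X_notMem {σ R : Type*} [CommRing R] {f : MvPolynomial σ R} {e : ℕ}
    (hf : f.IsHomogeneous e) (he : 0 < e) {P : Ideal (MvPolynomial σ R)} (hfP : f ∉ P) :
    ∃ j, MvPolynomial.X j ∉ P := by
  by_contra! h
  refine hfP ?_
  have h₁ : MvPolynomial.idealOfVars σ R ≤ P := by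
    rw [MvPolynomial.idealOfVars, Ideal.span_le]
    rintro _ ⟨j, rfl⟩
    exact h j
  refine h₁ ?_
  rw [← pow_one (MvPolynomial.idealOfVars σ R), MvPolynomial.mem_pow_idealOfVars_iff]
  intro α hα
  have h₂ : α.degree = e := by
    rw [Finsupp.degree_eq_weight_one]
    exact hf (MvPolynomial.mem_support_iff.1 hα)
  rw [h₂]
  exact he

/-- The Nullstellensatz for `Proj`: a homogeneous polynomial of positive degree belongs to the
radical of a homogeneous ideal if it vanishes at all the common zeros of the ideal in `Proj`. -/
theorem mem_radical_of_forall_projPoint (hU : IsAffineOpen U) (hx : IsPolyChart A x)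
    {I : Ideal (MvPolynomial (Fin n) (RSec X.presheaf U))}
    (hI : ∀ f ∈ I, ∀ i, MvPolynomial.homogeneousComponent i f ∈ I)
    {f : MvPolynomial (Fin n) (RSec X.presheaf U)} {e : ℕ} (hf : f.IsHomogeneous e) (he : 0 < e)
    (h : ∀ (y : ProjPoint A) (hy : y.pt ∈ U), agerm A hy (polyEv A x le_rfl f) ∉ y.ideal →
      ∃ g ∈ I, agerm A hy (polyEv A x le_rfl g) ∉ y.ideal) : f ∈ I.radical := by
  by_contra hfI
  obtain ⟨P, hP, hIP, hfP, hhom⟩ := exists_homogeneous_prime hI hfI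
  obtain ⟨j, hj⟩ := exists_X_notMem hf he hfP
  obtain ⟨y, hy, hyP⟩ := exists_projPoint hU hx P hhom hj
  obtain ⟨g, hg, hgy⟩ := h y hy fun h => hfP ((hyP f).1 h)
  exact hgy ((hyP g).2 (hIP hg))

/-- A section of `G` which vanishes in the localized stalk at a point `y` of `Proj` is killed by a
polynomial which does not vanish at `y`. -/
theorem exists_smul_eq_zero_of_toFib {G : GrMod A} (hU : IsAffineOpen U) (hx : IsPolyChart A x)
    (hG : IsLocalizingOn (toPMod G.toModules) U) {m : MSec G.mod U} (y : ProjPoint A)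
    (hy : y.pt ∈ U) (h : toFib G y (ggerm G hy m) = 0) :
    ∃ g, agerm A hy (polyEv A x le_rfl g) ∉ y.ideal ∧ polyEv A x le_rfl g • m = 0 := by
  obtain ⟨b, hb⟩ := (IsLocalizedModule.eq_zero_iff y.ideal.primeCompl (toFib G y)).1 h
  obtain ⟨r, hr, g, hg⟩ := exists_agerm_mul_eq hU hx hy b.1
  have hb' : b.1 • ggerm G hy m = 0 := hb
  have h₁ : ggerm G hy (polyEv A x le_rfl g • m) = 0 := by
    rw [ggerm_smul, ← hg, mul_smul, hb', smul_zero]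
  have hgy : agerm A hy (polyEv A x le_rfl g) ∉ y.ideal := by
    rw [← hg]
    exact y.isPrime.mul_notMem ((agerm_aunit_notMem_iff y hy r).2 hr) b.2
  obtain ⟨W, hyW, i, j, hW⟩ := TopCat.Presheaf.germ_eq (X := X.toTopCat) G.mod.presheaf y.pt hy hy
    _ _ (h₁.trans (ggerm G hy).map_zero.symm)
  have hW' : mres G.mod i.le (polyEv A x le_rfl g • m) = mres G.mod j.le 0 := hW
  obtain ⟨t, ht, hyt⟩ := hU.exists_basicOpen_le ⟨y.pt, hyW⟩ hy
  have h₂ : mres G.mod (X.basicOpen_le t) (polyEv A x le_rfl g • m) = 0 := by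
    rw [← mres_mres G.mod i.le ht, hW', map_zero, map_zero]
  obtain ⟨N, hN⟩ := exists_pow_smul_eq_zero hG t h₂
  refine ⟨MvPolynomial.C t ^ N * g, ?_, ?_⟩
  · rw [map_mul, map_mul, map_pow, map_pow, polyEv_C]
    exact y.isPrime.mul_notMem (fun h => (agerm_aunit_notMem_iff y hy t).2 hyt
      (y.isPrime.mem_of_pow_mem _ h)) hgy
  · rw [map_mul, map_pow, polyEv_C, mul_smul, hN]

/-- A homogeneous section of `G` over an affine open subset whose image in `G~` vanishes on the
locus `f ≠ 0` of `Proj` is killed by a power of `f`. -/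
theorem exists_pow_smul_eq_zero_of_toFib {G : GrMod A} (hU : IsAffineOpen U)
    (hx : IsPolyChart A x) (hG : IsLocalizingOn (toPMod G.toModules) U) {d : ℤ}
    {m : MSec G.mod U} (hm : m ∈ G.deg d U) {f : MvPolynomial (Fin n) (RSec X.presheaf U)} {e : ℕ}
    (hf : f.IsHomogeneous e) (he : 0 < e)
    (h : ∀ (y : ProjPoint A) (hy : y.pt ∈ U), agerm A hy (polyEv A x le_rfl f) ∉ y.ideal →
      toFib G y (ggerm G hy m) = 0) :
    ∃ N : ℕ, polyEv A x le_rfl f ^ N • m = 0 := by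
  let I : Ideal (MvPolynomial (Fin n) (RSec X.presheaf U)) :=
    (Submodule.annihilator (Submodule.span (RSec A.ring U) {m})).comap (polyEv A x le_rfl)
  have hI : ∀ g, g ∈ I ↔ polyEv A x le_rfl g • m = 0 := fun g =>
    Submodule.mem_annihilator_span_singleton m _
  -- The annihilator of `m` is homogeneous because `m` is.
  have hI' : ∀ g ∈ I, ∀ i, MvPolynomial.homogeneousComponent i g ∈ I := by
    intro g hg i
    rw [hI] at hg ⊢
    by_cases hi : i < g.totalDegree + 1
    · refine smul_eq_zero_of_sum hm (Finset.range (g.totalDegree + 1))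
        (fun i => polyEv A x le_rfl (MvPolynomial.homogeneousComponent i g))
        (fun i => polyEv_mem_deg hx le_rfl (MvPolynomial.homogeneousComponent_isHomogeneous i g)) ?_
        (Finset.mem_range.2 hi)
      rw [← map_sum, MvPolynomial.sum_homogeneousComponent]
      exact hg
    · rw [MvPolynomial.homogeneousComponent_eq_zero i g (by omega), map_zero, zero_smul]
  obtain ⟨N, hN⟩ := mem_radical_of_forall_projPoint hU hx hI' hf he fun y hy hfy => by
    obtain ⟨g, hg, hg'⟩ := exists_smul_eq_zero_of_toFib hU hx hG y hy (h y hy hfy)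
    exact ⟨g, (hI g).2 hg', hg⟩
  refine ⟨N, ?_⟩
  rw [← map_pow]
  exact (hI _).1 hN

end Vanish

/-! ### Sections of `G~(p)` as local fractions -/

section LocalFraction

variable {X : Scheme.{u}} {n : ℕ} {A : GrAlg X} {U : X.Opens} {x : Fin n → RSec A.ring U}

/-- The sets `D(V, g)` form a basis of the topology of `Proj`. -/
theorem exists_basicSet_subset (W : Opens (proj A)) {y : ProjPoint A} (hy : y ∈ W) :
    ∃ (V : X.Opens) (d : ℕ) (g : RSec A.ring V), g ∈ A.deg d V ∧ y ∈ basicSet g ∧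
      ∀ z ∈ basicSet g, z ∈ W := by
  obtain ⟨W, hW⟩ := W
  change TopologicalSpace.GenerateOpen _ W at hW
  change y ∈ W at hy
  change ∃ (V : X.Opens) (d : ℕ) (g : RSec A.ring V), g ∈ A.deg d V ∧ y ∈ basicSet g ∧
      ∀ z ∈ basicSet g, z ∈ W
  induction hW with
  | basic W h =>
    obtain ⟨V, d, g, hg, rfl⟩ := h
    exact ⟨V, d, g, hg, hy, fun z hz => hz⟩
  | univ =>
    refine ⟨⊤, 0, 1, one_mem_deg A ⊤, ⟨trivial, fun h => ?_⟩, fun z _ => trivial⟩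
    rw [map_one] at h
    exact y.isPrime.one_notMem h
  | inter W W' _ _ ih ih' =>
    obtain ⟨V, d, g, hg, ⟨hyV, hgy⟩, h⟩ := ih hy.1
    obtain ⟨V', d', g', hg', ⟨hyV', hgy'⟩, h'⟩ := ih' hy.2
    have e₁ : V ⊓ V' ≤ V := inf_le_left
    have e₂ : V ⊓ V' ≤ V' := inf_le_right
    have hyVV : y.pt ∈ V ⊓ V' := ⟨hyV, hyV'⟩
    refine ⟨V ⊓ V', d + d', rres A.ring e₁ g * rres A.ring e₂ g',
      A.mul_mem (A.res_mem e₁ hg) (A.res_mem e₂ hg'), ⟨hyVV, ?_⟩, ?_⟩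
    · rw [map_mul, agerm_rres, agerm_rres]
      exact y.isPrime.mul_notMem hgy hgy'
    · rintro z ⟨hz, hgz⟩
      rw [map_mul, agerm_rres, agerm_rres] at hgz
      exact ⟨h z ⟨e₁ hz, fun hh => hgz (Ideal.mul_mem_right _ _ hh)⟩,
        h' z ⟨e₂ hz, fun hh => hgz (Ideal.mul_mem_left _ _ hh)⟩⟩
  | sUnion S _ ih =>
    obtain ⟨W, hWS, hyW⟩ := hy
    obtain ⟨V, d, g, hg, hyg, h⟩ := ih W hWS hyW
    exact ⟨V, d, g, hg, hyg, fun z hz => ⟨W, hWS, h z hz⟩⟩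

theorem map_homogeneousComponent {σ R S : Type*} [CommRing R] [CommRing S] (φ : R →+* S)
    (f : MvPolynomial σ R) (i : ℕ) :
    MvPolynomial.map φ (MvPolynomial.homogeneousComponent i f) =
      MvPolynomial.homogeneousComponent i (MvPolynomial.map φ f) := by
  ext α
  rw [MvPolynomial.coeff_map, MvPolynomial.coeff_homogeneousComponent,
    MvPolynomial.coeff_homogeneousComponent, MvPolynomial.coeff_map]
  split_ifs
  · rfl
  · exact map_zero φ

/-- The section `s` of `G~(p)` over the inverse image of `U` is the fraction `m / g` on the locus
`g ≠ 0`, where `g` is a homogeneous polynomial in the sections `x_j`. -/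
structure IsFrac {G : GrMod A} (x : Fin n → RSec A.ring U) {p : ℤ}
    (s : tildeSec G p (preim A U)) (d : ℕ) (g : MvPolynomial (Fin n) (RSec X.presheaf U))
    (m : MSec G.mod U) : Prop where
  isHomogeneous : g.IsHomogeneous d
  mem_deg : m ∈ G.deg (d + p) U
  smul_eq : ∀ z : preim A U, agerm A (pt_mem z) (polyEv A x le_rfl g) ∉ z.1.ideal →
    agerm A (pt_mem z) (polyEv A x le_rfl g) • s.1 z = toFib G z.1 (ggerm G (pt_mem z) m)

/-- Near each point of `Proj` over `U`, a section of `G~(p)` is a fraction with numerator and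
denominator defined over `U`. -/
theorem exists_isFrac {G : GrMod A} (hU : IsAffineOpen U) (hx : IsPolyChart A x)
    (hG : IsLocalizingOn (toPMod G.toModules) U) {p : ℤ} (s : tildeSec G p (preim A U))
    (y : preim A U) : ∃ d g m, IsFrac x s d g m ∧
      agerm A (pt_mem y) (polyEv A x le_rfl g) ∉ y.1.ideal := by
  obtain ⟨V, d, m₀, hm₀, g₀, hg₀, W', hyW', hfrac⟩ := s.2 y
  obtain ⟨V', e, h₀, hh₀, ⟨hyV', hyh⟩, hsub⟩ := exists_basicSet_subset W' hyW'
  obtain ⟨hyV, hyg, -⟩ := hfrac y hyW'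
  have e₁ : U ⊓ V ⊓ V' ≤ U := inf_le_left.trans inf_le_left
  have e₂ : U ⊓ V ⊓ V' ≤ V := inf_le_left.trans inf_le_right
  have e₃ : U ⊓ V ⊓ V' ≤ V' := inf_le_right
  have hyV₃ : y.1.pt ∈ U ⊓ V ⊓ V' := ⟨⟨pt_mem y, hyV⟩, hyV'⟩
  have ha : rres A.ring e₂ g₀ * rres A.ring e₃ h₀ ∈ A.deg (d + e) (U ⊓ V ⊓ V') :=
    A.mul_mem (A.res_mem e₂ hg₀) (A.res_mem e₃ hh₀)
  have hm₁ : rres A.ring e₃ h₀ • mres G.mod e₂ m₀ ∈ G.deg ((d + e : ℕ) + p) (U ⊓ V ⊓ V') := by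
    have := G.smul_mem (A.res_mem e₃ hh₀) (G.res_mem e₂ hm₀)
    rwa [show (e : ℤ) + (d + p) = (d + e : ℕ) + p by push_cast; ring] at this
  obtain ⟨W, hW, hyW, f, hf, hfa⟩ := hx.exists_homogeneous _ e₁ _ _ ha _ hyV₃
  obtain ⟨r, hr, hyr⟩ := hU.exists_basicOpen_le ⟨y.1.pt, hyW⟩ (pt_mem y)
  obtain ⟨N, g, hg⟩ := exists_map_eq_C_mul hU r (MvPolynomial.map (rres X.presheaf hr) f)
  have hg' := congrArg (MvPolynomial.homogeneousComponent (d + e)) hg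
  rw [← map_homogeneousComponent, MvPolynomial.homogeneousComponent_C_mul,
    ← map_homogeneousComponent, MvPolynomial.homogeneousComponent_of_mem hf, if_pos rfl] at hg'
  set g₁ := MvPolynomial.homogeneousComponent (d + e) g with hg₁
  obtain ⟨M, m₂, hm₂, hm₂'⟩ := exists_extension hG _ r (G.res_mem (hr.trans hW) hm₁)
  have key : ∀ (z : X) (hz : z ∈ U) (hzr : z ∈ X.basicOpen r),
      agerm A hz (polyEv A x le_rfl g₁) = agerm A hz (aunit A U r) ^ N *
        (agerm A (e₂ (hW (hr hzr))) g₀ * agerm A (e₃ (hW (hr hzr))) h₀) := by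
    intro z hz hzr
    have h₁ := congrArg (fun q => agerm A hzr (polyEv A x (X.basicOpen_le r) q)) hg'
    rw [← rres_polyEv A x le_rfl (X.basicOpen_le r), agerm_rres, map_mul, map_mul, polyEv_C,
      ← rres_polyEv A x (hW.trans e₁) hr, hfa, ← map_pow, ← rres_aunit, agerm_rres, agerm_rres,
      agerm_rres, map_mul, agerm_rres, agerm_rres, map_pow, map_pow] at h₁
    exact h₁
  have key' : ∀ (z : X) (hz : z ∈ U) (hzr : z ∈ X.basicOpen r),
      ggerm G hz m₂ = agerm A hz (aunit A U r) ^ M •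
        agerm A (e₃ (hW (hr hzr))) h₀ • ggerm G (e₂ (hW (hr hzr))) m₀ := by
    intro z hz hzr
    have h₁ := congrArg (ggerm G hzr) hm₂'
    rw [ggerm_mres, ggerm_smul, map_pow, agerm_rres, ggerm_mres, ggerm_smul, agerm_rres,
      ggerm_mres] at h₁
    exact h₁
  have hCg : ∀ (z : X) (hz : z ∈ U), agerm A hz (polyEv A x le_rfl (MvPolynomial.C (r ^ (M + 1)) *
      g₁)) = agerm A hz (aunit A U r) ^ (M + 1) * agerm A hz (polyEv A x le_rfl g₁) := by
    intro z hz
    rw [map_mul, map_mul, polyEv_C, map_pow, map_pow]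
  -- On `D(r)` we have `g₁ = r ^ N g₀ h₀` and `m₂ = r ^ M h₀ m₀`. The additional factor `r` of the
  -- denominator makes its nonvanishing locus lie over `D(r)`.
  refine ⟨d + e, MvPolynomial.C (r ^ (M + 1)) * g₁, aunit A U (r ^ (N + 1)) • m₂,
    ⟨(MvPolynomial.homogeneousComponent_isHomogeneous _ g).C_mul _, aunit_smul_mem _ hm₂,
      fun z hz => ?_⟩, ?_⟩
  · rw [hCg] at hz
    have hzr : z.1.pt ∈ X.basicOpen r := by
      rw [← agerm_aunit_notMem_iff z.1 (pt_mem z)]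
      exact fun h => hz (Ideal.mul_mem_right _ _ (Ideal.pow_mem_of_mem _ h _ M.succ_pos))
    have hzh : z.1 ∈ basicSet h₀ := ⟨e₃ (hW (hr hzr)), fun h => hz (by
      rw [key _ _ hzr]
      exact Ideal.mul_mem_left _ _ (Ideal.mul_mem_left _ _ (Ideal.mul_mem_left _ _ h)))⟩
    obtain ⟨hzV, -, hs⟩ := hfrac z (hsub z.1 hzh)
    rw [hCg, key _ _ hzr, ggerm_smul, key' _ _ hzr, map_pow, map_pow, map_smul, map_smul, map_smul,
      ← hs]
    simp only [smul_smul]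
    congr 1
    ring
  · have hr' := (agerm_aunit_notMem_iff y.1 (pt_mem y) r).2 hyr
    rw [hCg, key _ _ hyr]
    exact y.1.isPrime.mul_notMem (fun h => hr' (y.1.isPrime.mem_of_pow_mem _ h))
      (y.1.isPrime.mul_notMem (fun h => hr' (y.1.isPrime.mem_of_pow_mem _ h))
        (y.1.isPrime.mul_notMem hyg hyh))

end LocalFraction

/-! ### Fractions with a prescribed denominator -/

section GlobalFraction

variable {X : Scheme.{u}} {n : ℕ} {A : GrAlg X} {U : X.Opens} {x : Fin n → RSec A.ring U}
  {G : GrMod A} {p : ℤ} {s : tildeSec G p (preim A U)}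

/-- Two fractions `m / g` and `m' / g'` representing the same section satisfy `g' m = g m'` up to a
power of `f g g'`. -/
theorem exists_pow_smul_eq_smul (hU : IsAffineOpen U) (hx : IsPolyChart A x)
    (hG : IsLocalizingOn (toPMod G.toModules) U) {f g g' : MvPolynomial (Fin n) (RSec X.presheaf U)}
    {e d d' : ℕ} (hf : f.IsHomogeneous e) (he : 0 < e) {m m' : MSec G.mod U}
    (h : IsFrac x s d g m) (h' : IsFrac x s d' g' m') :
    ∃ L : ℕ, (polyEv A x le_rfl f * polyEv A x le_rfl g * polyEv A x le_rfl g') ^ L •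
      polyEv A x le_rfl g' • m = (polyEv A x le_rfl f * polyEv A x le_rfl g *
        polyEv A x le_rfl g') ^ L • polyEv A x le_rfl g • m' := by
  have h₁ : polyEv A x le_rfl g' • m - polyEv A x le_rfl g • m' ∈ G.deg (d + d' + p) U := by
    refine sub_mem ?_ ?_
    · have := G.smul_mem (polyEv_mem_deg hx le_rfl h'.isHomogeneous) h.mem_deg
      rwa [show (d' : ℤ) + (d + p) = d + d' + p by ring] at this
    · have := G.smul_mem (polyEv_mem_deg hx le_rfl h.isHomogeneous) h'.mem_deg
      rwa [show (d : ℤ) + (d' + p) = d + d' + p by ring] at this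
  obtain ⟨L, hL⟩ := exists_pow_smul_eq_zero_of_toFib hU hx hG h₁
    ((hf.mul h.isHomogeneous).mul h'.isHomogeneous) (by omega) fun y hy hfg => by
      rw [map_mul, map_mul, map_mul, map_mul] at hfg
      have hg : agerm A hy (polyEv A x le_rfl g) ∉ y.ideal := fun hh =>
        hfg (Ideal.mul_mem_right _ _ (Ideal.mul_mem_left _ _ hh))
      have hg' : agerm A hy (polyEv A x le_rfl g') ∉ y.ideal := fun hh =>
        hfg (Ideal.mul_mem_left _ _ hh)
      rw [map_sub, ggerm_smul, ggerm_smul, map_sub, map_smul, map_smul]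
      have e₁ := h.smul_eq ⟨y, hy⟩ hg
      have e₂ := h'.smul_eq ⟨y, hy⟩ hg'
      refine sub_eq_zero.2 ?_
      refine (congrArg _ e₁.symm).trans (Eq.trans ?_ (congrArg _ e₂))
      exact smul_comm _ _ _
  refine ⟨L, sub_eq_zero.1 ?_⟩
  rw [← smul_sub, ← hL, map_mul, map_mul]

theorem IsFrac.mul_left (hx : IsPolyChart A x) {c g : MvPolynomial (Fin n) (RSec X.presheaf U)}
    {e d : ℕ} (hc : c.IsHomogeneous e) {m : MSec G.mod U} (h : IsFrac x s d g m) :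
    IsFrac x s (e + d) (c * g) (polyEv A x le_rfl c • m) where
  isHomogeneous := hc.mul h.isHomogeneous
  mem_deg := by
    have := G.smul_mem (polyEv_mem_deg hx le_rfl hc) h.mem_deg
    rwa [← add_assoc, ← Nat.cast_add] at this
  smul_eq z hz := by
    rw [map_mul, map_mul] at hz ⊢
    have hg : agerm A (pt_mem z) (polyEv A x le_rfl g) ∉ z.1.ideal := fun hh =>
      hz (Ideal.mul_mem_left _ _ hh)
    rw [ggerm_smul, map_smul, ← h.smul_eq z hg, smul_smul]

/-- A section of `G~(p)` over the inverse image of a sufficiently small affine open subset is,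
on the locus `f ≠ 0`, a fraction with a power of `f` as denominator. -/
theorem exists_isFrac_pow (hU : IsAffineOpen U) (hx : IsPolyChart A x)
    (hG : IsLocalizingOn (toPMod G.toModules) U) (s : tildeSec G p (preim A U))
    {f : MvPolynomial (Fin n) (RSec X.presheaf U)} {e : ℕ} (hf : f.IsHomogeneous e) (he : 0 < e) :
    ∃ N m, IsFrac x s (e * N) (f ^ N) m := by
  classical
  obtain ⟨M, hM⟩ := mem_radical_of_forall_projPoint hU hx
    (homogeneousComponent_mem_span (S := {g | ∃ d m, IsFrac x s d g m})
      fun g ⟨d, m, h⟩ => ⟨d, h.isHomogeneous⟩) hf he fun y hy _ => by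
      obtain ⟨d, g, m, h, hg⟩ := exists_isFrac hU hx hG s ⟨y, hy⟩
      exact ⟨g, Ideal.subset_span ⟨d, m, h⟩, hg⟩
  obtain ⟨T, hT, hfT⟩ := Submodule.mem_span_finite_of_mem_span hM
  choose d m hm using fun g : T => hT g.2
  choose L hL using fun g g' : T => exists_pow_smul_eq_smul hU hx hG hf he (hm g) (hm g')
  obtain ⟨K, hK⟩ : ∃ K, ∀ g g' : T, L g g' ≤ K :=
    ⟨Finset.univ.sup fun q : T × T => L q.1 q.2, fun g g' =>
      Finset.le_sup (f := fun q : T × T => L q.1 q.2) (Finset.mem_univ (g, g'))⟩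
  -- With the denominators `f ^ K * g ^ (K + 1)` for `g ∈ T`, the fractions agree over `U`, without
  -- extra factors.
  let D : T → ℕ := fun g => e * K + d g * K + d g
  let h : T → MvPolynomial (Fin n) (RSec X.presheaf U) := fun g => f ^ K * g.1 ^ K * g.1
  let m' : T → MSec G.mod U := fun g => polyEv A x le_rfl (f ^ K * g.1 ^ K) • m g
  have hh : ∀ g, IsFrac x s (D g) (h g) (m' g) := fun g =>
    (hm g).mul_left hx ((hf.pow K).mul ((hm g).isHomogeneous.pow K))
  have hcomm : ∀ g g', polyEv A x le_rfl (h g') • m' g = polyEv A x le_rfl (h g) • m' g' := by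
    intro g g'
    obtain ⟨c, hc⟩ := Nat.exists_eq_add_of_le (hK g g')
    have := congrArg (fun t => ((polyEv A x le_rfl f) ^ K * (polyEv A x le_rfl f *
      polyEv A x le_rfl g * polyEv A x le_rfl g') ^ c) • t) (hL g g')
    simp only [smul_smul] at this
    simp only [h, m', smul_smul, map_mul, map_pow]
    refine Eq.trans ?_ (this.trans ?_)
    · congr 1
      rw [hc]
      ring
    · congr 1
      rw [hc]
      ring
  obtain ⟨N, hN⟩ := mem_radical_of_forall_projPoint hU hx
    (homogeneousComponent_mem_span (S := Set.range h)
      fun _ ⟨g, hg⟩ => ⟨D g, hg ▸ (hh g).isHomogeneous⟩) hf he fun y hy hfy => by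
      by_contra! hcon
      refine hfy (y.isPrime.mem_of_pow_mem M ?_)
      rw [← map_pow, ← map_pow]
      have h₁ : Ideal.span (T : Set _) ≤ y.ideal.comap ((agerm A hy).comp (polyEv A x le_rfl)) := by
        rw [Ideal.span_le]
        intro g hg
        have h₂ := hcon (h ⟨g, hg⟩) (Ideal.subset_span ⟨⟨g, hg⟩, rfl⟩)
        simp only [h, map_mul, map_pow] at h₂
        refine (y.isPrime.mem_or_mem h₂).elim (fun h₃ => ?_) id
        exact (y.isPrime.mem_or_mem h₃).elim
          (fun h₄ => absurd (y.isPrime.mem_of_pow_mem _ h₄) hfy) (y.isPrime.mem_of_pow_mem _)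
      exact h₁ hfT
  -- Write `f ^ N` as a combination of the new denominators, with homogeneous coefficients; the same
  -- combination of the numerators is a numerator for `f ^ N`.
  obtain ⟨c, hc⟩ := (Ideal.mem_span_range_iff_exists_fun).1 hN
  choose c' hc' hcdeg using fun g => homogeneousComponent_mul (f := c g) (hh g).isHomogeneous (e * N)
  have hfN : ∑ g, c' g * h g = f ^ N := by
    have h₁ : MvPolynomial.homogeneousComponent (e * N) (f ^ N) = f ^ N :=
      (MvPolynomial.homogeneousComponent_of_mem (hf.pow N)).trans (if_pos rfl)
    rw [← h₁, ← hc, map_sum]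
    exact Finset.sum_congr rfl fun g _ => (hc' g).symm
  refine ⟨N, ∑ g, polyEv A x le_rfl (c' g) • m' g, hf.pow N, sum_mem fun g _ => ?_, fun z hz => ?_⟩
  · rcases hcdeg g with h₁ | ⟨h₁, h₂⟩
    · rw [h₁, map_zero, zero_smul]
      exact zero_mem _
    · have := G.smul_mem (polyEv_mem_deg hx le_rfl h₂) (hh g).mem_deg
      rwa [← add_assoc, ← Nat.cast_add, Nat.sub_add_cancel h₁] at this
  · obtain ⟨g, hg⟩ : ∃ g, agerm A (pt_mem z) (polyEv A x le_rfl (h g)) ∉ z.1.ideal := by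
      by_contra! hcon
      refine hz ?_
      rw [← hfN, map_sum, map_sum]
      refine sum_mem fun g _ => ?_
      rw [map_mul, map_mul]
      exact Ideal.mul_mem_left _ _ (hcon g)
    refine fib_cancel G hg ?_
    have h₁ : polyEv A x le_rfl (h g) • ∑ g', polyEv A x le_rfl (c' g') • m' g' =
        polyEv A x le_rfl (f ^ N) • m' g := by
      rw [Finset.smul_sum, ← hfN, map_sum, Finset.sum_smul]
      refine Finset.sum_congr rfl fun g' _ => ?_
      rw [smul_comm, ← hcomm, smul_smul, map_mul (polyEv A x le_rfl) (c' g')]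
    rw [smul_comm, (hh g).smul_eq z hg]
    have h₂ := congrArg (fun t => toFib G z.1 (ggerm G (pt_mem z) t)) h₁
    simp only [ggerm_smul, map_smul] at h₂
    exact h₂.symm

end GlobalFraction

/-! ### Numerators over the variables -/

section CompatibleNumerators

variable {X : Scheme.{u}} {n : ℕ} {A : GrAlg X} {U : X.Opens} {x : Fin n → RSec A.ring U}
  {G : GrMod A} {p : ℤ}

/-- A section of `G~(p)` over the inverse image of a sufficiently small affine open subset is given
by fractions `m_j / x_j^N`, where `x_i^N m_j = x_j^N m_i`. -/
theorem exists_compatible_numerators (hU : IsAffineOpen U) (hx : IsPolyChart A x)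
    (hG : IsLocalizingOn (toPMod G.toModules) U) (s : tildeSec G p (preim A U)) :
    ∃ (N : ℕ) (m : Fin n → MSec G.mod U),
      (∀ j, IsFrac x s N (MvPolynomial.X j ^ N) (m j)) ∧
      ∀ i j, polyEv A x le_rfl (MvPolynomial.X i ^ N) • m j =
        polyEv A x le_rfl (MvPolynomial.X j ^ N) • m i := by
  choose N m hm using fun j : Fin n =>
    exists_isFrac_pow hU hx hG s (MvPolynomial.isHomogeneous_X _ j) one_pos
  obtain ⟨K, hK⟩ : ∃ K, ∀ j, N j ≤ K :=
    ⟨Finset.univ.sup N, fun j => Finset.le_sup (Finset.mem_univ j)⟩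
  let m' : Fin n → MSec G.mod U := fun j => polyEv A x le_rfl (MvPolynomial.X j ^ (K - N j)) • m j
  have hm' : ∀ j, IsFrac x s K (MvPolynomial.X j ^ K) (m' j) := fun j => by
    have := (hm j).mul_left hx (MvPolynomial.isHomogeneous_X_pow j (K - N j))
    rwa [one_mul, ← pow_add, Nat.sub_add_cancel (hK j)] at this
  -- For numerators `m' j` over `x_j ^ K`, the sections `x_i ^ K m'_j` and `x_j ^ K m'_i` become equal
  -- after multiplication by `(x_i x_i ^ K x_j ^ K) ^ l`, so the powers `x_j ^ (l * (K + 1))` suffice.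
  choose L hL using fun i j => exists_pow_smul_eq_smul hU hx hG
    (MvPolynomial.isHomogeneous_X (RSec X.presheaf U) i) one_pos (hm' i) (hm' j)
  obtain ⟨l, hl⟩ : ∃ l, ∀ i j, L i j ≤ l :=
    ⟨Finset.univ.sup fun q : Fin n × Fin n => L q.1 q.2, fun i j =>
      Finset.le_sup (f := fun q : Fin n × Fin n => L q.1 q.2) (Finset.mem_univ (i, j))⟩
  refine ⟨l * (K + 1) + K, fun j => polyEv A x le_rfl (MvPolynomial.X j ^ (l * (K + 1))) • m' j,
    fun j => ?_, fun i j => ?_⟩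
  · have := (hm' j).mul_left hx (MvPolynomial.isHomogeneous_X_pow j (l * (K + 1)))
    rwa [← pow_add] at this
  · obtain ⟨c, hc⟩ := Nat.exists_eq_add_of_le (hl i j)
    have := congrArg (fun t => (polyEv A x le_rfl (MvPolynomial.X i) ^ (c * (K + 1)) *
      polyEv A x le_rfl (MvPolynomial.X j) ^ (c * (K + 1) + L i j)) • t) (hL i j)
    simp only [smul_smul, map_pow] at this ⊢
    refine Eq.trans ?_ (this.symm.trans ?_)
    · congr 1
      rw [hc]
      ring
    · congr 1
      rw [hc]
      ring

end CompatibleNumerators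

section Algebra

variable {σ R : Type*} [Fintype σ] [CommRing R]

/-- A monomial of degree larger than `|σ| N` is divisible by the `N`-th power of some variable. -/
theorem exists_le_of_degree {N : ℕ} {β : σ →₀ ℕ} (h : Fintype.card σ * N < β.degree) :
    ∃ j, N ≤ β j := by
  by_contra! hcon
  refine absurd h (not_lt.2 ?_)
  rw [Finsupp.degree_eq_sum]
  exact (Finset.sum_le_card_nsmul _ _ N fun j _ => (hcon j).le).trans (by simp)

/-- To check an additive property on a sufficiently high power of the ideal `(X_j)`, it suffices
to consider monomials divisible by some `X_j^N`. -/
theorem induction_on_mem_pow_idealOfVars {N k : ℕ} (hk : Fintype.card σ * N < k)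
    {motive : MvPolynomial σ R → Prop} (zero : motive 0)
    (add : ∀ f g, motive f → motive g → motive (f + g))
    {f : MvPolynomial σ R} (hf : f ∈ MvPolynomial.idealOfVars σ R ^ k)
    (monomial : ∀ β ∈ f.support, ∀ j, N ≤ β j → motive (MvPolynomial.monomial β (f.coeff β))) :
    motive f := by
  rw [f.as_sum]
  rw [MvPolynomial.mem_pow_idealOfVars_iff] at hf
  refine Finset.sum_induction _ motive add zero fun β hβ => ?_
  obtain ⟨j, hj⟩ := exists_le_of_degree (hk.trans_le (hf β hβ))
  exact monomial β hβ j hj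

variable {B M : Type*} [CommRing B] [AddCommGroup M] [Module B M]

/-- Elements `m_j` with `X_i^N m_j = X_j^N m_i` define a map `X_j^N ↦ m_j` on the ideal generated
by the `X_j^N`; here it is extended by zero to the other monomials. -/
theorem exists_extend_monomials (ev : MvPolynomial σ R →+* B) {N : ℕ} {m : σ → M}
    (hm : ∀ i j, ev (MvPolynomial.X i ^ N) • m j = ev (MvPolynomial.X j ^ N) • m i) :
    ∃ Φ : MvPolynomial σ R →+ M, ∀ (β : σ →₀ ℕ) (j : σ) (r : R), N ≤ β j →
      Φ (MvPolynomial.monomial β r) =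
        ev (MvPolynomial.monomial (β - Finsupp.single j N) r) • m j := by
  classical
  let T : (σ →₀ ℕ) → M := fun β => if h : ∃ j, N ≤ β j then
    ev (MvPolynomial.monomial (β - Finsupp.single h.choose N) 1) • m h.choose else 0
  have hT : ∀ (β : σ →₀ ℕ) (j : σ), N ≤ β j →
      T β = ev (MvPolynomial.monomial (β - Finsupp.single j N) 1) • m j := by
    intro β j hj
    have h : ∃ j, N ≤ β j := ⟨j, hj⟩
    simp only [T, dif_pos h]
    set i := h.choose with hi
    have hi' : N ≤ β i := h.choose_spec
    by_cases hij : i = j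
    · rw [hij]
    · have e₁ : β - Finsupp.single i N =
          (β - Finsupp.single i N - Finsupp.single j N) + Finsupp.single j N := by
        refine (tsub_add_cancel_of_le ?_).symm
        rw [Finsupp.single_le_iff, Finsupp.tsub_apply, Finsupp.single_eq_of_ne (Ne.symm hij)]
        exact hj
      have e₂ : β - Finsupp.single j N =
          (β - Finsupp.single i N - Finsupp.single j N) + Finsupp.single i N := by
        rw [tsub_right_comm]
        refine (tsub_add_cancel_of_le ?_).symm
        rw [Finsupp.single_le_iff, Finsupp.tsub_apply, Finsupp.single_eq_of_ne hij]
        exact hi'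
      rw [e₁, e₂, MvPolynomial.monomial_add_single, MvPolynomial.monomial_add_single, map_mul,
        map_mul, mul_smul, mul_smul, hm j i]
  let _ : Module R M := Module.compHom M (ev.comp MvPolynomial.C)
  let Φ : MvPolynomial σ R →ₗ[R] M := (MvPolynomial.basisMonomials σ R).constr ℕ T
  refine ⟨Φ.toAddMonoidHom, fun β j r hj => ?_⟩
  have h₁ : MvPolynomial.monomial β r = r • MvPolynomial.basisMonomials σ R β := by
    rw [MvPolynomial.coe_basisMonomials, MvPolynomial.smul_monomial, smul_eq_mul, mul_one]
  have h₂ : Φ (MvPolynomial.monomial β r) = ev (MvPolynomial.C r) • T β := by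
    rw [h₁, map_smul, Module.Basis.constr_basis]
    rfl
  refine h₂.trans ?_
  rw [hT β j hj, smul_smul, ← map_mul, MvPolynomial.C_mul_monomial, mul_one]

/-- The map of `exists_extend_monomials` is linear on sufficiently high powers of `(X_j)`. -/
theorem map_mul_of_mem_pow {ev : MvPolynomial σ R →+* B} {N k : ℕ}
    (hk : Fintype.card σ * N < k) {m : σ → M} {Φ : MvPolynomial σ R →+ M}
    (hΦ : ∀ (β : σ →₀ ℕ) (j : σ) (r : R), N ≤ β j → Φ (MvPolynomial.monomial β r) =
        ev (MvPolynomial.monomial (β - Finsupp.single j N) r) • m j)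
    (g : MvPolynomial σ R) {f : MvPolynomial σ R} (hf : f ∈ MvPolynomial.idealOfVars σ R ^ k) :
    Φ (g * f) = ev g • Φ f := by
  refine induction_on_mem_pow_idealOfVars (motive := fun f => Φ (g * f) = ev g • Φ f) hk
    (by simp) (fun f f' h h' => by rw [mul_add, map_add, h, h', map_add, smul_add]) hf
    fun β _ j hj => ?_
  induction g using MvPolynomial.induction_on' with
  | monomial α r =>
    rw [MvPolynomial.monomial_mul, hΦ _ j _ hj,
      hΦ _ j _ (hj.trans (by rw [Finsupp.add_apply]; exact Nat.le_add_left _ _)), smul_smul,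
      ← map_mul, MvPolynomial.monomial_mul, add_tsub_assoc_of_le (Finsupp.single_le_iff.2 hj)]
  | add g g' h h' => rw [add_mul, map_add, h, h', map_add, add_smul]

end Algebra

/-! ### Morphisms on powers of the irrelevant ideal -/

section Extend

variable {X : Scheme.{u}} {n : ℕ} {A : GrAlg X} {U : X.Opens} {x : Fin n → RSec A.ring U}
  {G : GrMod A} {p : ℤ}

theorem smul_mres_numerators {N : ℕ} {m : Fin n → MSec G.mod U}
    (hm : ∀ i j, polyEv A x le_rfl (MvPolynomial.X i ^ N) • m j =
      polyEv A x le_rfl (MvPolynomial.X j ^ N) • m i) {V : X.Opens} (h : V ≤ U) (i j : Fin n) :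
    polyEv A x h (MvPolynomial.X i ^ N) • mres G.mod h (m j) =
      polyEv A x h (MvPolynomial.X j ^ N) • mres G.mod h (m i) := by
  have h₁ := congrArg (mres G.mod h) (hm i j)
  rwa [mres_smul, mres_smul, rres_polyEv, rres_polyEv, map_pow (MvPolynomial.map _),
    map_pow (MvPolynomial.map _), MvPolynomial.map_X, MvPolynomial.map_X] at h₁

theorem isHomogeneous_of_polyEv_mem (hx : IsPolyChart A x) {V : X.Opens} (h : V ≤ U) {i : ℕ}
    {f : MvPolynomial (Fin n) (RSec X.presheaf V)} (hf : polyEv A x h f ∈ A.deg i V) {z : X}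
    (hz : z ∈ V) : ∃ (W : X.Opens) (hW : W ≤ V), z ∈ W ∧
      (MvPolynomial.map (rres X.presheaf hW) f).IsHomogeneous i := by
  obtain ⟨W, hW, hzW, g, hg, h'⟩ := hx.exists_homogeneous V h i _ hf z hz
  rw [rres_polyEv] at h'
  exact ⟨W, hW, hzW, hx.injective W _ h' ▸ hg⟩

/-- The relation between the section `a` of `I^k` and the section `t` of `G`: they are the values
at the same polynomial of the evaluation at the `x_j` and of the additive map `Φ`. -/
def EvRel (x : Fin n → RSec A.ring U) (k : ℕ)
    (Φ : ∀ V : X.Opens, V ≤ U → MvPolynomial (Fin n) (RSec X.presheaf V) →+ MSec G.mod V)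
    (V : X.Opens) (h : V ≤ U) (a : idealPow A k V) (t : MSec G.mod V) : Prop :=
  ∃ f ∈ MvPolynomial.idealOfVars (Fin n) (RSec X.presheaf V) ^ k,
    polyEv A x h f = a.1 ∧ t = Φ V h f

/-- Additive maps on polynomials over the open subsets of a chart, which are linear on `(X_j)^k`
and compatible with restriction there, define a morphism `I^k → G`. -/
theorem exists_homSec_of_polynomials (hx : IsPolyChart A x) {k : ℕ}
    {Φ : ∀ V : X.Opens, V ≤ U → MvPolynomial (Fin n) (RSec X.presheaf V) →+ MSec G.mod V}
    (hres : ∀ (V W : X.Opens) (h : V ≤ U) (hW : W ≤ V),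
      ∀ f ∈ MvPolynomial.idealOfVars (Fin n) (RSec X.presheaf V) ^ k,
        mres G.mod hW (Φ V h f) = Φ W (hW.trans h) (MvPolynomial.map (rres X.presheaf hW) f))
    (hmul : ∀ (V : X.Opens) (h : V ≤ U) (g : MvPolynomial (Fin n) (RSec X.presheaf V)),
      ∀ f ∈ MvPolynomial.idealOfVars (Fin n) (RSec X.presheaf V) ^ k,
        Φ V h (g * f) = polyEv A x h g • Φ V h f) :
    ∃ φ : homSec (idealPMod A k) G.mod U, ∀ (V : X.Opens) (h : V ≤ U),
      ∀ f ∈ MvPolynomial.idealOfVars (Fin n) (RSec X.presheaf V) ^ k,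
        ∀ ha : polyEv A x h f ∈ idealPow A k V,
          homApp φ h (mkIdeal A k (polyEv A x h f) ha) = Φ V h f := by
  have hres' : ∀ (V W : X.Opens) (h : V ≤ U) (hW : W ≤ V) (a : idealPow A k V) (t : MSec G.mod V),
      EvRel x k Φ V h a t → EvRel x k Φ W (hW.trans h)
        ⟨rres A.ring hW a.1, rres_mem_idealPow A k hW a.2⟩ (mres G.mod hW t) := by
    rintro V W h hW a t ⟨f, hf, hfa, rfl⟩
    exact ⟨_, map_mem_pow_idealOfVars _ k hf, by rw [← rres_polyEv A x h hW, hfa],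
      hres V W h hW f hf⟩
  have hmul' : ∀ (V : X.Opens) (h : V ≤ U) (g : MvPolynomial (Fin n) (RSec X.presheaf V))
      (a : idealPow A k V) (t : MSec G.mod V), EvRel x k Φ V h a t →
        EvRel x k Φ V h (polyEv A x h g • a) (polyEv A x h g • t) := by
    rintro V h g a t ⟨f, hf, hfa, rfl⟩
    exact ⟨g * f, Ideal.mul_mem_left _ _ hf, by rw [map_mul, hfa]; rfl, (hmul V h g f hf).symm⟩
  have hex := exists_homSec_of_rel (M := idealPMod A k) (N := G.mod) (U := U) G.isSheaf
    (fun V h a t => EvRel x k Φ V h a t) (fun V W h hW a t => hres' V W h hW a t)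
    (by
      rintro V h a t t' ⟨f, -, hfa, rfl⟩ ⟨g, -, hga, rfl⟩
      rw [hx.injective V h (hfa.trans hga.symm)])
    (by
      rintro V h a b t t' ⟨f, hf, hfa, rfl⟩ ⟨g, hg, hga, rfl⟩
      exact ⟨f + g, add_mem hf hg, by rw [map_add, hfa, hga]; rfl, (map_add (Φ V h) f g).symm⟩)
    (by
      intro V h r a t z hz hat
      obtain ⟨W, hW, hzW, g, hg⟩ := hx.exists_polyEv_eq V h r z hz
      refine ⟨W, hW, hzW, ?_⟩
      have h₁ := hmul' W (hW.trans h) g _ _ (hres' V W h hW a t hat)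
      rw [hg] at h₁
      have h₂ : mres G.mod hW (r • t) = rres A.ring hW r • mres G.mod hW t := mres_smul _ _ _ _
      rw [h₂]
      have h₃ : mres (idealPMod A k) hW (r • a) =
        rres A.ring hW r • mres (idealPMod A k) hW a := mres_smul _ _ _ _
      rw [h₃]
      exact h₁)
    (by
      intro V h a z hz
      obtain ⟨W, hW, hzW, f, hf, hfa⟩ := exists_polyEv_eq_of_mem_idealPow hx h k
        (show idealPow A k V from a).2 hz
      exact ⟨W, hW, hzW, Φ W _ f, f, hf, hfa, rfl⟩)
  obtain ⟨φ, hφ⟩ := hex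
  exact ⟨φ, fun V h f hf ha => hφ V h _ _ ⟨f, hf, rfl, rfl⟩⟩

/-- Homogeneous sections `m_j` of `G` with `x_i^N m_j = x_j^N m_i` define a morphism of degree `p`
on a power of `I` with `x_j^N ↦ m_j`. -/
theorem exists_grHom_of_numerators (hx : IsPolyChart A x) {N : ℕ} {m : Fin n → MSec G.mod U}
    (hdeg : ∀ j, m j ∈ G.deg (N + p) U)
    (hm : ∀ i j, polyEv A x le_rfl (MvPolynomial.X i ^ N) • m j =
      polyEv A x le_rfl (MvPolynomial.X j ^ N) • m i) {k : ℕ} (hk : n * N < k) :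
    ∃ φ : grHom G k p U, ∀ (j : Fin n)
      (ha : polyEv A x le_rfl (MvPolynomial.X j ^ k) ∈ idealPow A k U),
      homApp φ.1 le_rfl (mkIdeal A k _ ha) =
        polyEv A x le_rfl (MvPolynomial.X j ^ (k - N)) • m j := by
  have hk' : Fintype.card (Fin n) * N < k := by rwa [Fintype.card_fin]
  choose Φ hΦ using fun (V : X.Opens) (h : V ≤ U) =>
    exists_extend_monomials (polyEv A x h) (smul_mres_numerators hm h)
  have hres : ∀ (V W : X.Opens) (h : V ≤ U) (hW : W ≤ V),
      ∀ f ∈ MvPolynomial.idealOfVars (Fin n) (RSec X.presheaf V) ^ k,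
        mres G.mod hW (Φ V h f) = Φ W (hW.trans h) (MvPolynomial.map (rres X.presheaf hW) f) := by
    intro V W h hW f hf
    refine induction_on_mem_pow_idealOfVars (motive := fun f => mres G.mod hW (Φ V h f) =
      Φ W (hW.trans h) (MvPolynomial.map (rres X.presheaf hW) f)) hk' (by simp only [map_zero])
      (fun f g hf hg => by simp only [map_add, hf, hg]) hf fun β _ j hj => ?_
    rw [hΦ V h β j _ hj, MvPolynomial.map_monomial, hΦ W _ β j _ hj, mres_smul, mres_mres,
      rres_polyEv, MvPolynomial.map_monomial]
  obtain ⟨φ, hφ⟩ := exists_homSec_of_polynomials hx hres fun V h g f hf =>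
    map_mul_of_mem_pow hk' (hΦ V h) g hf
  refine ⟨⟨φ, fun V h i a ha hai => G.of_locally fun z hz => ?_⟩, fun j ha => ?_⟩
  · obtain ⟨W, hW, hzW, f, hf, hfa⟩ := exists_polyEv_eq_of_mem_idealPow hx h k ha hz
    have hai' : polyEv A x (hW.trans h) f ∈ A.deg i W := hfa ▸ A.res_mem hW hai
    obtain ⟨W', hW', hzW', hfi⟩ := isHomogeneous_of_polyEv_mem hx (hW.trans h) hai' hzW
    refine ⟨W', hW'.trans hW, hzW', ?_⟩
    have hf' := map_mem_pow_idealOfVars (rres X.presheaf hW') k hf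
    have hfa' : polyEv A x (hW'.trans (hW.trans h)) (MvPolynomial.map (rres X.presheaf hW') f) =
        rres A.ring (hW'.trans hW) a := by
      rw [← rres_polyEv A x (hW.trans h) hW', hfa, rres_rres]
    have ha' := rres_mem_idealPow A k (hW'.trans hW) ha
    have h₁ : mres G.mod (hW'.trans hW) (homApp φ h (mkIdeal A k a ha)) =
        Φ W' (hW'.trans (hW.trans h)) (MvPolynomial.map (rres X.presheaf hW') f) := by
      rw [mres_homApp, mres_mkIdeal, ← hφ W' _ _ hf' (hfa' ▸ ha')]
      congr 2
      exact hfa'.symm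
    rw [h₁]
    refine induction_on_mem_pow_idealOfVars
      (motive := fun g => Φ W' (hW'.trans (hW.trans h)) g ∈ G.deg (i + p) W') hk'
      (by rw [map_zero]; exact zero_mem _)
      (fun f g hf hg => by rw [map_add]; exact add_mem hf hg) hf' fun β hβ j hj => ?_
    have hβi : β.degree = i := by
      rw [Finsupp.degree_eq_weight_one]
      exact hfi (MvPolynomial.mem_support_iff.1 hβ)
    have hle : Finsupp.single j N ≤ β := Finsupp.single_le_iff.2 hj
    have hβN : (β - Finsupp.single j N).degree + N = i := by
      have h₂ := congrArg Finsupp.degree (tsub_add_cancel_of_le hle)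
      rwa [map_add, Finsupp.degree_single, hβi] at h₂
    rw [hΦ W' _ β j _ hj]
    have h₂ := G.smul_mem (polyEv_mem_deg hx (hW'.trans (hW.trans h))
      (MvPolynomial.isHomogeneous_monomial (d := β - Finsupp.single j N)
        (MvPolynomial.coeff β (MvPolynomial.map (rres X.presheaf hW') f)) rfl))
      (G.res_mem (hW'.trans (hW.trans h)) (hdeg j))
    rwa [← add_assoc, ← Nat.cast_add, hβN] at h₂
  · have hkN : N ≤ k := by
      have := Fin.pos j
      nlinarith
    have hX : MvPolynomial.X j ^ k ∈
        MvPolynomial.idealOfVars (Fin n) (RSec X.presheaf U) ^ k :=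
      Ideal.pow_mem_pow (Ideal.subset_span (Set.mem_range_self j)) k
    refine (hφ U le_rfl _ hX ha).trans ?_
    rw [MvPolynomial.X_pow_eq_monomial, hΦ U le_rfl _ j _ (by rwa [Finsupp.single_eq_same]),
      mres_self, ← Finsupp.single_tsub, ← MvPolynomial.X_pow_eq_monomial]

end Extend

/-! ### Local bijectivity of the canonical morphism -/

section Main

variable {X : Scheme.{u}} {n : ℕ} {A : GrAlg X} {U : X.Opens} {x : Fin n → RSec A.ring U}
  {G : GrMod A} {p : ℤ}

/-- The `x_j` have no common zero in `Proj`. -/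
theorem exists_notMem_ideal (hx : IsPolyChart A x) (y : ProjPoint A) (hy : y.pt ∈ U) :
    ∃ j, agerm A hy (x j) ∉ y.ideal := by
  obtain ⟨i, V, hyV, hi, s, hs, hsy⟩ := y.relevant
  have e : U ⊓ V ≤ V := inf_le_right
  have hyUV : y.pt ∈ U ⊓ V := ⟨hy, hyV⟩
  obtain ⟨W, hW, hyW, f, hf, hfs⟩ :=
    hx.exists_homogeneous (U ⊓ V) inf_le_left i _ (A.res_mem e hs) y.pt hyUV
  obtain ⟨j, hj⟩ := exists_X_notMem hf hi
    (P := y.ideal.comap ((agerm A hyW).comp (polyEv A x (hW.trans inf_le_left)))) (by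
      rwa [Ideal.mem_comap, RingHom.comp_apply, hfs, agerm_rres, agerm_rres])
  refine ⟨j, ?_⟩
  rwa [Ideal.mem_comap, RingHom.comp_apply, polyEv_X, agerm_rres] at hj

/-- The maps `φ ↦ φ(g) / g` are jointly surjective over an affine chart. -/
theorem exists_unitImage_eq (hU : IsAffineOpen U) (hx : IsPolyChart A x)
    (hG : IsLocalizingOn (toPMod G.toModules) U) (t : tildeSec G p (preim A U)) :
    ∃ (k : ℕ) (φ : grHom G k p U), unitImage G k p U φ = t := by
  obtain ⟨N, m, hfrac, hm⟩ := exists_compatible_numerators hU hx hG t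
  obtain ⟨φ, hφ⟩ := exists_grHom_of_numerators hx (fun j => (hfrac j).mem_deg) hm
    (Nat.lt_succ_self (n * N))
  refine ⟨n * N + 1, φ, Subtype.ext (funext fun y => ?_)⟩
  change value G φ y = t.1 y
  obtain ⟨j, hj⟩ := exists_notMem_ideal hx y.1 (pt_mem y)
  have hX : ∀ i, agerm A (pt_mem y) (polyEv A x le_rfl (MvPolynomial.X j ^ i)) ∉ y.1.ideal := by
    intro i h
    rw [map_pow, map_pow, polyEv_X, rres_self] at h
    exact hj (y.1.isPrime.mem_of_pow_mem i h)
  have hkN : N ≤ n * N + 1 := by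
    have := Fin.pos j
    nlinarith
  have ha : polyEv A x le_rfl (MvPolynomial.X j ^ (n * N + 1)) ∈ idealPow A (n * N + 1) U :=
    polyEv_mem_idealPow hx le_rfl _
      (Ideal.pow_mem_pow (Ideal.subset_span (Set.mem_range_self j)) _)
  refine fib_cancel G (hX (n * N + 1)) ((smul_value G φ y le_rfl (pt_mem y) _ ha).trans ?_)
  rw [hφ j ha, ggerm_smul, map_smul, ← (hfrac j).smul_eq y (hX N), smul_smul, ← map_mul,
    ← map_mul, ← pow_add, Nat.sub_add_cancel hkN]

/-- Over an affine chart, a morphism `φ` on `I^k` for which `φ(g) / g` is zero vanishes on some `I^l`. -/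
theorem exists_grHomTrans_eq_zero (hU : IsAffineOpen U) (hx : IsPolyChart A x)
    (hG : IsLocalizingOn (toPMod G.toModules) U) {k : ℕ} (φ : grHom G k p U)
    (hφ : unitImage G k p U φ = 0) :
    ∃ (l : ℕ) (hl : k ≤ l), grHomTrans G hl p U φ = 0 := by
  have hX : ∀ (V : X.Opens) (h : V ≤ U) (j : Fin n),
      polyEv A x h (MvPolynomial.X j ^ k) ∈ idealPow A k V := fun V h j =>
    polyEv_mem_idealPow hx h _ (Ideal.pow_mem_pow (Ideal.subset_span (Set.mem_range_self j)) _)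
  let m : Fin n → MSec G.mod U := fun j => homApp φ.1 le_rfl (mkIdeal A k _ (hX U le_rfl j))
  have hm : ∀ j, m j ∈ G.deg (k + p) U := fun j =>
    φ.2 U le_rfl k _ _ (polyEv_mem_deg hx le_rfl (MvPolynomial.isHomogeneous_X_pow j k))
  choose L hL using fun j => exists_pow_smul_eq_zero_of_toFib hU hx hG (hm j)
    (MvPolynomial.isHomogeneous_X (RSec X.presheaf U) j) one_pos fun y hy _ => by
      refine (smul_value G φ ⟨y, hy⟩ le_rfl hy _ (hX U le_rfl j)).symm.trans ?_
      have h₁ : value G φ ⟨y, hy⟩ = 0 := congrArg (fun t => t.1 ⟨y, hy⟩) hφ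
      rw [h₁, smul_zero]
  obtain ⟨K, hK⟩ : ∃ K, ∀ j, L j ≤ K :=
    ⟨Finset.univ.sup L, fun j => Finset.le_sup (Finset.mem_univ j)⟩
  have hzero : ∀ (V : X.Opens) (h : V ≤ U) (j : Fin n),
      polyEv A x h (MvPolynomial.X j ^ K) •
        homApp φ.1 h (mkIdeal A k _ (hX V h j)) = 0 := by
    intro V h j
    have h₁ : polyEv A x le_rfl (MvPolynomial.X j ^ K) • m j = 0 := by
      rw [← Nat.sub_add_cancel (hK j), pow_add, map_mul, mul_smul, map_pow _ _ (L j), hL j,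
        smul_zero]
    have h₂ := congrArg (mres G.mod h) h₁
    rw [mres_smul, rres_polyEv, map_pow (MvPolynomial.map _), MvPolynomial.map_X, map_zero,
      mres_homApp, mres_mkIdeal] at h₂
    refine Eq.trans ?_ h₂
    congr 3
    rw [rres_polyEv, map_pow (MvPolynomial.map _), MvPolynomial.map_X]
  -- A monomial of degree larger than `n * (K + k)` is divisible by `x_j ^ K * x_j ^ k` for some `j`;
  -- the summand `k` ensures `k ≤ l` when `n = 0`.
  refine ⟨n * (K + k) + 1 + k, Nat.le_add_left _ _, Subtype.ext (homSec_ext fun V h a => ?_)⟩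
  obtain ⟨a, ha⟩ : idealPow A (n * (K + k) + 1 + k) V := a
  change homApp φ.1 h (mkIdeal A k a (idealPow_le A (Nat.le_add_left _ _) V ha)) = 0
  refine eq_of_locally_of_mem G.isSheaf _ _ fun z hz => ?_
  obtain ⟨W, hW, hzW, f, hf, hfa⟩ := exists_polyEv_eq_of_mem_idealPow hx h _ ha hz
  refine ⟨W, hW, hzW, ?_⟩
  obtain ⟨hfk, h₁⟩ : ∃ hfk : polyEv A x (hW.trans h) f ∈ idealPow A k W,
      homApp φ.1 (hW.trans h) (mkIdeal A k _ hfk) = 0 := by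
    refine induction_on_mem_pow_idealOfVars (N := K + k) (motive := fun f =>
      ∃ hfk : polyEv A x (hW.trans h) f ∈ idealPow A k W,
        homApp φ.1 (hW.trans h) (mkIdeal A k _ hfk) = 0) (by rw [Fintype.card_fin]; omega) ?_ ?_ hf ?_
    · refine ⟨by rw [map_zero]; exact zero_mem _, ?_⟩
      refine Eq.trans ?_ (map_zero (homApp φ.1 (hW.trans h)))
      congr 1
    · rintro f g ⟨hf, hf'⟩ ⟨hg, hg'⟩
      refine ⟨by rw [map_add]; exact add_mem hf hg, ?_⟩
      refine Eq.trans ?_ ((map_add (homApp φ.1 (hW.trans h)) (mkIdeal A k _ hf)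
        (mkIdeal A k _ hg)).trans (by rw [hf', hg', add_zero]))
      congr 1
      exact Subtype.ext (map_add _ _ _)
    · intro β _ j hj
      have e : polyEv A x (hW.trans h) (MvPolynomial.monomial β (f.coeff β)) =
          polyEv A x (hW.trans h) (MvPolynomial.monomial (β - Finsupp.single j (K + k))
            (f.coeff β)) * polyEv A x (hW.trans h) (MvPolynomial.X j ^ K) *
            polyEv A x (hW.trans h) (MvPolynomial.X j ^ k) := by
        rw [← map_mul, ← map_mul, mul_assoc, ← pow_add, ← MvPolynomial.monomial_add_single,
          tsub_add_cancel_of_le (Finsupp.single_le_iff.2 hj)]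
      refine ⟨e ▸ Ideal.mul_mem_left _ _ (hX W (hW.trans h) j), ?_⟩
      refine Eq.trans ?_ ((map_smul (homApp φ.1 (hW.trans h)) (polyEv A x (hW.trans h)
        (MvPolynomial.monomial (β - Finsupp.single j (K + k)) (f.coeff β)) *
          polyEv A x (hW.trans h) (MvPolynomial.X j ^ K)) (mkIdeal A k _ (hX W (hW.trans h) j))).trans ?_)
      · congr 1
        exact Subtype.ext e
      · rw [mul_smul, hzero, smul_zero]
  rw [mres_homApp, mres_mkIdeal, map_zero]
  refine Eq.trans ?_ h₁
  congr 1
  exact Subtype.ext hfa.symm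

theorem IsFrame.restrict {F : PMod X.presheaf} {U V : X.Opens} {x : Fin n → MSec F U}
    (hx : IsFrame F x) (h : V ≤ U) : IsFrame F fun j => mres F h (x j) := by
  intro W hW
  have := hx W (hW.trans h)
  simpa only [mres_mres] using this

theorem exists_affine_chart {E : X.Modules} (hE : IsVectorBundle E n) (U : X.Opens) {z : X}
    (hz : z ∈ U) : ∃ (V : X.Opens) (_ : V ≤ U), z ∈ V ∧ IsAffineOpen V ∧
      ∃ x : Fin n → RSec (symAlg (dual E)).ring V, IsPolyChart (symAlg (dual E)) x := by
  obtain ⟨U', hzU', e, he⟩ := hE z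
  obtain ⟨V, hV, hzV, hVU⟩ := exists_isAffineOpen_mem_and_subset
    (show z ∈ U ⊓ U' from ⟨hz, hzU'⟩)
  have he' := IsFrame.restrict (F := toPMod E) he (hVU.trans inf_le_right : V ≤ U')
  exact ⟨V, hVU.trans inf_le_left, hzV, hV, _,
    isPolyChart_symAlg _ (isFrame_dualFrame E he')⟩

/-- The open subset `V` is affine, `A` is a polynomial algebra in `n` variables over `V`, and the
sections of `G` over the basic open subsets of `V` are localizations of those over `V`. -/
structure IsGood (n : ℕ) (G : GrMod A) (V : X.Opens) : Prop where
  isAffineOpen : IsAffineOpen V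
  exists_isPolyChart : ∃ x : Fin n → RSec A.ring V, IsPolyChart A x
  isLocalizingOn : IsLocalizingOn (toPMod G.toModules) V

theorem locallySurjective_of_isGood (p : ℤ) (H : ∀ (U : X.Opens) (z : X), z ∈ U →
    ∃ (V : X.Opens) (_ : V ≤ U), z ∈ V ∧ IsGood n G V) : LocallySurjective G p := by
  intro U t z hz
  obtain ⟨V, hV, hzV, hVa, ⟨x, hx⟩, hG⟩ := H U z hz
  obtain ⟨k, φ, hφ⟩ := exists_unitImage_eq hVa hx hG (tildeRes G p (preim_mono hV) t)
  exact ⟨V, hV, k, φ, hzV, hφ⟩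

theorem unitImage_grHomRes_eq_zero {k : ℕ} {φ : grHom G k p U} (hφ : unitImage G k p U φ = 0)
    {V : X.Opens} (hV : V ≤ U) : unitImage G k p V (grHomRes G k p hV φ) = 0 :=
  (unitImage_res G k p hV φ).trans ((congrArg (tildeRes G p (preim_mono hV)) hφ).trans
    (tildeRes G p (preim_mono hV)).map_zero)

theorem IsGood.exists_grHomTrans_eq_zero {V : X.Opens} (h : IsGood n G V) {k : ℕ}
    {φ : grHom G k p U} (hφ : unitImage G k p U φ = 0) (hV : V ≤ U) :
    ∃ (l : ℕ) (hl : k ≤ l), grHomTrans G hl p V (grHomRes G k p hV φ) = 0 :=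
  h.exists_isPolyChart.elim fun _ hx => GradedLocalization.exists_grHomTrans_eq_zero
    h.isAffineOpen hx h.isLocalizingOn (grHomRes G k p hV φ) (unitImage_grHomRes_eq_zero hφ hV)

theorem locallyInjective_of_isGood (p : ℤ) (H : ∀ (U : X.Opens) (z : X), z ∈ U →
    ∃ (V : X.Opens) (_ : V ≤ U), z ∈ V ∧ IsGood n G V) : LocallyInjective G p := by
  intro k U φ hφ z hz
  obtain ⟨V, hV, hzV, h⟩ := H U z hz
  exact (h.exists_grHomTrans_eq_zero (p := p) (k := k) hφ hV).elim fun l h' =>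
    h'.elim fun hl h'' => ⟨V, hV, l, hl, hzV, h''⟩

theorem exists_isGood {E : X.Modules} (hE : IsVectorBundle E n) {G : GrMod (symAlg (dual E))}
    (hG : G.IsQuasicoherent) (U : X.Opens) (z : X) (hz : z ∈ U) :
    ∃ (V : X.Opens) (_ : V ≤ U), z ∈ V ∧ IsGood n G V := by
  have : SheafOfModules.IsQuasicoherent (R := X.ringCatSheaf) G.toModules := hG
  obtain ⟨V, hV, hzV, hVa, hx⟩ := exists_affine_chart hE U hz
  exact ⟨V, hV, hzV, hVa, hx, isLocalizingOn_of_isQuasicoherent G.toModules hVa⟩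

end Main

end GradedLocalization

end

theorem proposition3p5 (X : Scheme.{u}) [IsLocallyNoetherian X] (n : ℕ) (hn : 0 < n)
    (E : X.Modules) (hE : GradedLocalization.IsVectorBundle E n)
    (G : GradedLocalization.GrMod (GradedLocalization.symAlg (GradedLocalization.dual E)))
    (hG : G.IsQuasicoherent) :
    (∀ (i : ℕ) (p : ℤ) (U : X.Opens)
      (a : (GradedLocalization.symAlg (GradedLocalization.dual E)).deg i U)
      (s : GradedLocalization.MSec
        (GradedLocalization.toPMod (GradedLocalization.grLoc G p)) U),
      GradedLocalization.canonicalSec G (i + p) U (GradedLocalization.grLocMul G i p U a s) =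
        GradedLocalization.tildeMul G i p U a (GradedLocalization.canonicalSec G p U s)) ∧
    (∀ p : ℤ, IsIso (GradedLocalization.canonicalMap G p)) ∧
    IsIso (Limits.Sigma.map fun p : ℤ => GradedLocalization.canonicalMap G p) := by
  have hsurj := fun p : ℤ => GradedLocalization.locallySurjective_of_isGood p
    (GradedLocalization.exists_isGood hE hG)
  have hiso : ∀ p : ℤ, IsIso (GradedLocalization.canonicalMap G p) := fun p =>
    (GradedLocalization.nonempty_isColimit_unitCocone
      (GradedLocalization.locallyInjective_of_isGood p
        (GradedLocalization.exists_isGood hE hG)) (hsurj p)).elim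
      fun h => GradedLocalization.isIso_canonicalMap_of_isColimit h
  exact ⟨fun i p U a s => GradedLocalization.canonicalSec_grLocMul i p (hsurj p) U a s, hiso,
    inferInstance⟩
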